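/- For a group $G$, let $I_G$ be the set of involutions of $G$ (elements of order exactly $2$) and let $I_G^{(2)}$ be the set of ordered pairs of distinct involutions; $G$ acts on both by conjugation. Let $D_{\mathbb Z}=\mathbb Z/2\mathbb Z\ltimes\mathbb Z$ be the infinite dihedral group and $D_{\mathbb Q}=\mathbb Z/2\mathbb Z\ltimes\mathbb Q$ the group of isometries $x\mapsto\pm x+q$ of $\mathbb Q$. A subgroup $H\le G$ is malnormal (resp. quasi-malnormal) if $H\cap gHg^{-1}$ is trivial (resp. has at most $2$ elements) for every $g\in G\setminus H$. A pair $(u,v)\in I_G^{(2)}$ is of type $D_{\mathbb Z}$ if $\langle u,v\rangle$ is contained in a quasi-malnormal subgroup of $G$ isomorphic to $D_{\mathbb Z}$, and of type $D_{\mathbb Q}$ if $\langle u,v\rangle$ is contained in a subgroup of $G$ isomorphic to $D_{\mathbb Q}$. The group $G$ belongs to the class $\mathcal C$ if (1) $G$ acts transitively on $I_G$ and freely on $I_G^{(2)}$; (2) every pair in $I_G^{(2)}$ is of type $D_{\mathbb Z}$ or $D_{\mathbb Q}$; (3) the set of pairs of type $D_{\mathbb Q}$ is non-empty and $G$ acts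 transitively on it. An element $h\in G$ of infinite order is a translation if it is the product of two distinct involutions, a homothety if it centralizes some involution, and isolated if it is contained in a malnormal cyclic subgroup of $G$. The group $G$ belongs to the class $\mathcal C'$ if it belongs to $\mathcal C$, all its elements have order $1$, $2$ or $\infty$, and every element of infinite order is a translation, a homothety or isolated. Finally, $G$ is sharply $2$-transitive if it acts on some set $X$ with at least two elements in such a way that for any two ordered pairs $(x_1,x_2)$, $(y_1,y_2)$ of distinct elements of $X$ there is a unique $g\in G$ with $gx_1=y_1$ and $gx_2=y_2$. **Theorem.** Let $G_0$ be a countable group belonging to $\mathcal C'$. Then there exists a countable group $G$ containing $G_0$ (that is, with an injective homomorphism $G_0\to G$) such that - $G$ is sharply $2$-transitive and belongs to $\mathcal C'$; - $G$ has exactly four conjugacy classes: $\{1\}$, the set of involutions, the set of translations and the set of homotheties. -/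

import Mathlib

universe u

namespace SharpTwo

variable {G : Type*} [Group G]

/-- The set of involutions of `G` (elements of order exactly two). -/
def involutions (G : Type*) [Group G] : Set G := {g | orderOf g = 2}

/-- The conjugate subgroup `g H g⁻¹`. -/
def conjSubgroup (g : G) (H : Subgroup G) : Subgroup G :=
  H.map (MulAut.conj g).toMonoidHom

/-- `H` is malnormal: `H ∩ g H g⁻¹` is trivial for every `g ∉ H`. -/
def IsMalnormal (H : Subgroup G) : Prop :=
  ∀ g : G, g ∉ H → H ⊓ conjSubgroup g H = ⊥

/-- `H` is quasi-malnormal: `H ∩ g H g⁻¹` has at most two elements for every `g ∉ H`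
(the extended cardinality is used, so that an infinite intersection is excluded). -/
def IsQuasiMalnormal (H : Subgroup G) : Prop :=
  ∀ g : G, g ∉ H → ((H ⊓ conjSubgroup g H : Subgroup G) : Set G).encard ≤ 2

/-- The action of `{1, -1}` (the group `ℤ/2ℤ`) on an abelian group, `-1` acting by inversion. -/
def signAction (A : Type*) [CommGroup A] : ℤˣ →* MulAut A where
  toFun e :=
    { toFun := fun a => a ^ (e : ℤ)
      invFun := fun a => a ^ (e : ℤ)
      left_inv := fun a => by
        change (a ^ (e : ℤ)) ^ (e : ℤ) = a
        rw [← zpow_mul, ← Units.val_mul, Int.units_mul_self, Units.val_one, zpow_one]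
      right_inv := fun a => by
        change (a ^ (e : ℤ)) ^ (e : ℤ) = a
        rw [← zpow_mul, ← Units.val_mul, Int.units_mul_self, Units.val_one, zpow_one]
      map_mul' := fun a b => mul_zpow a b _ }
  map_one' := by
    ext a
    change a ^ ((1 : ℤˣ) : ℤ) = a
    rw [Units.val_one, zpow_one]
  map_mul' e f := by
    ext a
    change a ^ ((e * f : ℤˣ) : ℤ) = (a ^ (f : ℤ)) ^ (e : ℤ)
    rw [← zpow_mul, Units.val_mul, mul_comm]

/-- The infinite dihedral group `ℤ/2ℤ ⋉ ℤ`. -/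
abbrev DInt : Type := DihedralGroup 0

/-- The group `ℤ/2ℤ ⋉ ℚ` of isometries `x ↦ ±x + q` of `ℚ`. -/
abbrev DRat : Type := Multiplicative ℚ ⋊[signAction (Multiplicative ℚ)] ℤˣ

/-- `(u, v)` is an ordered pair of distinct involutions. -/
def IsInvolutionPair (u v : G) : Prop :=
  u ∈ involutions G ∧ v ∈ involutions G ∧ u ≠ v

/-- The pair of distinct involutions `(u, v)` is of type `D_ℤ`: `⟨u, v⟩` is contained in a
quasi-malnormal infinite dihedral subgroup. -/
def IsTypeInt (u v : G) : Prop :=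
  IsInvolutionPair u v ∧ ∃ D : Subgroup G, Subgroup.closure {u, v} ≤ D ∧
    Nonempty (D ≃* DInt) ∧ IsQuasiMalnormal D

/-- The pair of distinct involutions `(u, v)` is of type `D_ℚ`: `⟨u, v⟩` is contained in a
subgroup isomorphic to `ℤ/2ℤ ⋉ ℚ`. -/
def IsTypeRat (u v : G) : Prop :=
  IsInvolutionPair u v ∧ ∃ D : Subgroup G, Subgroup.closure {u, v} ≤ D ∧
    Nonempty (D ≃* DRat)

/-- The class `𝒞`; `G` acts by conjugation on its involutions and on the ordered pairs of
distinct involutions. -/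
structure ClassC (G : Type*) [Group G] : Prop where
  transitive : ∀ u ∈ involutions G, ∀ v ∈ involutions G, ∃ g : G, g * u * g⁻¹ = v
  free : ∀ u v : G, IsInvolutionPair u v →
    ∀ g : G, g * u * g⁻¹ = u → g * v * g⁻¹ = v → g = 1
  type_or : ∀ u v : G, IsInvolutionPair u v → IsTypeInt u v ∨ IsTypeRat u v
  exists_typeRat : ∃ u v : G, IsTypeRat u v
  transitive_typeRat : ∀ u v u' v' : G, IsTypeRat u v → IsTypeRat u' v' →
    ∃ g : G, g * u * g⁻¹ = u' ∧ g * v * g⁻¹ = v'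

/-- Elements of infinite order that are a product of two distinct involutions. -/
def translations (G : Type*) [Group G] : Set G :=
  {h | ¬ IsOfFinOrder h ∧ ∃ u v : G, IsInvolutionPair u v ∧ h = u * v}

/-- Elements of infinite order that centralize some involution. -/
def homotheties (G : Type*) [Group G] : Set G :=
  {h | ¬ IsOfFinOrder h ∧ ∃ u ∈ involutions G, h * u = u * h}

/-- Elements of infinite order that lie in a malnormal cyclic subgroup. -/
def isolatedElements (G : Type*) [Group G] : Set G :=
  {h | ¬ IsOfFinOrder h ∧ ∃ k : G, h ∈ Subgroup.zpowers k ∧ IsMalnormal (Subgroup.zpowers k)}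

/-- Every element has order `1`, `2` or `∞`, and every element of infinite order is a
translation, a homothety or isolated. -/
def ThreeTypeCondition (G : Type*) [Group G] : Prop :=
  (∀ h : G, IsOfFinOrder h → orderOf h = 1 ∨ orderOf h = 2) ∧
  ∀ h : G, ¬ IsOfFinOrder h →
    h ∈ translations G ∨ h ∈ homotheties G ∨ h ∈ isolatedElements G

/-- The class `𝒞'`. -/
def ClassC' (G : Type*) [Group G] : Prop :=
  ClassC G ∧ ThreeTypeCondition G

/-- `G` acts sharply 2-transitively on some set with at least two elements. The set may be taken
in the universe of `G`, since a transitive `G`-set is a quotient of `G`. -/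
def IsSharplyTwoTransitive (G : Type u) [Group G] : Prop :=
  ∃ (X : Type u) (_ : MulAction G X), Nontrivial X ∧
    ∀ x₁ x₂ y₁ y₂ : X, x₁ ≠ x₂ → y₁ ≠ y₂ → ∃! g : G, g • x₁ = y₁ ∧ g • x₂ = y₂

end SharpTwo

/-!
The group `G` is the union of a chain of HNN extensions starting with `G₀`, along which the
obstructions to the conclusion are removed one by one. Three kinds of extension are used: a stable
letter conjugates

* a quasi-malnormal infinite dihedral subgroup to the subgroup generated by a pair of involutions of
  type `D_ℚ`, so that the pairs in the former acquire type `D_ℚ`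
  (`SharpTwo.exists_extension_isTypeRat`);
* `⟨h, w⟩` to `⟨h', w⟩` for two homotheties centralizing the same involution `w`
  (`SharpTwo.exists_extension_conj_homotheties`);
* a malnormal infinite cyclic subgroup to the subgroup generated by a homothety, so that an isolated
  element becomes a homothety (`SharpTwo.exists_extension_mem_homotheties`).

What has to be shown is that the class `𝒞'` is preserved. An HNN extension `Γ` of `G` acts on its
Bass–Serre tree, realized as the set of cosets of `G` with the distance given by the length of
normal forms. In all three cases the pointwise stabilizer of a line of the tree either is trivial
or contains exactly one involution. If the associated subgroup `A` meets its other conjugates and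
those of `B` in torsion elements only, this holds since each line has a vertex whose two edges on
the line are not both of the kind stabilized by `B` (`HNNExtension.exists_line_stabilizer_le`,
`HNNExtension.isTreeExtension_of_torsion`). If both associated subgroups centralize a common
involution `w`, a nontrivial element fixing the line forces the conjugates of `w` attached to its
edges to coincide (`HNNExtension.isTreeExtension_of_centralizer`).

Given this, the elements of `Γ` are understood through their fixed vertices and axes
(`SharpTwo.IsTreeExtension.classC'`). An element fixing a vertex is conjugate into `G`. If the axis
of an element is fixed pointwise by an involution, the element centralizes this involution and is a
homothety. Otherwise the stabilizer of the axis acts faithfully on it, so that it is infinite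
cyclic or infinite dihedral; since an element has only one axis, the stabilizer is malnormal in the
first case and quasi-malnormal in the second. The element is isolated in the first case; in the
second it is a translation, and pairs of involutions with this product are of type `D_ℤ`. Freeness
of the action on pairs of distinct involutions means that a nontrivial element centralizes at most
one involution, which is read off from the fixed vertices and axes of the elements involved.

A bookkeeping of pairs of elements (`SharpTwo.exists_chain`) ensures that in the union all pairs of
distinct involutions are of type `D_ℚ`, every element of infinite order is a translation or a
homothety, and all homotheties are conjugate. Then the action by conjugation on the set of
involutions is sharply 2-transitive (`SharpTwo.isSharplyTwoTransitive_of_isTypeRat`), and there are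
four conjugacy classes (`SharpTwo.conjClasses_eq`).
-/

/-! ### Trees as metric spaces and their isometries -/

/-- The distance function of (the vertex set of) a simplicial tree: an integral metric that is
geodesic, has no odd triangle and satisfies the four-point condition of `0`-hyperbolicity. -/
structure IsTreeDist {V : Type*} (d : V → V → ℕ) : Prop where
  self (x : V) : d x x = 0
  eq_of_dist (x y : V) : d x y = 0 → x = y
  comm (x y : V) : d x y = d y x
  triangle (x y z : V) : d x z ≤ d x y + d y z
  four (x y z w : V) :
    d x y + d z w ≤ d x z + d y w ∨ d x y + d z w ≤ d x w + d y z
  even (x y z : V) : (d x y + d y z + d x z) % 2 = 0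
  geod (x y : V) (k : ℕ) : k ≤ d x y → ∃ z, d x z = k ∧ d z y + k = d x y

/-- An action by isometries, without inversion of edges, for a given tree distance. -/
structure IsTreeAction (Γ : Type*) [Group Γ] {V : Type*} [MulAction Γ V] (d : V → V → ℕ) : Prop
    extends IsTreeDist d where
  isom (g : Γ) (x y : V) : d (g • x) (g • y) = d x y
  no_inversion (g : Γ) (x y : V) : d x y = 1 → g • x = y → g • y ≠ x

/-- A bi-infinite geodesic. -/
def IsTreeLine {V : Type*} (d : V → V → ℕ) (L : ℤ → V) : Prop :=
  ∀ i j : ℤ, (d (L i) (L j) : ℤ) = |i - j|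

namespace IsTreeDist

variable {V : Type*} {d : V → V → ℕ}

theorem eq_of_between (hd : IsTreeDist d) {x y a b : V} (h1 : d x a + d a y = d x y)
    (h2 : d x b = d x a) (h3 : d b y = d a y) : a = b := by
  apply hd.eq_of_dist
  have := hd.four a b x y
  have := hd.comm a x
  have := hd.comm b x
  omega

/-- A distance function for which every vertex `x ≠ y` has exactly one neighbour closer to `y`,
all the other neighbours being farther from `y`, is a tree distance. -/
theorem of_unique_closer_neighbour {d : V → V → ℕ} (self : ∀ x, d x x = 0)
    (eq0 : ∀ x y, d x y = 0 → x = y) (comm : ∀ x y, d x y = d y x)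
    (ex : ∀ x y, x ≠ y → ∃ z, d x z = 1 ∧ d z y + 1 = d x y)
    (uniq : ∀ x y z z', d x z = 1 → d x z' = 1 → d z y + 1 = d x y → d z' y + 1 = d x y → z = z')
    (pm : ∀ x y z, d x z = 1 → d z y = d x y + 1 ∨ d z y + 1 = d x y) : IsTreeDist d := by
  have tri : ∀ n x y z, d x y = n → d x z ≤ d x y + d y z := by
    intro n
    induction n with
    | zero =>
      intro x y z h
      rw [eq0 _ _ h]; omega
    | succ n ih =>
      intro x y z h
      obtain ⟨x', h1, h2⟩ := ex x y (by rintro rfl; rw [self] at h; omega)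
      have := ih x' y z (by omega)
      have := pm x z x' h1
      omega
  have ev : ∀ n x y z, d x y = n → (d x y + d y z + d x z) % 2 = 0 := by
    intro n
    induction n with
    | zero =>
      intro x y z h
      rw [eq0 _ _ h, self]; omega
    | succ n ih =>
      intro x y z h
      obtain ⟨x', h1, h2⟩ := ex x y (by rintro rfl; rw [self] at h; omega)
      have := ih x' y z (by omega)
      have := pm x z x' h1
      omega
  have geo : ∀ k x y, k ≤ d x y → ∃ z, d x z = k ∧ d z y + k = d x y := by
    intro k
    induction k with
    | zero => intro x y _; exact ⟨x, self x, rfl⟩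
    | succ k ih =>
      intro x y h
      obtain ⟨x', h1, h2⟩ := ex x y (by rintro rfl; rw [self] at h; omega)
      obtain ⟨z, h3, h4⟩ := ih x' y (by omega)
      refine ⟨z, ?_, by omega⟩
      have := tri _ x x' z rfl
      have := tri _ x z y rfl
      omega
  -- a path that starts by moving away from `w` keeps moving away from `w`
  have away : ∀ n x z y w, d x y = n → d x z = 1 → d z w = d x w + 1 → d z y + 1 = d x y →
      d w y = d w x + d x y := by
    intro n
    induction n with
    | zero => intros; omega
    | succ n ih =>
      intro x z y w hn h1 h2 h3
      have c1 := comm z w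
      have c2 := comm x w
      by_cases hzy : z = y
      · subst hzy; rw [self] at h3; omega
      · obtain ⟨z', h4, h5⟩ := ex z y hzy
        rcases pm z w z' h4 with h6 | h6
        · have := ih z z' y w (by omega) h4 h6 h5
          omega
        · have := uniq z w z' x h4 (by rw [comm]; exact h1) h6 h2.symm
          subst this
          omega
  have key : ∀ x y w x', x ≠ y → d w y ≤ d w x → d x x' = 1 → d x' w + 1 = d x w →
      d x' y + 1 = d x y := by
    intro x y w x' hxy hle h1 h2
    obtain ⟨z, h3, h4⟩ := ex x y hxy
    rcases pm x w z h3 with h5 | h5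
    · have := away _ x z y w rfl h3 h5 h4
      omega
    · rw [uniq x w x' z h1 h3 h2 h5]; exact h4
  have four : ∀ n x y z w, d w x + d w y + d w z = n →
      d x y + d z w ≤ d x z + d y w ∨ d x y + d z w ≤ d x w + d y z := by
    intro n
    induction n with
    | zero =>
      intro x y z w h
      rw [← eq0 w x (by omega), ← eq0 w y (by omega), ← eq0 w z (by omega)]
      simp
    | succ n ih =>
      intro x y z w h
      have cxw := comm x w
      have cyw := comm y w
      have czw := comm z w
      have cxy := comm x y
      have cyz := comm y z
      have cxz := comm x z
      by_cases e1 : x = y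
      · subst e1
        have := tri _ w x z rfl
        rw [self]; omega
      by_cases e2 : x = z
      · subst e2
        right; omega
      by_cases e3 : y = z
      · subst e3
        left; omega
      by_cases m1 : d w y ≤ d w x ∧ d w z ≤ d w x
      · obtain ⟨x', h1, h2⟩ := ex x w (by rintro rfl; rw [self] at *; omega)
        have := key x y w x' e1 m1.1 h1 h2
        have := key x z w x' e2 m1.2 h1 h2
        have := comm x' w
        have := ih x' y z w (by omega)
        omega
      by_cases m2 : d w x ≤ d w y ∧ d w z ≤ d w y
      · obtain ⟨y', h1, h2⟩ := ex y w (by rintro rfl; rw [self] at *; omega)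
        have := key y x w y' (Ne.symm e1) m2.1 h1 h2
        have := key y z w y' e3 m2.2 h1 h2
        have := comm y' w
        have := comm y' x
        have := ih x y' z w (by omega)
        omega
      · obtain ⟨z', h1, h2⟩ := ex z w (by rintro rfl; rw [self] at *; omega)
        have := key z x w z' (Ne.symm e2) (by omega) h1 h2
        have := key z y w z' (Ne.symm e3) (by omega) h1 h2
        have := comm z' w
        have := comm z' x
        have := comm z' y
        have := ih x y z' w (by omega)
        omega
  exact ⟨self, eq0, comm, fun x y z => tri _ x y z rfl, fun x y z w => four _ x y z w rfl,
    fun x y z => ev _ x y z rfl, fun x y k => geo k x y⟩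

/-- Three vertices have a median: the segments joining them pairwise have a common vertex. -/
theorem exists_median (hd : IsTreeDist d) (x y z : V) :
    ∃ m, d x m + d m y = d x y ∧ d y m + d m z = d y z ∧ d x m + d m z = d x z := by
  have h1 := hd.triangle x y z
  have h2 := hd.triangle x z y
  have h3 := hd.triangle y x z
  have h4 := hd.even x y z
  have h5 := hd.comm y z
  have h6 := hd.comm x y
  obtain ⟨m, hm1, hm2⟩ := hd.geod x y ((d x y + d x z - d y z) / 2) (by omega)
  have h7 := hd.four m z x y
  have h8 := hd.comm m x
  have h9 := hd.comm m y
  have h10 := hd.comm z y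
  have h11 := hd.comm z x
  have h12 := hd.triangle x m z
  have h13 := hd.triangle y m z
  exact ⟨m, by omega, by omega, by omega⟩

/-- The segments `[a, x]` and `[a, b]` coincide along their overlap. -/
theorem eq_of_overlap (hd : IsTreeDist d) {x a b z z' : V} {s : ℕ}
    (hs : 2 * s + d x b ≤ d x a + d a b) (h1 : d z a = s) (h2 : d x z + s = d x a)
    (h3 : d a z' = s) (h4 : d z' b + s = d a b) : z = z' := by
  apply hd.eq_of_dist
  have f1 := hd.four x z' a b
  have f2 := hd.four z z' x a
  rw [hd.comm z' a, h3] at f1 f2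
  rw [hd.comm z x, h1, hd.comm z' x] at f2
  omega

/-- The nearest-point projection to a line. -/
theorem exists_proj (hd : IsTreeDist d) {L : ℤ → V} (hL : IsTreeLine d L) (x : V) :
    ∃ (j₀ : ℤ) (D : ℕ), ∀ j, (d x (L j) : ℤ) = D + |j - j₀| := by
  obtain ⟨j₀, hmin⟩ : ∃ j₀, ∀ j, d x (L j₀) ≤ d x (L j) := by
    obtain ⟨_, ⟨j₀, rfl⟩, h⟩ := WellFounded.has_min (wellFounded_lt (α := ℕ))
      (Set.range fun j => d x (L j)) ⟨_, 0, rfl⟩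
    exact ⟨j₀, fun j => not_lt.1 (h _ ⟨j, rfl⟩)⟩
  have step : ∀ e : ℤ, |e| = 1 → d x (L (j₀ + e)) = d x (L j₀) + 1 := by
    intro e he
    have h1 := hL j₀ (j₀ + e)
    have h2 := hd.even x (L j₀) (L (j₀ + e))
    have h3 := hd.triangle x (L j₀) (L (j₀ + e))
    have h4 := hmin (j₀ + e)
    rw [show j₀ - (j₀ + e) = -e by ring, abs_neg, he] at h1
    omega
  have main : ∀ e : ℤ, |e| = 1 → ∀ n : ℕ, (d x (L (j₀ + e * n)) : ℤ) = d x (L j₀) + n := by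
    intro e he n
    have hs := step e he
    rcases Nat.eq_zero_or_pos n with rfl | hn
    · simp
    have h1 := hL j₀ (j₀ + e)
    have h2 := hL (j₀ + e) (j₀ + e * n)
    have h3 := hL j₀ (j₀ + e * n)
    have h4 := hd.four x (L (j₀ + e)) (L j₀) (L (j₀ + e * n))
    have h5 := hd.triangle x (L j₀) (L (j₀ + e * n))
    have h6 := hd.comm (L j₀) (L (j₀ + e))
    have a2 : |j₀ + e - (j₀ + e * n)| = n - 1 := by
      rw [show j₀ + e - (j₀ + e * n) = -(e * (n - 1)) by ring, abs_neg, abs_mul, he, one_mul,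
        abs_of_nonneg (by omega)]
    have a3 : |j₀ - (j₀ + e * n)| = n := by
      rw [show j₀ - (j₀ + e * n) = -(e * n) by ring, abs_neg, abs_mul, he, one_mul, Nat.abs_cast]
    rw [show j₀ - (j₀ + e) = -e by ring, abs_neg, he] at h1
    omega
  refine ⟨j₀, d x (L j₀), fun j => ?_⟩
  rcases le_total j₀ j with h | h
  · have := main 1 (by simp) (j - j₀).toNat
    rw [Int.toNat_of_nonneg (by omega)] at this
    rw [abs_of_nonneg (by omega), ← this]
    congr 3; ring
  · have := main (-1) (by simp) (j₀ - j).toNat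
    rw [Int.toNat_of_nonneg (by omega)] at this
    rw [abs_of_nonpos (by omega), show -(j - j₀) = j₀ - j by ring, ← this]
    congr 3; ring

end IsTreeDist

theorem IsTreeLine.injective {V : Type*} {d : V → V → ℕ} (hd : IsTreeDist d) {L : ℤ → V}
    (hL : IsTreeLine d L) : Function.Injective L := by
  intro i j h
  have := hL i j
  rw [h, hd.self] at this
  exact sub_eq_zero.1 (abs_eq_zero.1 this.symm)

/-- The isometries of `ℤ` are translations and reflections. -/
theorem int_isometry {f : ℤ → ℤ} (hf : ∀ i j, |f i - f j| = |i - j|) :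
    ∃ ε : ℤ, (ε = 1 ∨ ε = -1) ∧ ∀ i, f i = f 0 + ε * i := by
  have h1 := hf 1 0
  have : f 1 - f 0 = 1 ∨ f 1 - f 0 = -1 := (abs_eq zero_le_one).1 (by simpa using h1)
  rcases this with h | h
  · refine ⟨1, Or.inl rfl, fun i => ?_⟩
    have := abs_eq_abs.1 (hf i 0)
    have := abs_eq_abs.1 (hf i 1)
    omega
  · refine ⟨-1, Or.inr rfl, fun i => ?_⟩
    have := abs_eq_abs.1 (hf i 0)
    have := abs_eq_abs.1 (hf i 1)
    omega

namespace IsTreeAction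

variable {Γ V : Type*} [Group Γ] [MulAction Γ V] {d : V → V → ℕ}

theorem fixes_between (h : IsTreeAction Γ d) {g : Γ} {x y m : V} (hx : g • x = x) (hy : g • y = y)
    (hm : d x m + d m y = d x y) : g • m = m := by
  refine (h.eq_of_between hm ?_ ?_).symm
  · conv_lhs => rw [← hx]
    exact h.isom g x m
  · conv_lhs => rw [← hy]
    exact h.isom g m y

/-- If `g²` does not displace `x` farther than `g` does, then `g` fixes the midpoint of `[x, gx]`,
which is a vertex since inversions are excluded. -/
theorem exists_fixed_of_dist_le (h : IsTreeAction Γ d) {g : Γ} {x : V}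
    (hx : d x (g • g • x) ≤ d x (g • x)) :
    ∃ m, g • m = m ∧ d x m + d m (g • x) = d x (g • x) ∧ d x m = d m (g • x) := by
  have e1 := h.even x (g • x) (g • g • x)
  rw [h.isom g x (g • x)] at e1
  have i0 := h.isom g x (g • x)
  obtain ⟨k, hk⟩ | ⟨k, hk⟩ := Nat.even_or_odd (d x (g • x))
  · obtain ⟨y, hy1, hy2⟩ := h.geod x (g • x) k (by omega)
    have i2 := h.isom g x y
    have i3 := h.isom g y (g • x)
    have := h.toIsTreeDist.eq_of_overlap (x := x) (a := g • x) (b := g • g • x) (z := y)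
      (z' := g • y) (s := k) (by omega) (by omega) (by omega) (by omega) (by omega)
    exact ⟨y, this.symm, by omega, by omega⟩
  · exfalso
    obtain ⟨y, hy1, hy2⟩ := h.geod x (g • x) k (by omega)
    obtain ⟨z, hz1, hz2⟩ := h.geod x (g • x) (k + 1) (by omega)
    have i2 := h.isom g x y
    have i3 := h.isom g y (g • x)
    have i4 := h.isom g x z
    have i5 := h.isom g z (g • x)
    -- the two vertices of the middle edge of `[x, gx]` are exchanged
    have b3 : z = g • y := h.toIsTreeDist.eq_of_overlap (x := x) (a := g • x) (b := g • g • x)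
      (s := k) (by omega) (by omega) (by omega) (by omega) (by omega)
    have b4 : y = g • z := h.toIsTreeDist.eq_of_overlap (x := x) (a := g • x) (b := g • g • x)
      (s := k + 1) (by omega) (by omega) (by omega) (by omega) (by omega)
    have b5 : d y z = 1 := by
      have f := h.four y z x (g • x)
      have t := h.triangle x y z
      have c1 := h.comm y x
      have c4 := h.comm z x
      clear b3 b4 i0 i2 i3 i4 i5 e1 hx
      omega
    exact h.no_inversion g y z b5 b3.symm b4.symm

/-- If `y`, `gy`, `g²y` lie on a geodesic in this order, then so do all the vertices `gⁿy`. -/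
theorem dist_pow (h : IsTreeAction Γ d) {g : Γ} {y : V} (h2 : d y (g • g • y) = 2 * d y (g • y))
    (h0 : 0 < d y (g • y)) (n : ℕ) : d y (g ^ n • y) = n * d y (g • y) := by
  suffices ∀ n : ℕ, d y (g ^ n • y) = n * d y (g • y) ∧
      d y (g ^ (n + 1) • y) = (n + 1) * d y (g • y) from (this n).1
  intro n
  induction n with
  | zero => simp [h.self]
  | succ n ih =>
    refine ⟨by simpa using ih.2, ?_⟩
    have f := h.four y (g ^ (n + 1) • y) (g ^ n • y) (g ^ (n + 1 + 1) • y)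
    have i1 := h.isom (g ^ n) y (g • y)
    have i2 := h.isom (g ^ (n + 1)) y (g • y)
    have i3 := h.isom (g ^ n) y (g • g • y)
    simp only [smul_smul, ← pow_succ, ← mul_assoc] at i1 i2 i3
    have c := h.comm (g ^ (n + 1) • y) (g ^ n • y)
    have t := h.triangle y (g ^ (n + 1) • y) (g ^ (n + 1 + 1) • y)
    rw [smul_smul] at h2
    simp only [add_mul, one_mul] at *
    omega

theorem zpow_smul_line {g : Γ} {L : ℤ → V} {c : ℤ} (hg : ∀ i, g • L i = L (i + c)) (m : ℤ)
    (i : ℤ) : g ^ m • L i = L (i + m * c) := by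
  have hinv : ∀ i, g⁻¹ • L i = L (i - c) := by
    intro i
    rw [inv_smul_eq_iff, hg]; congr 1; ring
  induction m generalizing i with
  | zero => simp
  | succ n ih => rw [zpow_add_one, mul_smul, hg, ih]; congr 1; ring
  | pred n ih => rw [zpow_sub_one, mul_smul, hinv, ih]; congr 1; ring

/-- An element without fixed vertex translates a line. -/
theorem exists_axis (h : IsTreeAction Γ d) {g : Γ} (hg : ∀ x : V, g • x ≠ x) [Nonempty V] :
    ∃ (L : ℤ → V) (ℓ : ℤ), 0 < ℓ ∧ IsTreeLine d L ∧ ∀ i, g • L i = L (i + ℓ) := by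
  -- trimming `[x, gx]` by the overlap of `[x, gx]` and `[gx, g²x]` gives a fundamental segment
  obtain ⟨y, h0, h2⟩ : ∃ y, 0 < d y (g • y) ∧ d y (g • g • y) = 2 * d y (g • y) := by
    obtain ⟨x⟩ := ‹Nonempty V›
    have hlt : d x (g • x) < d x (g • g • x) := by
      by_contra hle
      obtain ⟨m, hm, -⟩ := h.exists_fixed_of_dist_le (not_lt.1 hle)
      exact hg m hm
    have e1 := h.even x (g • x) (g • g • x)
    have i1 := h.isom g x (g • x)
    have t1 := h.triangle x (g • x) (g • g • x)
    obtain ⟨y, hy1, hy2⟩ := h.geod x (g • x) ((2 * d x (g • x) - d x (g • g • x)) / 2) (by omega)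
    have i2 := h.isom g x y
    have i3 := h.isom g y (g • x)
    have i4 := h.isom g (g • x) (g • y)
    have i5 := h.isom g y (g • y)
    have f1 := h.four x (g • y) (g • x) (g • g • x)
    have f2 := h.four y (g • y) x (g • x)
    have c1 := h.comm y x
    have c2 := h.comm (g • y) (g • x)
    have c3 := h.comm (g • y) x
    have c4 := h.comm (g • g • y) (g • g • x)
    have t2 := h.triangle x y (g • g • y)
    have t3 := h.triangle x (g • g • y) (g • g • x)
    have t4 := h.triangle y (g • y) (g • x)
    have t5 := h.triangle y (g • y) (g • g • y)
    exact ⟨y, by omega, by omega⟩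
  obtain ⟨ℓ, hℓ⟩ : ∃ ℓ, ℓ = d y (g • y) := ⟨_, rfl⟩
  have hℓ0 : (0 : ℤ) < ℓ := by omega
  have hz : ∀ a b : ℤ, a ≤ b → (d (g ^ a • y) (g ^ b • y) : ℤ) = (b - a) * ℓ := by
    intro a b hab
    have e := h.isom (g ^ a) y (g ^ (b - a) • y)
    rw [smul_smul, ← zpow_add, add_sub_cancel] at e
    obtain ⟨n, hn⟩ := Int.eq_ofNat_of_zero_le (show 0 ≤ b - a by omega)
    rw [e, hn, zpow_natCast, h.dist_pow h2 h0, hℓ]; push_cast; ring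
  have hγ : ∀ r : ℕ, ∃ p, r ≤ ℓ → d y p = r ∧ d p (g • y) + r = ℓ := by
    intro r
    by_cases hr : r ≤ ℓ
    · obtain ⟨p, hp⟩ := h.geod y (g • y) r (by omega)
      exact ⟨p, fun _ => by rw [hℓ]; exact hp⟩
    · exact ⟨y, fun h => absurd h hr⟩
  choose γ hγ using hγ
  let L : ℤ → V := fun i => g ^ (i / ℓ) • γ (i % ℓ).toNat
  have hmod0 : ∀ i : ℤ, 0 ≤ i % ℓ := fun i => Int.emod_nonneg _ (by omega)
  have hmod1 : ∀ i : ℤ, i % ℓ < ℓ := fun i => Int.emod_lt_of_pos _ (by omega)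
  have hr : ∀ i : ℤ, (d (g ^ (i / ℓ) • y) (L i) : ℤ) = i % ℓ ∧
      (d (L i) (g ^ (i / ℓ + 1) • y) : ℤ) = ℓ - i % ℓ := by
    intro i
    have a := hmod0 i
    have b := hmod1 i
    have c := hγ (i % ℓ).toNat (by omega)
    have i1 := h.isom (g ^ (i / ℓ)) y (γ (i % ℓ).toNat)
    have i2 := h.isom (g ^ (i / ℓ)) (γ (i % ℓ).toNat) (g • y)
    rw [smul_smul, ← zpow_add_one] at i2
    constructor
    · change (d _ (g ^ (i / ℓ) • γ (i % ℓ).toNat) : ℤ) = _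
      omega
    · change (d (g ^ (i / ℓ) • γ (i % ℓ).toNat) _ : ℤ) = _
      omega
  have hle : ∀ i j : ℤ, i ≤ j → (d (L i) (L j) : ℤ) = j - i := by
    intro i j hij
    obtain ⟨a1, a2⟩ := hr i
    obtain ⟨b1, b2⟩ := hr j
    have ei := Int.emod_add_mul_ediv i ℓ
    have ej := Int.emod_add_mul_ediv j ℓ
    have hq : i / ℓ ≤ j / ℓ := Int.ediv_le_ediv hℓ0 hij
    have z1 := hz (i / ℓ) (j / ℓ + 1) (by omega)
    have t1 := h.triangle (g ^ (i / ℓ) • y) (L i) (g ^ (j / ℓ + 1) • y)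
    have t2 := h.triangle (L i) (L j) (g ^ (j / ℓ + 1) • y)
    have low : (d (L i) (L j) : ℤ) ≥ j - i := by
      have : (j / ℓ + 1 - i / ℓ) * ℓ = ℓ * (j / ℓ) - ℓ * (i / ℓ) + ℓ := by ring
      omega
    refine le_antisymm ?_ low
    rcases eq_or_lt_of_le hq with hq | hq
    · have z2 := hz (j / ℓ) (j / ℓ + 1) (by omega)
      rw [add_sub_cancel_left, one_mul] at z2
      rw [hq] at a1 a2 ei
      have f := h.four (L i) (L j) (g ^ (j / ℓ) • y) (g ^ (j / ℓ + 1) • y)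
      have c1 := h.comm (g ^ (j / ℓ) • y) (L i)
      have c2 := h.comm (g ^ (j / ℓ) • y) (L j)
      omega
    · have z2 := hz (i / ℓ + 1) (j / ℓ) (by omega)
      have t3 := h.triangle (L i) (g ^ (i / ℓ + 1) • y) (L j)
      have t4 := h.triangle (g ^ (i / ℓ + 1) • y) (g ^ (j / ℓ) • y) (L j)
      have : (j / ℓ - (i / ℓ + 1)) * ℓ = ℓ * (j / ℓ) - ℓ * (i / ℓ) - ℓ := by ring
      omega
  refine ⟨L, ℓ, hℓ0, ?_, ?_⟩
  · intro i j
    rcases le_total i j with hij | hij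
    · rw [hle i j hij, abs_of_nonpos (by omega)]; ring
    · rw [h.comm, hle j i hij, abs_of_nonneg (by omega)]
  · intro i
    change g • g ^ (i / ℓ) • γ (i % ℓ).toNat = g ^ ((i + ℓ) / ℓ) • γ ((i + ℓ) % ℓ).toNat
    rw [Int.add_ediv_of_dvd_right (dvd_refl _), Int.ediv_self (by omega), Int.add_emod_right,
      smul_smul, ← zpow_one_add, add_comm 1]

/-- An element translating a line by `c ≠ 0` moves every vertex by `|c|` plus twice the distance
to the line. -/
theorem dist_smul_eq (h : IsTreeAction Γ d) {g : Γ} {L : ℤ → V} (hL : IsTreeLine d L) {c : ℤ}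
    (hc : c ≠ 0) (hg : ∀ i, g • L i = L (i + c)) (x : V) :
    |c| ≤ d x (g • x) ∧ ((d x (g • x) : ℤ) = |c| ↔ x ∈ Set.range L) := by
  obtain ⟨j, D, hj⟩ := h.exists_proj hL x
  have h1 := hj j
  have h2 := hj (j + c)
  have h3 := hj (j - c)
  have i1 := h.isom g x (L j)
  have i2 := h.isom g x (L (j - c))
  rw [hg] at i1 i2
  rw [sub_add_cancel] at i2
  have l := hL j (j + c)
  have f := h.four x (L (j + c)) (g • x) (L j)
  have f' := h.four x (g • x) (L j) (L (j + c))
  have c1 := h.comm (L (j + c)) (g • x)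
  have c2 := h.comm (L (j + c)) (L j)
  have c3 := h.comm (g • x) (L j)
  rw [sub_self, abs_zero] at h1
  rw [add_sub_cancel_left] at h2
  rw [sub_sub_cancel_left, abs_neg] at h3
  rw [sub_add_cancel_left, abs_neg] at l
  have hpos : 0 < |c| := abs_pos.2 hc
  have key : (d x (g • x) : ℤ) = |c| + 2 * D := by omega
  refine ⟨by omega, fun e => ⟨j, ?_⟩, ?_⟩
  · exact (h.eq_of_dist _ _ (by omega)).symm
  · rintro ⟨i, rfl⟩
    rw [hg, hL, sub_add_cancel_left, abs_neg]

theorem smul_line_isLine (h : IsTreeAction Γ d) {L : ℤ → V} (hL : IsTreeLine d L) (g : Γ) :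
    IsTreeLine d fun i => g • L i := fun i j => by
  rw [h.isom, hL]

/-- The axis of an element is determined by the element. -/
theorem range_axis_eq (h : IsTreeAction Γ d) {g : Γ} {L L' : ℤ → V} (hL : IsTreeLine d L)
    (hL' : IsTreeLine d L') {c c' : ℤ} (hc : c ≠ 0) (hc' : c' ≠ 0)
    (hg : ∀ i, g • L i = L (i + c)) (hg' : ∀ i, g • L' i = L' (i + c')) :
    Set.range L = Set.range L' := by
  have e : |c| = |c'| := by
    have h1 := (h.dist_smul_eq hL hc hg (L' 0)).1
    have h2 := (h.dist_smul_eq hL' hc' hg' (L 0)).1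
    have h3 := (h.dist_smul_eq hL hc hg (L 0)).2.2 ⟨0, rfl⟩
    have h4 := (h.dist_smul_eq hL' hc' hg' (L' 0)).2.2 ⟨0, rfl⟩
    omega
  ext x
  rw [← (h.dist_smul_eq hL hc hg x).2, ← (h.dist_smul_eq hL' hc' hg' x).2, e]

/-- An element preserving a line acts on it as an isometry of `ℤ`. -/
theorem exists_sign_shift (h : IsTreeAction Γ d) {k : Γ} {L : ℤ → V} (hL : IsTreeLine d L)
    (hk : ∀ i, k • L i ∈ Set.range L) :
    ∃ ε c : ℤ, (ε = 1 ∨ ε = -1) ∧ ∀ i, k • L i = L (c + ε * i) := by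
  choose f hf using hk
  obtain ⟨ε, hε, hfε⟩ := int_isometry (f := f) fun i j => by
    rw [← hL (f i) (f j), hf, hf, h.isom, hL]
  exact ⟨ε, f 0, hε, fun i => by rw [← hfε, hf]⟩

/-- An element fixing a vertex and preserving the orientation of a line fixes the line
pointwise. -/
theorem shift_eq_zero_of_fixed (h : IsTreeAction Γ d) {k : Γ} {L : ℤ → V} (hL : IsTreeLine d L)
    {c : ℤ} (hk : ∀ i, k • L i = L (i + c)) {x : V} (hx : k • x = x) : c = 0 := by
  by_contra hc
  have := (h.dist_smul_eq hL hc hk x).1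
  rw [hx, h.self] at this
  exact hc (abs_eq_zero.1 (le_antisymm (by exact_mod_cast this) (abs_nonneg c)))

/-- A conjugating element maps the axis of an element to the axis of its conjugate. -/
theorem smul_axis_mem_range (h : IsTreeAction Γ d) {g k g' : Γ} {L : ℤ → V} (hL : IsTreeLine d L)
    {c c' : ℤ} (hc : c ≠ 0) (hc' : c' ≠ 0) (hg : ∀ i, g • L i = L (i + c))
    (hg' : ∀ i, g' • L i = L (i + c')) (hk : k * g * k⁻¹ = g') (i : ℤ) :
    k • L i ∈ Set.range L := by
  rw [h.range_axis_eq hL (h.smul_line_isLine hL k) hc' hc hg' (fun i => ?_)]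
  · exact ⟨i, rfl⟩
  · rw [← hg, smul_smul, smul_smul, ← hk]; simp

/-- An element commuting with a translation of a line, and fixing a vertex, fixes the line
pointwise. -/
theorem fixes_axis_of_commute (h : IsTreeAction Γ d) {g k : Γ} {L : ℤ → V} (hL : IsTreeLine d L)
    {c : ℤ} (hc : c ≠ 0) (hg : ∀ i, g • L i = L (i + c)) (hk : k * g = g * k) {x : V}
    (hx : k • x = x) (i : ℤ) : k • L i = L i := by
  obtain ⟨ε, e, hε, hke⟩ := h.exists_sign_shift hL
    (h.smul_axis_mem_range hL hc hc hg hg (k := k) (by rw [hk]; simp))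
  have hinj := hL.injective h.toIsTreeDist
  have e1 : k • g • L 0 = g • k • L 0 := by rw [smul_smul, smul_smul, hk]
  rw [hg, hke, hke, hg] at e1
  have e2 := hinj e1
  have : ε = 1 := by
    rcases hε with rfl | rfl
    · rfl
    · exfalso; omega
  subst this
  have := h.shift_eq_zero_of_fixed hL (c := e) (fun i => by rw [hke]; congr 1; ring) hx
  rw [hke, this]; congr 1; ring

/-- An involution fixes the midpoint of the segment from a vertex to its image. -/
theorem exists_fixed_of_sq_eq_one (h : IsTreeAction Γ d) {g : Γ} (hg : g * g = 1) (x : V) :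
    ∃ m, g • m = m ∧ d x m + d m (g • x) = d x (g • x) ∧ d x m = d m (g • x) := by
  apply h.exists_fixed_of_dist_le
  rw [smul_smul, hg, one_smul, h.self]
  exact Nat.zero_le _

theorem exists_fixed_of_isOfFinOrder (h : IsTreeAction Γ d) [Nonempty V] {g : Γ}
    (hg : IsOfFinOrder g) : ∃ x : V, g • x = x := by
  by_contra! hne
  obtain ⟨L, ℓ, hℓ, hL, hgL⟩ := h.exists_axis hne
  obtain ⟨n, hn, hgn⟩ := isOfFinOrder_iff_pow_eq_one.1 hg
  have := zpow_smul_line hgL n 0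
  rw [zpow_natCast, hgn, one_smul] at this
  have := hL.injective h.toIsTreeDist this
  have : (0 : ℤ) < n * ℓ := by positivity
  omega

/-- Two involutions whose product fixes a vertex have a common fixed vertex. -/
theorem exists_common_fixed_of_mul (h : IsTreeAction Γ d) {u v : Γ} (hu : u * u = 1)
    (hv : v * v = 1) {x : V} (hx : (u * v) • x = x) : ∃ m : V, u • m = m ∧ v • m = m := by
  obtain ⟨m, hm, hm1, hm2⟩ := h.exists_fixed_of_sq_eq_one hu x
  obtain ⟨n, hn, hn1, hn2⟩ := h.exists_fixed_of_sq_eq_one hv x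
  have e : v • x = u • x := by
    rw [mul_smul] at hx
    calc v • x = u • u • v • x := by rw [smul_smul u u, hu, one_smul]
      _ = u • x := by rw [hx]
  rw [e] at hn1 hn2
  have : m = n := h.eq_of_between hm1 (by omega) (by omega)
  exact ⟨m, hm, this ▸ hn⟩

/-- An involution and an element fixing a vertex that commute have a common fixed vertex. -/
theorem exists_common_fixed_of_commute (h : IsTreeAction Γ d) {u g : Γ} (hu : u * u = 1)
    (hug : g * u = u * g) {x : V} (hx : g • x = x) : ∃ m : V, u • m = m ∧ g • m = m := by
  obtain ⟨m, hm, hm1, -⟩ := h.exists_fixed_of_sq_eq_one hu x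
  refine ⟨m, hm, h.fixes_between hx ?_ hm1⟩
  rw [smul_smul, hug, mul_smul, hx]

end IsTreeAction

/-! ### Involutions, dihedral groups and the class `𝒞` -/

namespace SharpTwo

section Algebra

variable {G : Type*} [Group G] {H : Type*} [Group H]

theorem mem_involutions_iff {u : G} : u ∈ involutions G ↔ u * u = 1 ∧ u ≠ 1 := by
  change orderOf u = 2 ↔ _
  rw [orderOf_eq_prime_iff, pow_two]

theorem involution_inv {u : G} (hu : u ∈ involutions G) : u⁻¹ = u :=
  inv_eq_of_mul_eq_one_left (mem_involutions_iff.1 hu).1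

theorem isOfFinOrder_of_involution {u : G} (hu : u ∈ involutions G) : IsOfFinOrder u :=
  orderOf_pos_iff.1 (by rw [show orderOf u = 2 from hu]; norm_num)

theorem isOfFinOrder_of_zpow {x : G} {n : ℤ} (hn : n ≠ 0) (h : IsOfFinOrder (x ^ n)) :
    IsOfFinOrder x := by
  obtain ⟨m, hm, h⟩ := isOfFinOrder_iff_zpow_eq_one.1 h
  exact isOfFinOrder_iff_zpow_eq_one.2 ⟨n * m, mul_ne_zero hn hm, by rw [zpow_mul, h]⟩

theorem map_mem_involutions {f : G →* H} (hf : Function.Injective f) {u : G} :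
    f u ∈ involutions H ↔ u ∈ involutions G := by
  change orderOf (f u) = 2 ↔ orderOf u = 2
  rw [orderOf_injective f hf]

theorem IsInvolutionPair.map_iff {f : G →* H} (hf : Function.Injective f) {u v : G} :
    IsInvolutionPair (f u) (f v) ↔ IsInvolutionPair u v := by
  simp only [IsInvolutionPair, map_mem_involutions hf, ne_eq, hf.eq_iff]

theorem conj_injective (g : G) : Function.Injective (MulAut.conj g).toMonoidHom :=
  (MulAut.conj g).injective

theorem conj_mem_involutions {u : G} (g : G) : g * u * g⁻¹ ∈ involutions G ↔ u ∈ involutions G :=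
  map_mem_involutions (conj_injective g)

theorem IsTypeRat.map {f : G →* H} (hf : Function.Injective f) {u v : G} (h : IsTypeRat u v) :
    IsTypeRat (f u) (f v) := by
  obtain ⟨hp, D, hD, ⟨e⟩⟩ := h
  refine ⟨(IsInvolutionPair.map_iff hf).2 hp, D.map f, ?_,
    ⟨(D.equivMapOfInjective f hf).symm.trans e⟩⟩
  rw [Subgroup.closure_le] at hD ⊢
  rintro _ (rfl | rfl)
  · exact ⟨u, hD (by simp), rfl⟩
  · exact ⟨v, hD (by simp), rfl⟩

theorem IsTypeRat.conj {u v : G} (h : IsTypeRat u v) (g : G) :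
    IsTypeRat (g * u * g⁻¹) (g * v * g⁻¹) := h.map (conj_injective g)

theorem isTypeRat_conj_iff {u v : G} (g : G) :
    IsTypeRat (g * u * g⁻¹) (g * v * g⁻¹) ↔ IsTypeRat u v :=
  ⟨fun h => by simpa [mul_assoc] using h.conj g⁻¹, fun h => h.conj g⟩

theorem mem_conjSubgroup_iff {g x : G} {K : Subgroup G} :
    x ∈ conjSubgroup g K ↔ g⁻¹ * x * g ∈ K := by
  constructor
  · rintro ⟨y, hy, rfl⟩
    simpa [mul_assoc] using hy
  · intro h
    exact ⟨_, h, by simp [mul_assoc]⟩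

theorem isMalnormal_iff {K : Subgroup G} :
    IsMalnormal K ↔ ∀ g ∉ K, ∀ x ∈ K, g⁻¹ * x * g ∈ K → x = 1 := by
  simp only [IsMalnormal, Subgroup.eq_bot_iff_forall, Subgroup.mem_inf, mem_conjSubgroup_iff]
  exact ⟨fun h g hg x hx hgx => h g hg x ⟨hx, hgx⟩, fun h g hg x hx => h g hg x hx.1 hx.2⟩

/-- The features shared by the infinite dihedral group and `ℤ/2ℤ ⋉ ℚ`: the elements of finite order
are trivial or involutions, the product of two distinct involutions has infinite order, and every
element of infinite order is mapped by conjugation to itself or its inverse, being inverted by at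
least two involutions. -/
structure IsDihedralLike (D : Type*) [Group D] : Prop where
  torsion (x : D) : IsOfFinOrder x → x = 1 ∨ x ∈ involutions D
  mul_infinite (u v : D) : IsInvolutionPair u v → ¬ IsOfFinOrder (u * v)
  conj_eq (x g : D) : ¬ IsOfFinOrder x → g * x * g⁻¹ = x ∨ g * x * g⁻¹ = x⁻¹
  inverted (x : D) : ¬ IsOfFinOrder x →
    ∃ a b, IsInvolutionPair a b ∧ a * x * a⁻¹ = x⁻¹ ∧ b * x * b⁻¹ = x⁻¹

theorem isOfFinOrder_map_iff {f : G →* H} (hf : Function.Injective f) {x : G} :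
    IsOfFinOrder (f x) ↔ IsOfFinOrder x := hf.isOfFinOrder_iff

theorem IsDihedralLike.of_equiv (h : IsDihedralLike G) (e : H ≃* G) : IsDihedralLike H := by
  have hi : Function.Injective e.toMonoidHom := e.injective
  have hs : ∀ y, e (e.symm y) = y := e.apply_symm_apply
  constructor
  · intro x hx
    rcases h.torsion (e x) ((isOfFinOrder_map_iff hi).2 hx) with h1 | h1
    · left; simpa using h1
    · right; exact (map_mem_involutions hi).1 h1
  · intro u v huv hf
    refine h.mul_infinite (e u) (e v) ((IsInvolutionPair.map_iff hi).2 huv) ?_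
    rw [← map_mul]; exact (isOfFinOrder_map_iff hi).2 hf
  · intro x g hx
    rcases h.conj_eq (e x) (e g) (fun hf => hx ((isOfFinOrder_map_iff hi).1 hf)) with h1 | h1
    · left; apply e.injective; simpa using h1
    · right; apply e.injective; simpa using h1
  · intro x hx
    obtain ⟨a, b, hab, h1, h2⟩ := h.inverted (e x) (fun hf => hx ((isOfFinOrder_map_iff hi).1 hf))
    refine ⟨e.symm a, e.symm b, (IsInvolutionPair.map_iff hi).1 ?_, ?_, ?_⟩
    · change IsInvolutionPair (e (e.symm a)) (e (e.symm b))
      rwa [hs, hs]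
    · apply e.injective; simpa using h1
    · apply e.injective; simpa using h2

theorem isOfFinOrder_coe {D : Subgroup G} {x : D} : IsOfFinOrder (x : G) ↔ IsOfFinOrder x :=
  isOfFinOrder_map_iff (f := D.subtype) D.subtype_injective

namespace IsDihedralLike

variable {D : Subgroup G}

theorem coe_torsion (h : IsDihedralLike D) {x : G} (hx : x ∈ D) (hf : IsOfFinOrder x) :
    x = 1 ∨ x ∈ involutions G := by
  rcases h.torsion ⟨x, hx⟩ (isOfFinOrder_coe.1 hf) with h1 | h1
  · left; simpa using h1
  · right; exact (map_mem_involutions D.subtype_injective).2 h1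

theorem coe_mul_infinite (h : IsDihedralLike D) {u v : G} (hu : u ∈ D) (hv : v ∈ D)
    (huv : IsInvolutionPair u v) : ¬ IsOfFinOrder (u * v) := fun hf =>
  h.mul_infinite ⟨u, hu⟩ ⟨v, hv⟩ ((IsInvolutionPair.map_iff D.subtype_injective).1 huv)
    (isOfFinOrder_coe.1 hf)

theorem coe_conj_eq (h : IsDihedralLike D) {x g : G} (hx : x ∈ D) (hg : g ∈ D)
    (hf : ¬ IsOfFinOrder x) : g * x * g⁻¹ = x ∨ g * x * g⁻¹ = x⁻¹ := by
  have := h.conj_eq ⟨x, hx⟩ ⟨g, hg⟩ (fun hf' => hf (isOfFinOrder_coe.2 hf'))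
  simpa [Subtype.ext_iff] using this

theorem coe_inverted (h : IsDihedralLike D) {x : G} (hx : x ∈ D) (hf : ¬ IsOfFinOrder x) :
    ∃ a b, IsInvolutionPair a b ∧ a * x * a⁻¹ = x⁻¹ ∧ b * x * b⁻¹ = x⁻¹ := by
  obtain ⟨a, b, hab, h1, h2⟩ := h.inverted ⟨x, hx⟩ (fun hf' => hf (isOfFinOrder_coe.2 hf'))
  exact ⟨a, b, (IsInvolutionPair.map_iff D.subtype_injective).2 hab,
    by simpa [Subtype.ext_iff] using h1, by simpa [Subtype.ext_iff] using h2⟩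

/-- A subgroup of a dihedral-like group has at most two elements or contains an element of infinite
order. -/
theorem encard_le_two_iff (h : IsDihedralLike D) {S : Subgroup G} (hS : S ≤ D) :
    (S : Set G).encard ≤ 2 ↔ ∀ x ∈ S, IsOfFinOrder x := by
  constructor
  · intro hc x hx
    have hfin : (S : Set G).Finite := Set.finite_of_encard_le_coe (k := 2) hc
    have : Finite S := hfin
    exact isOfFinOrder_coe.2 (isOfFinOrder_of_finite (⟨x, hx⟩ : S))
  · intro hx
    by_contra hc
    obtain ⟨a, ha, ha1⟩ : ∃ a ∈ S, a ≠ 1 := by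
      by_contra! hne
      refine hc ((Set.encard_le_encard (t := {1}) fun a ha => hne a ha).trans ?_)
      simp
    obtain ⟨b, hb, hb1, hba⟩ : ∃ b ∈ S, b ≠ 1 ∧ b ≠ a := by
      by_contra! hne
      refine hc ((Set.encard_le_encard (t := {1, a}) fun b hb => ?_).trans
        (Set.encard_pair (Ne.symm ha1)).le)
      by_cases hb1 : b = 1
      · exact Or.inl hb1
      · exact Or.inr (hne b hb hb1)
    have ha' := (h.coe_torsion (hS ha) (hx a ha)).resolve_left ha1
    have hb' := (h.coe_torsion (hS hb) (hx b hb)).resolve_left hb1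
    exact h.coe_mul_infinite (hS hb) (hS ha) ⟨hb', ha', hba⟩ (hx _ (S.mul_mem hb ha))

theorem isQuasiMalnormal_iff (h : IsDihedralLike D) : IsQuasiMalnormal D ↔
    ∀ g ∉ D, ∀ x ∈ D, g⁻¹ * x * g ∈ D → IsOfFinOrder x := by
  constructor
  · intro hD g hg x hx hgx
    exact (h.encard_le_two_iff inf_le_left).1 (hD g hg) x
      (Subgroup.mem_inf.2 ⟨hx, mem_conjSubgroup_iff.2 hgx⟩)
  · intro hD g hg
    refine (h.encard_le_two_iff inf_le_left).2 fun x hx => ?_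
    rw [Subgroup.mem_inf, mem_conjSubgroup_iff] at hx
    exact hD g hg x hx.1 hx.2

/-- A quasi-malnormal dihedral-like subgroup contains every element normalizing the subgroup
generated by one of its elements of infinite order. -/
theorem mem_of_conj_eq (h : IsDihedralLike D) (hD : IsQuasiMalnormal D) {x g : G} (hx : x ∈ D)
    (hf : ¬ IsOfFinOrder x) (hg : g * x * g⁻¹ = x ∨ g * x * g⁻¹ = x⁻¹) : g ∈ D := by
  by_contra hgD
  refine hf (h.isQuasiMalnormal_iff.1 hD g⁻¹ (fun h' => hgD (by simpa using D.inv_mem h')) x hx ?_)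
  rw [inv_inv]
  rcases hg with hg | hg <;> rw [hg]
  · exact hx
  · exact D.inv_mem hx

theorem le_of_mem (h : IsDihedralLike D) (hD : IsQuasiMalnormal D) {E : Subgroup G}
    (hE : IsDihedralLike E) {x : G} (hx : x ∈ D) (hx' : x ∈ E) (hf : ¬ IsOfFinOrder x) : E ≤ D :=
  fun _ hg => h.mem_of_conj_eq hD hx hf (hE.coe_conj_eq hx' hg hf)

end IsDihedralLike

theorem DInt.isOfFinOrder_r {i : ZMod 0} (h : IsOfFinOrder (DihedralGroup.r i : DInt)) :
    i = 0 := by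
  obtain ⟨n, hn, h1⟩ := isOfFinOrder_iff_pow_eq_one.1 h
  rw [DihedralGroup.r_pow, DihedralGroup.one_def, DihedralGroup.r.injEq] at h1
  rcases mul_eq_zero.1 h1 with h3 | h3
  · exact h3
  · exact absurd (Nat.cast_eq_zero.1 h3) hn.ne'

theorem DInt.sr_mem (i : ZMod 0) : (DihedralGroup.sr i : DInt) ∈ involutions DInt :=
  DihedralGroup.orderOf_sr i

theorem DInt.exists_sr {u : DInt} (hu : u ∈ involutions DInt) :
    ∃ i : ZMod 0, u = DihedralGroup.sr i := by
  rcases u with i | i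
  · exfalso
    have := DInt.isOfFinOrder_r (i := i) (isOfFinOrder_of_involution hu)
    exact (mem_involutions_iff.1 hu).2 (by rw [DihedralGroup.one_def, this])
  · exact ⟨i, rfl⟩

theorem DInt.exists_r {x : DInt} (hx : ¬ IsOfFinOrder x) :
    ∃ i : ZMod 0, x = DihedralGroup.r i := by
  rcases x with i | i
  · exact ⟨i, rfl⟩
  · exact absurd (isOfFinOrder_of_involution (DInt.sr_mem i)) hx

theorem isDihedralLike_DInt : IsDihedralLike DInt := by
  constructor
  · rintro (i | i) hx
    · left
      rw [DihedralGroup.one_def, DInt.isOfFinOrder_r hx]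
    · exact Or.inr (DInt.sr_mem i)
  · rintro u v ⟨hu, hv, huv⟩ hf
    obtain ⟨i, rfl⟩ := DInt.exists_sr hu
    obtain ⟨j, rfl⟩ := DInt.exists_sr hv
    rw [DihedralGroup.sr_mul_sr] at hf
    exact huv (by rw [sub_eq_zero.1 (DInt.isOfFinOrder_r hf)])
  · intro x g hx
    obtain ⟨i, rfl⟩ := DInt.exists_r hx
    rcases g with j | j
    · left; simp
    · right; simp
  · intro x hx
    obtain ⟨i, rfl⟩ := DInt.exists_r hx
    refine ⟨DihedralGroup.sr 0, DihedralGroup.sr 1, ⟨DInt.sr_mem 0, DInt.sr_mem 1, ?_⟩, ?_, ?_⟩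
    · intro h
      rw [DihedralGroup.sr.injEq] at h
      exact zero_ne_one (α := ℤ) h
    · simp
    · simp

theorem DInt.exists_no_root {x : DInt} (hx : ¬ IsOfFinOrder x) : ∃ n : ℕ, 0 < n ∧
    ∀ y : DInt, y ^ n ≠ x := by
  obtain ⟨i, rfl⟩ := DInt.exists_r hx
  refine ⟨Int.natAbs i + 1, by omega, fun y hy => ?_⟩
  have hyf : ¬ IsOfFinOrder y := fun h => hx (by rw [← hy]; exact h.pow)
  obtain ⟨j, rfl⟩ := DInt.exists_r hyf
  rw [DihedralGroup.r_pow, DihedralGroup.r.injEq] at hy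
  have hi : i ≠ 0 := by
    rintro rfl
    exact hx (by rw [← DihedralGroup.one_def]; exact IsOfFinOrder.one)
  have no_root : ∀ a b : ℤ, a ≠ 0 → b * ((a.natAbs + 1 : ℕ) : ℤ) ≠ a := by
    intro a b ha hb
    have h3 := congrArg Int.natAbs hb
    rw [Int.natAbs_mul, Int.natAbs_natCast] at h3
    have hj : 0 < b.natAbs := by
      rcases Nat.eq_zero_or_pos b.natAbs with h | h
      · rw [h] at h3; omega
      · exact h
    have := Nat.le_mul_of_pos_left (a.natAbs + 1) hj
    omega
  exact no_root i j hi hy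

theorem DRat.left_pow (q : Multiplicative ℚ) (n : ℕ) :
    ((⟨q, 1⟩ : DRat)) ^ n = ⟨q ^ n, 1⟩ := by
  change (SemidirectProduct.inl q : DRat) ^ n = SemidirectProduct.inl (q ^ n)
  rw [map_pow]

theorem DRat.isOfFinOrder_left {q : Multiplicative ℚ} (h : IsOfFinOrder (⟨q, 1⟩ : DRat)) :
    q = 1 := by
  obtain ⟨n, hn, h1⟩ := isOfFinOrder_iff_pow_eq_one.1 h
  rw [DRat.left_pow] at h1
  have h2 : q ^ n = 1 := congrArg SemidirectProduct.left h1
  have h3 : (n : ℚ) * q.toAdd = 0 := by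
    have := congrArg Multiplicative.toAdd h2
    simpa using this
  rcases mul_eq_zero.1 h3 with h4 | h4
  · exfalso; exact hn.ne' (by exact_mod_cast h4)
  · exact h4

theorem signAction_neg_one (q : Multiplicative ℚ) :
    signAction (Multiplicative ℚ) (-1) q = q⁻¹ := by
  change q ^ (((-1 : ℤˣ) : ℤ)) = q⁻¹
  simp

theorem DRat.neg_mem (q : Multiplicative ℚ) : (⟨q, -1⟩ : DRat) ∈ involutions DRat := by
  rw [mem_involutions_iff]
  constructor
  · ext
    · simp [SemidirectProduct.mul_left, signAction_neg_one]
    · simp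
  · intro h
    have := congrArg SemidirectProduct.right h
    simp at this

theorem DRat.exists_neg {u : DRat} (hu : u ∈ involutions DRat) : ∃ q, u = ⟨q, -1⟩ := by
  obtain ⟨q, e⟩ := u
  rcases Int.units_eq_one_or e with rfl | rfl
  · exfalso
    refine (mem_involutions_iff.1 hu).2 ?_
    rw [DRat.isOfFinOrder_left (isOfFinOrder_of_involution hu)]; rfl
  · exact ⟨q, rfl⟩

theorem DRat.exists_left {x : DRat} (hx : ¬ IsOfFinOrder x) : ∃ q, x = ⟨q, 1⟩ := by
  obtain ⟨q, e⟩ := x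
  rcases Int.units_eq_one_or e with rfl | rfl
  · exact ⟨q, rfl⟩
  · exact absurd (isOfFinOrder_of_involution (DRat.neg_mem q)) hx

theorem DRat.neg_conj (p q : Multiplicative ℚ) :
    (⟨p, -1⟩ : DRat) * ⟨q, 1⟩ * (⟨p, -1⟩ : DRat)⁻¹ = (⟨q, 1⟩ : DRat)⁻¹ := by
  rw [involution_inv (DRat.neg_mem p)]
  ext
  · simp [SemidirectProduct.mul_left, SemidirectProduct.inv_left, signAction_neg_one]
  · simp

theorem isDihedralLike_DRat : IsDihedralLike DRat := by
  constructor
  · rintro ⟨q, e⟩ hx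
    rcases Int.units_eq_one_or e with rfl | rfl
    · left; rw [DRat.isOfFinOrder_left hx]; rfl
    · exact Or.inr (DRat.neg_mem q)
  · rintro u v ⟨hu, hv, huv⟩ hf
    obtain ⟨p, rfl⟩ := DRat.exists_neg hu
    obtain ⟨q, rfl⟩ := DRat.exists_neg hv
    have e : (⟨p, -1⟩ * ⟨q, -1⟩ : DRat) = ⟨p * q⁻¹, 1⟩ := by
      ext
      · simp [SemidirectProduct.mul_left, signAction_neg_one]
      · simp
    rw [e] at hf
    exact huv (by rw [mul_inv_eq_one.1 (DRat.isOfFinOrder_left hf)])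
  · intro x g hx
    obtain ⟨q, rfl⟩ := DRat.exists_left hx
    obtain ⟨p, e⟩ := g
    rcases Int.units_eq_one_or e with rfl | rfl
    · left
      rw [mul_inv_eq_iff_eq_mul]
      ext
      · simp [SemidirectProduct.mul_left, add_comm]
      · simp
    · right; exact DRat.neg_conj p q
  · intro x hx
    obtain ⟨q, rfl⟩ := DRat.exists_left hx
    refine ⟨⟨1, -1⟩, ⟨Multiplicative.ofAdd 1, -1⟩, ⟨DRat.neg_mem _, DRat.neg_mem _, ?_⟩,
      DRat.neg_conj _ _, DRat.neg_conj _ _⟩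
    intro h
    have := congrArg SemidirectProduct.left h
    exact zero_ne_one (α := ℚ) this

theorem DRat.exists_root {x : DRat} (hx : ¬ IsOfFinOrder x) {n : ℕ} (hn : 0 < n) :
    ∃ y : DRat, y ^ n = x := by
  obtain ⟨q, rfl⟩ := DRat.exists_left hx
  refine ⟨⟨Multiplicative.ofAdd (q.toAdd / n), 1⟩, ?_⟩
  rw [DRat.left_pow]
  congr 1
  apply Multiplicative.toAdd.injective
  have : (n : ℚ) ≠ 0 := by exact_mod_cast hn.ne'
  simp
  field_simp

theorem exists_root_of_mem {E : Subgroup G} (e : E ≃* DRat) {x : G} (hx : x ∈ E)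
    (hf : ¬ IsOfFinOrder x) {n : ℕ} (hn : 0 < n) : ∃ y ∈ E, y ^ n = x := by
  have hf' : ¬ IsOfFinOrder (e ⟨x, hx⟩) := fun h =>
    hf (isOfFinOrder_coe.2 ((isOfFinOrder_map_iff (f := e.toMonoidHom) e.injective).1 h))
  obtain ⟨y, hy⟩ := DRat.exists_root hf' hn
  refine ⟨e.symm y, (e.symm y).2, ?_⟩
  have : (e.symm y) ^ n = ⟨x, hx⟩ := by
    apply e.injective; rw [map_pow, e.apply_symm_apply, hy]
  simpa using congrArg Subtype.val this

/-- A quasi-malnormal infinite dihedral subgroup has no element of infinite order in common with a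
subgroup isomorphic to `ℤ/2ℤ ⋉ ℚ`, which it would contain. -/
theorem isOfFinOrder_of_mem_int_of_mem_rat {D E : Subgroup G} (eD : D ≃* DInt)
    (hD : IsQuasiMalnormal D) (eE : E ≃* DRat) {x : G} (hx : x ∈ D) (hx' : x ∈ E) :
    IsOfFinOrder x := by
  by_contra hf
  have hle : E ≤ D := (isDihedralLike_DInt.of_equiv eD).le_of_mem hD
    (isDihedralLike_DRat.of_equiv eE) hx hx' hf
  obtain ⟨n, hn, h⟩ := DInt.exists_no_root (x := eD ⟨x, hx⟩) fun h =>
    hf (isOfFinOrder_coe.2 ((isOfFinOrder_map_iff (f := eD.toMonoidHom) eD.injective).1 h))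
  obtain ⟨y, hy, hyx⟩ := exists_root_of_mem eE hx' hf hn
  apply h (eD ⟨y, hle hy⟩)
  rw [← map_pow]
  congr 1
  exact Subtype.ext hyx

/-- The two involutions of a pair of type `D_ℚ` have a product of infinite order. -/
theorem IsTypeRat.infinite {u v : G} (h : IsTypeRat u v) : ¬ IsOfFinOrder (u * v) := by
  obtain ⟨hp, E, hE, ⟨e⟩⟩ := h
  exact (isDihedralLike_DRat.of_equiv e).coe_mul_infinite
    (hE (Subgroup.subset_closure (by simp))) (hE (Subgroup.subset_closure (by simp))) hp

theorem IsTypeInt.infinite {u v : G} (h : IsTypeInt u v) : ¬ IsOfFinOrder (u * v) := by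
  obtain ⟨hp, E, hE, ⟨e⟩, -⟩ := h
  exact (isDihedralLike_DInt.of_equiv e).coe_mul_infinite
    (hE (Subgroup.subset_closure (by simp))) (hE (Subgroup.subset_closure (by simp))) hp

theorem IsTypeInt.not_isTypeRat {u v : G} (h : IsTypeInt u v) : ¬ IsTypeRat u v := by
  rintro ⟨-, E, hE, ⟨e⟩⟩
  apply h.infinite
  obtain ⟨-, D, hD, ⟨eD⟩, hq⟩ := h
  have hu : u ∈ Subgroup.closure {u, v} := Subgroup.subset_closure (by simp)
  have hv : v ∈ Subgroup.closure {u, v} := Subgroup.subset_closure (by simp)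
  exact isOfFinOrder_of_mem_int_of_mem_rat eD hq e (D.mul_mem (hD hu) (hD hv))
    (E.mul_mem (hE hu) (hE hv))

theorem IsTypeInt.conj {u v : G} (h : IsTypeInt u v) (g : G) :
    IsTypeInt (g * u * g⁻¹) (g * v * g⁻¹) := by
  obtain ⟨hp, D, hD, ⟨e⟩, hq⟩ := h
  let e' : conjSubgroup g D ≃* DInt :=
    (D.equivMapOfInjective (MulAut.conj g).toMonoidHom (conj_injective g)).symm.trans e
  refine ⟨(IsInvolutionPair.map_iff (conj_injective g)).2 hp, conjSubgroup g D, ?_, ⟨e'⟩, ?_⟩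
  · rw [Subgroup.closure_le] at hD ⊢
    rintro _ (rfl | rfl)
    · exact ⟨u, hD (by simp), rfl⟩
    · exact ⟨v, hD (by simp), rfl⟩
  · rw [(isDihedralLike_DInt.of_equiv e').isQuasiMalnormal_iff]
    rw [(isDihedralLike_DInt.of_equiv e).isQuasiMalnormal_iff] at hq
    intro k hk x hx hkx
    rw [mem_conjSubgroup_iff] at hk hx hkx
    have := hq (g⁻¹ * k * g) hk (g⁻¹ * x * g) hx (by simpa [mul_assoc] using hkx)
    have h2 := (isOfFinOrder_map_iff (conj_injective g)).2 this
    simpa [mul_assoc] using h2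

/-- The homomorphism from the infinite dihedral group given by an involution `s` inverting `r`. -/
def dihedralLift (s r : G) (hs : s * s = 1) (hr : s * r * s = r⁻¹) : DInt →* G where
  toFun
    | .r i => r ^ (show ℤ from i)
    | .sr i => s * r ^ (show ℤ from i)
  map_one' := zpow_zero r
  map_mul' := by
    have hsi : s⁻¹ = s := inv_eq_of_mul_eq_one_left hs
    have key : ∀ i : ℤ, r ^ i * s = s * r ^ (-i) := by
      intro i
      have : (s * r * s⁻¹) ^ i = r⁻¹ ^ i := by rw [hsi, hr]
      rw [conj_zpow, hsi, inv_zpow'] at this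
      rw [← this, ← mul_assoc, ← mul_assoc, hs, one_mul]
    rintro (i | i) (j | j)
    · exact zpow_add r _ _
    · change s * r ^ ((show ℤ from j) - (show ℤ from i)) =
        r ^ (show ℤ from i) * (s * r ^ (show ℤ from j))
      rw [← mul_assoc, key, mul_assoc, ← zpow_add]; congr 2; ring
    · change s * r ^ ((show ℤ from i) + (show ℤ from j)) =
        s * r ^ (show ℤ from i) * r ^ (show ℤ from j)
      rw [mul_assoc, zpow_add]
    · change r ^ ((show ℤ from j) - (show ℤ from i)) =
        s * r ^ (show ℤ from i) * (s * r ^ (show ℤ from j))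
      rw [mul_assoc, ← mul_assoc _ s, key, ← mul_assoc, ← mul_assoc, hs, one_mul, ← zpow_add]
      congr 1; ring

theorem zpow_mem_range_dihedralLift {s r : G} (hs : s * s = 1) (hr : s * r * s = r⁻¹) (i : ℤ) :
    r ^ i ∈ (dihedralLift s r hs hr).range :=
  ⟨DihedralGroup.r (show ZMod 0 from i), rfl⟩

theorem mul_zpow_mem_range_dihedralLift {s r : G} (hs : s * s = 1) (hr : s * r * s = r⁻¹)
    (i : ℤ) : s * r ^ i ∈ (dihedralLift s r hs hr).range :=
  ⟨DihedralGroup.sr (show ZMod 0 from i), rfl⟩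

theorem range_dihedralLift_le {s r : G} (hs : s * s = 1) (hr : s * r * s = r⁻¹) {K : Subgroup G}
    (hsK : s ∈ K) (hrK : r ∈ K) : (dihedralLift s r hs hr).range ≤ K := by
  rintro _ ⟨i | i, rfl⟩
  · exact K.zpow_mem hrK _
  · exact K.mul_mem hsK (K.zpow_mem hrK _)

theorem dihedralLift_injective {s r : G} (hs : s ∈ involutions G) (hr : s * r * s = r⁻¹)
    (hf : ¬ IsOfFinOrder r) :
    Function.Injective (dihedralLift s r (mem_involutions_iff.1 hs).1 hr) := by
  have hz : ∀ i : ℤ, IsOfFinOrder (r ^ i) → i = 0 := by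
    intro i hi
    by_contra h0
    exact hf (isOfFinOrder_of_zpow h0 hi)
  rw [injective_iff_map_eq_one]
  rintro (i | i) h
  · have h1 : r ^ (show ℤ from i) = 1 := h
    have : (show ℤ from i) = 0 := hz _ (by rw [h1]; exact IsOfFinOrder.one)
    rw [DihedralGroup.one_def]; congr
  · exfalso
    have h1 : s * r ^ (show ℤ from i) = 1 := h
    have h2 : s⁻¹ = r ^ (show ℤ from i) := inv_eq_of_mul_eq_one_right h1
    rw [involution_inv hs] at h2
    have h3 := hz _ (h2 ▸ isOfFinOrder_of_involution hs)
    rw [h3, zpow_zero] at h2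
    exact (mem_involutions_iff.1 hs).2 h2

theorem inverted_by_left {u v : G} (hu : u ∈ involutions G) (hv : v ∈ involutions G) :
    u * (u * v) * u⁻¹ = (u * v)⁻¹ := by
  rw [mul_inv_rev, involution_inv hu, involution_inv hv, ← mul_assoc,
    (mem_involutions_iff.1 hu).1, one_mul]

theorem inverted_by_right {u v : G} (hu : u ∈ involutions G) (hv : v ∈ involutions G) :
    v * (u * v) * v⁻¹ = (u * v)⁻¹ := by
  rw [mul_inv_rev, involution_inv hu, involution_inv hv, mul_assoc, mul_assoc,
    (mem_involutions_iff.1 hv).1, mul_one]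

/-- A malnormal cyclic subgroup has no nontrivial element, of infinite order, that an involution
normalizes. -/
theorem isOfFinOrder_of_mem_malnormal {k x a : G} (hk : IsMalnormal (Subgroup.zpowers k))
    (hx : x ∈ Subgroup.zpowers k) (ha : a ∈ involutions G)
    (hax : a * x * a⁻¹ = x ∨ a * x * a⁻¹ = x⁻¹) : IsOfFinOrder x := by
  by_cases hak : a ∈ Subgroup.zpowers k
  · obtain ⟨n, rfl⟩ := hak
    obtain ⟨m, rfl⟩ := hx
    by_cases hn : n = 0
    · subst hn
      exact absurd (zpow_zero k) (mem_involutions_iff.1 ha).2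
    · have : IsOfFinOrder k := isOfFinOrder_of_zpow hn (isOfFinOrder_of_involution ha)
      exact this.zpow
  · rw [isMalnormal_iff.1 hk a hak x hx ?_]
    · exact IsOfFinOrder.one
    · rw [involution_inv ha] at hax ⊢
      rcases hax with h | h <;> rw [h]
      · exact hx
      · exact inv_mem hx

namespace ClassC

/-- A nontrivial element centralizes at most one involution. -/
theorem involution_eq (h : ClassC G) {g w w' : G} (hg : g ≠ 1) (hw : w ∈ involutions G)
    (hw' : w' ∈ involutions G) (h1 : g * w = w * g) (h2 : g * w' = w' * g) : w = w' := by
  by_contra hne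
  exact hg (h.free w w' ⟨hw, hw', hne⟩ g (by rw [h1]; simp) (by rw [h2]; simp))

/-- Distinct involutions do not commute. -/
theorem involution_eq_of_commute (h : ClassC G) {w w' : G} (hw : w ∈ involutions G)
    (hw' : w' ∈ involutions G) (h1 : w * w' = w' * w) : w = w' :=
  h.involution_eq (mem_involutions_iff.1 hw).2 hw hw' rfl h1

/-- An element centralizing an involution is not inverted by two distinct involutions. -/
theorem eq_one_of_inverted (h : ClassC G) {x a b w : G} (hab : IsInvolutionPair a b)
    (ha : a * x * a⁻¹ = x⁻¹) (hb : b * x * b⁻¹ = x⁻¹) (hw : w ∈ involutions G)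
    (hxw : x * w = w * x) : x = 1 := by
  by_contra hx
  have key : ∀ a, a ∈ involutions G → a * x * a⁻¹ = x⁻¹ → a = w := by
    intro a hai hax
    refine h.involution_eq_of_commute hai hw ?_
    have e : w = a * w * a⁻¹ := by
      refine h.involution_eq hx hw ((conj_mem_involutions a).2 hw) hxw ?_
      have h1 : x = (a * x * a⁻¹)⁻¹ := by rw [hax, inv_inv]
      have h2 : x⁻¹ * w = w * x⁻¹ := by
        rw [inv_mul_eq_iff_eq_mul, ← mul_assoc, hxw, mul_assoc, mul_inv_cancel, mul_one]
      rw [h1]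
      simp only [mul_inv_rev, inv_inv, ← mul_assoc, inv_mul_cancel_right]
      rw [mul_assoc a, h2]
      simp only [← mul_assoc]
    rw [eq_mul_inv_iff_mul_eq] at e
    exact e.symm
  exact hab.2.2 ((key a hab.1 ha).trans (key b hab.2.1 hb).symm)

theorem not_translation_of_commute (h : ClassC G) {x w : G} (hx : x ∈ translations G)
    (hw : w ∈ involutions G) (hxw : x * w = w * x) : False := by
  obtain ⟨hf, u, v, huv, rfl⟩ := hx
  apply hf
  rw [h.eq_one_of_inverted huv (inverted_by_left huv.1 huv.2.1) (inverted_by_right huv.1 huv.2.1)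
    hw hxw]
  exact IsOfFinOrder.one

end ClassC

end Algebra

end SharpTwo

/-! ### The Bass–Serre tree of an HNN extension -/

namespace HNNExtension

open NormalWord

variable {G : Type*} [Group G] {A B : Subgroup G} {φ : A ≃* B}

/-- The number of occurrences of the stable letter in the normal form of an element, for some
choice of transversals of the associated subgroups. By `HasWord.tLength_le` it is the least number
of occurrences in a word for the element, so that the choice is irrelevant. -/
noncomputable def tLength (x : HNNExtension G A B φ) : ℕ :=
  (x • (empty : NormalWord (Classical.choice (TransversalPair.nonempty G A B)))).toList.length

theorem tLength_of_mul (g : G) (x : HNNExtension G A B φ) : tLength (of g * x) = tLength x := by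
  rw [tLength, mul_smul, of_smul_eq_smul, group_smul_toList, tLength]

theorem length_unitsSMul_of_cancels {d : TransversalPair G A B} {u : ℤˣ} {w : NormalWord d}
    (h : Cancels u w) : (unitsSMul φ u w).toList.length + 1 = w.toList.length := by
  rw [unitsSMul, dif_pos h]
  cases w using consRecOn with
  | ofGroup => simp [Cancels] at h
  | cons g u' w h1 h2 => simp [unitsSMulWithCancel]

theorem length_unitsSMul_of_not_cancels {d : TransversalPair G A B} {u : ℤˣ} {w : NormalWord d}
    (h : ¬ Cancels u w) : (unitsSMul φ u w).toList.length = w.toList.length + 1 := by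
  rw [unitsSMul, dif_neg h]
  simp

theorem tLength_t_zpow_mul (u : ℤˣ) (x : HNNExtension G A B φ) :
    tLength (t ^ (u : ℤ) * x) = tLength x + 1 ∨ tLength (t ^ (u : ℤ) * x) + 1 = tLength x := by
  rw [tLength, mul_smul, t_pow_smul_eq_unitsSMul, tLength]
  by_cases h : Cancels u (x • (empty : NormalWord (Classical.choice
    (TransversalPair.nonempty G A B))))
  · exact Or.inr (length_unitsSMul_of_cancels h)
  · exact Or.inl (length_unitsSMul_of_not_cancels h)

theorem tLength_of (g : G) : tLength (of g : HNNExtension G A B φ) = 0 := by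
  rw [tLength, of_smul_eq_smul]; rfl

theorem tLength_one : tLength (1 : HNNExtension G A B φ) = 0 := by
  simpa using tLength_of (φ := φ) 1

theorem tLength_t_zpow (u : ℤˣ) : tLength (t ^ (u : ℤ) : HNNExtension G A B φ) = 1 := by
  have := tLength_t_zpow_mul u (1 : HNNExtension G A B φ)
  rw [mul_one, tLength_one] at this
  omega

theorem exists_of_tLength_eq_zero {x : HNNExtension G A B φ} (h : tLength x = 0) :
    ∃ g, x = of g := by
  let w := x • (empty : NormalWord (Classical.choice (TransversalPair.nonempty G A B)))
  have h1 : w.prod φ = x := by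
    have := prod_smul φ x (empty : NormalWord (Classical.choice (TransversalPair.nonempty G A B)))
    rwa [prod_empty, mul_one] at this
  have h2 : w.toList = [] := List.length_eq_zero_iff.1 h
  refine ⟨w.head, ?_⟩
  rw [← h1, ReducedWord.prod, h2]
  simp

theorem exists_of_tLength_eq_succ {x : HNNExtension G A B φ} {n : ℕ} (h : tLength x = n + 1) :
    ∃ (g : G) (u : ℤˣ) (y : HNNExtension G A B φ), tLength y = n ∧ x = of g * t ^ (u : ℤ) * y := by
  let w := x • (empty : NormalWord (Classical.choice (TransversalPair.nonempty G A B)))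
  have hw : w.toList.length = n + 1 := h
  obtain ⟨⟨u, g'⟩, l, hl⟩ := List.exists_cons_of_length_eq_add_one hw
  have hc : Cancels (-u) (w.head⁻¹ • w) := by
    constructor
    · simp
    · simp [hl]
  refine ⟨w.head, u, t ^ ((-u : ℤˣ) : ℤ) * (of w.head⁻¹ * x), ?_, ?_⟩
  · rw [tLength, mul_smul, mul_smul, t_pow_smul_eq_unitsSMul, of_smul_eq_smul]
    have := length_unitsSMul_of_cancels (φ := φ) hc
    rw [group_smul_toList, hw] at this
    exact Nat.succ_injective this
  · simp [mul_assoc]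

/-- Any two ways of splitting off a stable letter from the left of a reduced word differ by an
element of an associated subgroup. In the Bass–Serre tree: the neighbour of a vertex that is closer
to another given vertex is unique. -/
theorem mem_toSubgroup_of_tLength_lt {x : HNNExtension G A B φ} {g g' : G} {u u' : ℤˣ}
    (h : tLength (t ^ ((-u : ℤˣ) : ℤ) * (of g⁻¹ * x)) + 1 = tLength x)
    (h' : tLength (t ^ ((-u' : ℤˣ) : ℤ) * (of g'⁻¹ * x)) + 1 = tLength x) :
    u = u' ∧ g⁻¹ * g' ∈ toSubgroup A B (-u) := by
  let w := x • (empty : NormalWord (Classical.choice (TransversalPair.nonempty G A B)))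
  have key : ∀ (g : G) (u : ℤˣ), tLength (t ^ ((-u : ℤˣ) : ℤ) * (of g⁻¹ * x)) + 1 = tLength x →
      Cancels (-u) (g⁻¹ • w) := by
    intro g u h
    by_contra hc
    have := length_unitsSMul_of_not_cancels (φ := φ) hc
    rw [tLength, mul_smul, mul_smul, t_pow_smul_eq_unitsSMul, of_smul_eq_smul, this] at h
    have e : (g⁻¹ • w).toList.length = tLength x := rfl
    omega
  obtain ⟨a1, a2⟩ := key g u h
  obtain ⟨b1, b2⟩ := key g' u' h'
  rw [group_smul_toList] at a2 b2
  have e : u = u' := by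
    rw [a2] at b2
    simpa using b2
  subst e
  refine ⟨rfl, ?_⟩
  have := mul_mem a1 (inv_mem b1)
  simpa using this

theorem t_zpow_conj_mem_range {u : ℤˣ} {k : G} (hk : k ∈ toSubgroup A B (-u)) :
    ∃ g : G, t ^ ((-u : ℤˣ) : ℤ) * of k * t ^ (u : ℤ) = (of g : HNNExtension G A B φ) := by
  rcases Int.units_eq_one_or u with rfl | rfl
  · refine ⟨φ.symm ⟨k, hk⟩, ?_⟩
    rw [equiv_symm_eq_conj]; simp
  · simp only [neg_neg] at hk ⊢
    refine ⟨φ ⟨k, hk⟩, ?_⟩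
    rw [equiv_eq_conj]; simp

theorem mem_toSubgroup_of_conj_mem_range {u : ℤˣ} {k g : G}
    (h : t ^ ((-u : ℤˣ) : ℤ) * of k * t ^ (u : ℤ) = (of g : HNNExtension G A B φ)) :
    k ∈ toSubgroup A B (-u) := by
  have h1 : tLength (t ^ ((-u : ℤˣ) : ℤ) * (of k⁻¹⁻¹ * t ^ (u : ℤ)) : HNNExtension G A B φ) + 1 =
      tLength (t ^ (u : ℤ) : HNNExtension G A B φ) := by
    rw [inv_inv, ← mul_assoc, h, tLength_of, tLength_t_zpow]
  have h2 : tLength (t ^ ((-u : ℤˣ) : ℤ) * (of 1⁻¹ * t ^ (u : ℤ)) : HNNExtension G A B φ) + 1 =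
      tLength (t ^ (u : ℤ) : HNNExtension G A B φ) := by
    rw [tLength_t_zpow]
    simp [tLength_one]
  simpa using (mem_toSubgroup_of_tLength_lt h1 h2).2

/-- Being a product of `n` stable letters, or inverses of such, and elements of the base group. -/
inductive HasWord : ℕ → HNNExtension G A B φ → Prop
  | of (g : G) : HasWord 0 (of g)
  | cons (g : G) (u : ℤˣ) {n : ℕ} {y : HNNExtension G A B φ} (h : HasWord n y) :
      HasWord (n + 1) (HNNExtension.of g * t ^ (u : ℤ) * y)

theorem HasWord.tLength_le {n : ℕ} {x : HNNExtension G A B φ} (h : HasWord n x) :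
    tLength x ≤ n := by
  induction h with
  | of g => exact (tLength_of g).le
  | cons g u h ih =>
    rw [mul_assoc, tLength_of_mul]
    rcases tLength_t_zpow_mul u ‹_› with h | h <;> omega

theorem hasWord_tLength (x : HNNExtension G A B φ) : HasWord (tLength x) x := by
  suffices ∀ n (x : HNNExtension G A B φ), tLength x = n → HasWord n x from this _ x rfl
  intro n
  induction n with
  | zero =>
    intro x hx
    obtain ⟨g, rfl⟩ := exists_of_tLength_eq_zero hx
    exact .of g
  | succ n ih =>
    intro x hx
    obtain ⟨g, u, y, hy, rfl⟩ := exists_of_tLength_eq_succ hx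
    exact .cons g u (ih y hy)

theorem HasWord.of_mul {n : ℕ} {x : HNNExtension G A B φ} (h : HasWord n x) (g : G) :
    HasWord n (HNNExtension.of g * x) := by
  cases h with
  | of g' => rw [← map_mul]; exact .of _
  | cons g' u h => rw [← mul_assoc, ← mul_assoc, ← map_mul]; exact .cons _ u h

theorem HasWord.mul {n m : ℕ} {x y : HNNExtension G A B φ} (h : HasWord n x) (h' : HasWord m y) :
    HasWord (n + m) (x * y) := by
  induction h with
  | of g => rw [zero_add]; exact h'.of_mul g
  | cons g u h ih =>
    rw [mul_assoc, add_right_comm]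
    exact .cons g u ih

theorem hasWord_t_zpow (u : ℤˣ) : HasWord 1 (t ^ (u : ℤ) : HNNExtension G A B φ) := by
  have := hasWord_tLength (t ^ (u : ℤ) : HNNExtension G A B φ)
  rwa [tLength_t_zpow] at this

theorem HasWord.inv {n : ℕ} {x : HNNExtension G A B φ} (h : HasWord n x) : HasWord n x⁻¹ := by
  induction h with
  | of g => rw [← map_inv]; exact .of _
  | cons g u h ih =>
    rw [mul_inv_rev, mul_inv_rev, ← map_inv, ← zpow_neg, ← Units.val_neg]
    exact ih.mul ((hasWord_t_zpow (-u)).mul (.of g⁻¹))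

theorem tLength_inv (x : HNNExtension G A B φ) : tLength x⁻¹ = tLength x := by
  have h1 := (hasWord_tLength x).inv.tLength_le
  have h2 := (hasWord_tLength x⁻¹).inv.tLength_le
  rw [inv_inv] at h2
  omega

theorem tLength_mul_of (x : HNNExtension G A B φ) (g : G) : tLength (x * of g) = tLength x := by
  rw [← tLength_inv, mul_inv_rev, ← map_inv, tLength_of_mul, tLength_inv]

variable (A B φ) in
/-- The vertices of the Bass–Serre tree of an HNN extension: the left cosets of the base group. -/
abbrev TreeVertex : Type _ := HNNExtension G A B φ ⧸ (of : G →* HNNExtension G A B φ).range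

/-- The vertex `xG` of the Bass–Serre tree. -/
abbrev vertex (x : HNNExtension G A B φ) : TreeVertex A B φ := QuotientGroup.mk x

theorem vertex_eq_iff {x y : HNNExtension G A B φ} :
    vertex x = vertex y ↔ ∃ g : G, x⁻¹ * y = of g := by
  rw [QuotientGroup.eq]
  exact ⟨fun ⟨g, h⟩ => ⟨g, h.symm⟩, fun ⟨g, h⟩ => ⟨g, h.symm⟩⟩

/-- The distance in the Bass–Serre tree. -/
noncomputable def treeDist (p q : TreeVertex A B φ) : ℕ := tLength (p.out⁻¹ * q.out)

theorem treeDist_vertex (x y : HNNExtension G A B φ) :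
    treeDist (vertex x) (vertex y) = tLength (x⁻¹ * y) := by
  obtain ⟨⟨_, g, rfl⟩, hx⟩ := QuotientGroup.mk_out_eq_mul (of : G →* HNNExtension G A B φ).range x
  obtain ⟨⟨_, g', rfl⟩, hy⟩ := QuotientGroup.mk_out_eq_mul (of : G →* HNNExtension G A B φ).range y
  rw [treeDist, hx, hy]
  dsimp only
  rw [mul_inv_rev, ← map_inv, mul_assoc, tLength_of_mul, ← mul_assoc, tLength_mul_of]

theorem smul_vertex (x y : HNNExtension G A B φ) : x • vertex y = vertex (x * y) := rfl

theorem exists_vertex_eq (p : TreeVertex A B φ) : ∃ x, p = vertex x :=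
  ⟨p.out, (QuotientGroup.out_eq' p).symm⟩

theorem exists_neighbour {x : HNNExtension G A B φ} {q : TreeVertex A B φ}
    (h : treeDist (vertex x) q = 1) : ∃ (g : G) (u : ℤˣ), q = vertex (x * of g * t ^ (u : ℤ)) := by
  obtain ⟨y, rfl⟩ := exists_vertex_eq q
  rw [treeDist_vertex] at h
  obtain ⟨g, u, z, hz, e⟩ := exists_of_tLength_eq_succ h
  obtain ⟨g', rfl⟩ := exists_of_tLength_eq_zero hz
  refine ⟨g, u, (vertex_eq_iff.2 ⟨g', ?_⟩).symm⟩
  rw [inv_mul_eq_iff_eq_mul] at e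
  rw [e]; group

theorem treeDist_neighbour (x y : HNNExtension G A B φ) (g : G) (u : ℤˣ) :
    treeDist (vertex (x * of g * t ^ (u : ℤ))) (vertex y) =
      tLength (t ^ ((-u : ℤˣ) : ℤ) * (of g⁻¹ * (x⁻¹ * y))) := by
  rw [treeDist_vertex]
  congr 1
  simp [mul_assoc]

theorem isTreeDist_treeDist : IsTreeDist (treeDist : TreeVertex A B φ → TreeVertex A B φ → ℕ) := by
  apply IsTreeDist.of_unique_closer_neighbour
  · intro p
    obtain ⟨x, rfl⟩ := exists_vertex_eq p
    rw [treeDist_vertex, inv_mul_cancel, tLength_one]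
  · intro p q h
    obtain ⟨x, rfl⟩ := exists_vertex_eq p
    obtain ⟨y, rfl⟩ := exists_vertex_eq q
    rw [treeDist_vertex] at h
    exact vertex_eq_iff.2 (exists_of_tLength_eq_zero h)
  · intro p q
    obtain ⟨x, rfl⟩ := exists_vertex_eq p
    obtain ⟨y, rfl⟩ := exists_vertex_eq q
    rw [treeDist_vertex, treeDist_vertex, ← tLength_inv, mul_inv_rev, inv_inv]
  · intro p q hpq
    obtain ⟨x, rfl⟩ := exists_vertex_eq p
    obtain ⟨y, rfl⟩ := exists_vertex_eq q
    obtain ⟨n, hn⟩ : ∃ n, tLength (x⁻¹ * y) = n + 1 := by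
      refine Nat.exists_eq_succ_of_ne_zero fun h0 => hpq ?_
      exact vertex_eq_iff.2 (exists_of_tLength_eq_zero h0)
    obtain ⟨g, u, z, hz, e⟩ := exists_of_tLength_eq_succ hn
    refine ⟨vertex (x * of g * t ^ (u : ℤ)), ?_, ?_⟩
    · rw [treeDist_vertex, ← mul_assoc, ← mul_assoc, inv_mul_cancel, one_mul, tLength_of_mul,
        tLength_t_zpow]
    · rw [treeDist_vertex, treeDist_vertex, hn, ← hz]
      rw [inv_mul_eq_iff_eq_mul] at e
      rw [e]; congr 2; group
  · intro p q r r' h1 h2 h3 h4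
    obtain ⟨x, rfl⟩ := exists_vertex_eq p
    obtain ⟨y, rfl⟩ := exists_vertex_eq q
    obtain ⟨g, u, rfl⟩ := exists_neighbour h1
    obtain ⟨g', u', rfl⟩ := exists_neighbour h2
    rw [treeDist_neighbour, treeDist_vertex x y] at h3 h4
    obtain ⟨rfl, hm⟩ := mem_toSubgroup_of_tLength_lt h3 h4
    obtain ⟨k, hk⟩ := t_zpow_conj_mem_range (φ := φ) hm
    refine vertex_eq_iff.2 ⟨k, ?_⟩
    rw [← hk]
    simp [mul_assoc]
  · intro p q r h
    obtain ⟨x, rfl⟩ := exists_vertex_eq p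
    obtain ⟨y, rfl⟩ := exists_vertex_eq q
    obtain ⟨g, u, rfl⟩ := exists_neighbour h
    rw [treeDist_neighbour, treeDist_vertex x y, ← tLength_of_mul g⁻¹ (x⁻¹ * y)]
    exact tLength_t_zpow_mul (-u) _

variable (A B φ) in
/-- The exponent sum of the stable letter. -/
def exponentSum : HNNExtension G A B φ →* Multiplicative ℤ :=
  lift 1 (Multiplicative.ofAdd 1) (by simp)

theorem exponentSum_of (g : G) : exponentSum A B φ (of g) = 1 := by simp [exponentSum]

theorem exponentSum_t_zpow (u : ℤˣ) :
    exponentSum A B φ (t ^ (u : ℤ)) = Multiplicative.ofAdd (u : ℤ) := by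
  rw [map_zpow, exponentSum, lift_t, ← ofAdd_zsmul]; simp

theorem isTreeAction_treeDist :
    IsTreeAction (HNNExtension G A B φ) (treeDist : TreeVertex A B φ → TreeVertex A B φ → ℕ) where
  toIsTreeDist := isTreeDist_treeDist
  isom g p q := by
    obtain ⟨x, rfl⟩ := exists_vertex_eq p
    obtain ⟨y, rfl⟩ := exists_vertex_eq q
    rw [smul_vertex, smul_vertex, treeDist_vertex, treeDist_vertex]
    congr 1; group
  no_inversion g p q h h1 h2 := by
    -- an inverted edge would force the exponent sum of `g` to be both `u` and `-u`
    obtain ⟨x, rfl⟩ := exists_vertex_eq p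
    obtain ⟨a, u, rfl⟩ := exists_neighbour h
    rw [smul_vertex] at h1 h2
    obtain ⟨b, hb⟩ := vertex_eq_iff.1 h1
    obtain ⟨c, hc⟩ := vertex_eq_iff.1 h2
    have e1 := congrArg (exponentSum A B φ) hb
    have e2 := congrArg (exponentSum A B φ) hc
    simp only [map_mul, map_inv, exponentSum_of, exponentSum_t_zpow] at e1 e2
    have f1 := congrArg Multiplicative.toAdd e1
    have f2 := congrArg Multiplicative.toAdd e2
    simp at f1 f2
    rcases Int.units_eq_one_or u with rfl | rfl <;> simp at f1 f2 <;> omega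

theorem smul_vertex_one_eq_iff {x : HNNExtension G A B φ} :
    x • vertex 1 = vertex (1 : HNNExtension G A B φ) ↔ ∃ g : G, x = of g := by
  rw [smul_vertex, mul_one, eq_comm, vertex_eq_iff]
  simp

theorem smul_vertex_eq_iff {x y : HNNExtension G A B φ} :
    x • vertex y = vertex y ↔ ∃ g : G, x = y * of g * y⁻¹ := by
  rw [smul_vertex, eq_comm, vertex_eq_iff]
  refine exists_congr fun g => ?_
  rw [eq_mul_inv_iff_mul_eq, inv_mul_eq_iff_eq_mul]

/-- The stabilizer of an edge. -/
theorem of_smul_neighbour_eq_iff {g c : G} {u : ℤˣ} :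
    (of g : HNNExtension G A B φ) • vertex (of c * t ^ (u : ℤ)) =
      vertex (of c * t ^ (u : ℤ) : HNNExtension G A B φ) ↔
    c⁻¹ * g * c ∈ toSubgroup A B (-u) := by
  have e : ∀ k : G, (of g : HNNExtension G A B φ) =
      of c * t ^ (u : ℤ) * of k * (of c * t ^ (u : ℤ))⁻¹ ↔
      t ^ ((-u : ℤˣ) : ℤ) * of (c⁻¹ * g * c) * t ^ (u : ℤ) = (of k : HNNExtension G A B φ) := by
    intro k
    rw [eq_mul_inv_iff_mul_eq, eq_comm, mul_assoc, ← eq_inv_mul_iff_mul_eq,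
      ← eq_inv_mul_iff_mul_eq, eq_comm]
    simp [mul_assoc]
  rw [smul_vertex_eq_iff]
  simp only [e]
  exact ⟨fun ⟨k, hk⟩ => mem_toSubgroup_of_conj_mem_range hk, fun h => t_zpow_conj_mem_range h⟩

/-- An element of the base group that a conjugation by an element outside of the base group maps
into the base group has a conjugate in one of the associated subgroups. -/
theorem exists_conj_mem_of_conj_mem_range {x : G} {γ : HNNExtension G A B φ}
    (hγ : γ ∉ (of : G →* HNNExtension G A B φ).range) {y : G} (h : γ⁻¹ * of x * γ = of y) :
    ∃ c : G, c⁻¹ * x * c ∈ A ∨ c⁻¹ * x * c ∈ B := by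
  have hT := isTreeAction_treeDist (A := A) (B := B) (φ := φ)
  have h1 : (of x : HNNExtension G A B φ) • vertex 1 = vertex (1 : HNNExtension G A B φ) :=
    smul_vertex_one_eq_iff.2 ⟨x, rfl⟩
  have h2 : (of x : HNNExtension G A B φ) • vertex γ = vertex γ :=
    smul_vertex_eq_iff.2 ⟨y, by rw [← h]; group⟩
  have h0 : 1 ≤ treeDist (vertex 1) (vertex γ) := by
    rw [Nat.one_le_iff_ne_zero]
    intro h0
    obtain ⟨g, hg⟩ := vertex_eq_iff.1 (hT.eq_of_dist _ _ h0)
    exact hγ ⟨g, by rw [← hg]; simp⟩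
  obtain ⟨z, hz1, hz2⟩ := hT.geod _ _ 1 h0
  have h3 := hT.fixes_between h1 h2 (m := z) (by omega)
  obtain ⟨c, u, rfl⟩ := exists_neighbour hz1
  rw [one_mul] at h3
  have h4 := of_smul_neighbour_eq_iff.1 h3
  refine ⟨c, ?_⟩
  rcases Int.units_eq_one_or u with rfl | rfl
  · right; simpa using h4
  · left; simpa using h4

theorem exists_edge_of_line {L : ℤ → TreeVertex A B φ} (hL : IsTreeLine treeDist L) (i : ℤ) :
    ∃ (γ : HNNExtension G A B φ) (u : ℤˣ),
      L i = vertex γ ∧ L (i + 1) = vertex (γ * t ^ (u : ℤ)) := by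
  obtain ⟨x, hx⟩ := exists_vertex_eq (L i)
  have h1 := hL i (i + 1)
  rw [hx] at h1
  obtain ⟨g, u, hu⟩ := exists_neighbour (x := x) (q := L (i + 1)) (by
    have : |i - (i + 1)| = 1 := by simp
    omega)
  refine ⟨x * of g, u, ?_, hu⟩
  rw [hx]
  exact vertex_eq_iff.2 ⟨g, by group⟩

/-- The elements fixing an edge, seen from a vertex of the edge. -/
theorem mem_of_fixes_edge {p γ : HNNExtension G A B φ} {c : G} {u : ℤˣ}
    (h1 : p • vertex γ = vertex γ)
    (h2 : p • vertex (γ * of c * t ^ (u : ℤ)) = vertex (γ * of c * t ^ (u : ℤ))) :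
    ∃ g : G, p = γ * of g * γ⁻¹ ∧ c⁻¹ * g * c ∈ toSubgroup A B (-u) := by
  obtain ⟨g, rfl⟩ := smul_vertex_eq_iff.1 h1
  refine ⟨g, rfl, ?_⟩
  rw [← of_smul_neighbour_eq_iff (φ := φ)]
  have := congrArg (γ⁻¹ • ·) h2
  simp only [smul_vertex] at this ⊢
  simpa [mul_assoc] using this

/-- On every line there is a vertex whose two neighbours on the line are not both reached through
the stable letter itself, since an edge going up from one end goes down from the other. Seen from
this vertex, the pointwise stabilizer of the line is therefore contained in `A ∩ cAc⁻¹` for some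
`c ∉ A` or in `A ∩ cBc⁻¹`. -/
theorem exists_line_stabilizer_le {L : ℤ → TreeVertex A B φ} (hL : IsTreeLine treeDist L) :
    ∃ (γ : HNNExtension G A B φ) (c : G) (u : ℤˣ), (u = -1 → c ∉ A) ∧
      ∀ p : HNNExtension G A B φ, (∀ i, p • L i = L i) →
        ∃ g ∈ A, c⁻¹ * g * c ∈ toSubgroup A B (-u) ∧ p = γ * of g * γ⁻¹ := by
  have hinj := hL.injective isTreeDist_treeDist
  -- it suffices to find a vertex with a downward edge
  have key : ∀ (i e : ℤ) (γ : HNNExtension G A B φ), |e| = 1 → L i = vertex γ →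
      L (i + e) = vertex (γ * t ^ ((-1 : ℤˣ) : ℤ)) →
      ∃ (γ : HNNExtension G A B φ) (c : G) (u : ℤˣ), (u = -1 → c ∉ A) ∧
      ∀ p : HNNExtension G A B φ, (∀ i, p • L i = L i) →
        ∃ g ∈ A, c⁻¹ * g * c ∈ toSubgroup A B (-u) ∧ p = γ * of g * γ⁻¹ := by
    intro i e γ he hi hie
    have h1 := hL i (i - e)
    rw [hi, sub_sub_cancel, he] at h1
    obtain ⟨c, u, hu⟩ := exists_neighbour (x := γ) (q := L (i - e)) (by omega)
    refine ⟨γ, c, u, ?_, ?_⟩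
    · rintro rfl hc
      have : L (i + e) = L (i - e) := by
        rw [hie, hu, vertex_eq_iff]
        refine ⟨φ ⟨c, hc⟩, ?_⟩
        rw [equiv_eq_conj]
        simp [mul_assoc]
      have := hinj this
      have : e = 0 := by omega
      rw [this] at he
      simp at he
    · intro p hp
      have p1 := hp i
      have p2 := hp (i + e)
      have p3 := hp (i - e)
      rw [hi] at p1
      rw [hie] at p2
      rw [hu] at p3
      obtain ⟨g, hg, hgu⟩ := mem_of_fixes_edge p1 p3
      obtain ⟨g', hg', hgu'⟩ := mem_of_fixes_edge (c := 1) (u := -1) p1 (by simpa using p2)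
      have : g = g' := by
        rw [hg] at hg'
        exact of_injective φ (by simpa using hg')
      subst this
      exact ⟨g, by simpa using hgu', hgu, hg⟩
  obtain ⟨γ, u, h0, h1⟩ := exists_edge_of_line hL 0
  rcases Int.units_eq_one_or u with rfl | rfl
  · refine key (0 + 1) (-1) (γ * t) (by simp) (by simpa using h1) ?_
    simpa using h0
  · exact key 0 1 γ (by simp) h0 h1

instance [Countable G] : Countable (HNNExtension G A B φ) := by
  have : ∀ n, Set.Countable {x : HNNExtension G A B φ | HasWord n x} := by
    intro n
    induction n with
    | zero =>
      refine (Set.countable_range (of : G → HNNExtension G A B φ)).mono ?_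
      rintro x (⟨g⟩)
      exact ⟨g, rfl⟩
    | succ n ih =>
      refine (((Set.countable_univ (α := G × ℤˣ)).prod ih).image
        fun a => of a.1.1 * t ^ (a.1.2 : ℤ) * a.2).mono ?_
      rintro x (_ | @⟨g, u, _, y, hy⟩)
      exact ⟨((g, u), y), ⟨trivial, hy⟩, rfl⟩
  rw [← Set.countable_univ_iff]
  exact (Set.countable_iUnion this).mono fun x _ => Set.mem_iUnion.2 ⟨_, hasWord_tLength x⟩

end HNNExtension

/-! ### The class `𝒞'` and actions on trees -/

namespace SharpTwo

section Maps

variable {G : Type*} [Group G] {H : Type*} [Group H]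

theorem map_mem_translations {f : G →* H} (hf : Function.Injective f) {h : G}
    (hh : h ∈ translations G) : f h ∈ translations H := by
  obtain ⟨h1, u, v, huv, rfl⟩ := hh
  exact ⟨fun h' => h1 ((isOfFinOrder_map_iff hf).1 h'), f u, f v,
    (IsInvolutionPair.map_iff hf).2 huv, map_mul f u v⟩

theorem map_mem_homotheties {f : G →* H} (hf : Function.Injective f) {h : G}
    (hh : h ∈ homotheties G) : f h ∈ homotheties H := by
  obtain ⟨h1, u, hu, hc⟩ := hh
  exact ⟨fun h' => h1 ((isOfFinOrder_map_iff hf).1 h'), f u, (map_mem_involutions hf).2 hu,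
    by rw [← map_mul, hc, map_mul]⟩

theorem conj_mem_isolatedElements {h : G} (hh : h ∈ isolatedElements G) (g : G) :
    g * h * g⁻¹ ∈ isolatedElements G := by
  obtain ⟨h1, k, ⟨n, hn⟩, hk⟩ := hh
  refine ⟨fun h' => h1 ((isOfFinOrder_map_iff (conj_injective g)).1 h'), g * k * g⁻¹,
    ⟨n, ?_⟩, ?_⟩
  · simp only at hn ⊢
    rw [conj_zpow, hn]
  · have hz : ∀ x, x ∈ Subgroup.zpowers (g * k * g⁻¹) ↔ g⁻¹ * x * g ∈ Subgroup.zpowers k := by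
      intro x
      simp only [Subgroup.mem_zpowers_iff, conj_zpow]
      refine exists_congr fun n => ?_
      constructor
      · rintro rfl; simp [mul_assoc]
      · intro e; rw [e]; simp [mul_assoc]
    rw [isMalnormal_iff] at hk ⊢
    intro a ha x hx hax
    rw [hz] at ha hx hax
    have := hk _ ha _ hx (by simpa [mul_assoc] using hax)
    rw [mul_assoc, inv_mul_eq_one] at this
    exact mul_eq_right.1 this.symm

end Maps

/-- The elements mapping a line to itself, on which they act as translations or reflections. -/
def lineStabilizer (Γ : Type*) [Group Γ] {V : Type*} [MulAction Γ V] (L : ℤ → V) : Subgroup Γ where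
  carrier := {k | ∃ ε c : ℤ, (ε = 1 ∨ ε = -1) ∧ ∀ i, k • L i = L (c + ε * i)}
  one_mem' := ⟨1, 0, Or.inl rfl, fun i => by simp⟩
  mul_mem' := by
    rintro a b ⟨ε, c, hε, ha⟩ ⟨ε', c', hε', hb⟩
    refine ⟨ε * ε', c + ε * c', ?_, fun i => ?_⟩
    · rcases hε with rfl | rfl <;> rcases hε' with rfl | rfl <;> simp
    · rw [mul_smul, hb, ha]; congr 1; ring
  inv_mem' := by
    rintro a ⟨ε, c, hε, ha⟩
    refine ⟨ε, -(ε * c), hε, fun i => ?_⟩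
    rw [inv_smul_eq_iff, ha]
    rcases hε with rfl | rfl <;> congr 1 <;> ring

/-- The lines with trivial pointwise stabilizer. -/
def IsFreeLine (Γ : Type*) [Group Γ] {V : Type*} [MulAction Γ V] (L : ℤ → V) : Prop :=
  ∀ p : Γ, (∀ i, p • L i = L i) → p = 1

section FreeLine

variable {Γ V : Type*} [Group Γ] [MulAction Γ V] {d : V → V → ℕ} {L : ℤ → V}

theorem IsFreeLine.ext (hF : IsFreeLine Γ L) {a b : Γ} (h : ∀ i, a • L i = b • L i) : a = b := by
  have := hF (b⁻¹ * a) fun i => by rw [mul_smul, h, inv_smul_smul]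
  exact (inv_mul_eq_one.1 this).symm

theorem IsFreeLine.flip_mem_involutions (hd : IsTreeDist d) (hL : IsTreeLine d L)
    (hF : IsFreeLine Γ L) {s : Γ} {c : ℤ} (hs : ∀ i, s • L i = L (c + -1 * i)) :
    s ∈ involutions Γ := by
  rw [mem_involutions_iff]
  constructor
  · refine hF _ fun i => ?_
    rw [mul_smul, hs, hs]; congr 1; ring
  · rintro rfl
    have h0 := hs 0
    have h1 := hs 1
    rw [one_smul] at h0 h1
    have := hL.injective hd h0
    have := hL.injective hd h1
    omega

theorem IsFreeLine.exists_shift (hd : IsTreeDist d) (hL : IsTreeLine d L) (hF : IsFreeLine Γ L)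
    {x : Γ} (hx : x ∈ lineStabilizer Γ L) (hf : ¬ IsOfFinOrder x) :
    ∃ c : ℤ, c ≠ 0 ∧ ∀ i, x • L i = L (i + c) := by
  obtain ⟨ε, c, rfl | rfl, h⟩ := hx
  · refine ⟨c, ?_, fun i => by rw [h]; congr 1; ring⟩
    rintro rfl
    apply hf
    rw [hF x fun i => by rw [h]; congr 1; ring]
    exact IsOfFinOrder.one
  · exact absurd (isOfFinOrder_of_involution (hF.flip_mem_involutions hd hL h)) hf

/-- The stabilizer of a free line is its own commensurator: an element of infinite order in the
stabilizer has the line as its axis, and an element has only one axis. -/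
theorem IsFreeLine.mem_of_conj_mem (hT : IsTreeAction Γ d) (hL : IsTreeLine d L)
    (hF : IsFreeLine Γ L) {x g : Γ} (hx : x ∈ lineStabilizer Γ L) (hf : ¬ IsOfFinOrder x)
    (hg : g⁻¹ * x * g ∈ lineStabilizer Γ L) : g ∈ lineStabilizer Γ L := by
  obtain ⟨c, hc, hxc⟩ := hF.exists_shift hT.toIsTreeDist hL hx hf
  have hf' : ¬ IsOfFinOrder (g⁻¹ * x * g) := by
    intro h
    apply hf
    have := (isOfFinOrder_map_iff (conj_injective g)).2 h
    simpa [mul_assoc] using this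
  obtain ⟨c', hc', hxc'⟩ := hF.exists_shift hT.toIsTreeDist hL hg hf'
  exact hT.exists_sign_shift hL
    (hT.smul_axis_mem_range hL hc' hc hxc' hxc (k := g) (by simp [mul_assoc]))

/-- The elements translating a free line form a cyclic group. -/
theorem IsFreeLine.exists_generator (hF : IsFreeLine Γ L) {h : Γ} {ℓ : ℤ} (hℓ : ℓ ≠ 0)
    (hh : ∀ i, h • L i = L (i + ℓ)) :
    ∃ (r : Γ) (m : ℤ), m ≠ 0 ∧ (∀ i, r • L i = L (i + m)) ∧
      ∀ (x : Γ) (c : ℤ), (∀ i, x • L i = L (i + c)) → ∃ n : ℤ, x = r ^ n := by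
  let S : AddSubgroup ℤ :=
    { carrier := {c | ∃ x : Γ, ∀ i, x • L i = L (i + c)}
      zero_mem' := ⟨1, fun i => by simp⟩
      add_mem' := by
        rintro a b ⟨x, hx⟩ ⟨y, hy⟩
        exact ⟨x * y, fun i => by rw [mul_smul, hy, hx]; congr 1; ring⟩
      neg_mem' := by
        rintro a ⟨x, hx⟩
        exact ⟨x⁻¹, fun i => by rw [inv_smul_eq_iff, hx]; congr 1; ring⟩ }
  obtain ⟨m, hm⟩ := Int.subgroup_cyclic S
  have hS : ∀ c ∈ S, ∃ n : ℤ, n * m = c := by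
    intro c hc
    rw [hm, AddSubgroup.mem_closure_singleton] at hc
    simpa using hc
  obtain ⟨r, hr⟩ : m ∈ S := by rw [hm]; exact AddSubgroup.subset_closure rfl
  refine ⟨r, m, ?_, hr, fun x c hx => ?_⟩
  · rintro rfl
    obtain ⟨n, hn⟩ := hS ℓ ⟨h, hh⟩
    exact hℓ (by rw [← hn, mul_zero])
  · obtain ⟨n, rfl⟩ := hS c ⟨x, hx⟩
    exact ⟨n, hF.ext fun i => by rw [hx, IsTreeAction.zpow_smul_line hr]⟩

theorem not_isOfFinOrder_of_shift (hd : IsTreeDist d) (hL : IsTreeLine d L) {h : Γ} {ℓ : ℤ}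
    (hℓ : ℓ ≠ 0) (hh : ∀ i, h • L i = L (i + ℓ)) : ¬ IsOfFinOrder h := by
  intro hf
  obtain ⟨n, hn, h1⟩ := isOfFinOrder_iff_zpow_eq_one.1 hf
  have := IsTreeAction.zpow_smul_line hh n 0
  rw [h1, one_smul] at this
  have := hL.injective hd this
  exact mul_ne_zero hn hℓ (by omega)

/-- An element translating a free line is a product of two involutions if some element reverses the
line; otherwise the stabilizer of the line is a malnormal cyclic subgroup. -/
theorem IsFreeLine.translation_or_isolated (hT : IsTreeAction Γ d) (hL : IsTreeLine d L)
    (hF : IsFreeLine Γ L) {h : Γ} {ℓ : ℤ} (hℓ : ℓ ≠ 0) (hh : ∀ i, h • L i = L (i + ℓ)) :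
    h ∈ translations Γ ∨ h ∈ isolatedElements Γ := by
  have hf := not_isOfFinOrder_of_shift hT.toIsTreeDist hL hℓ hh
  by_cases hflip : ∃ (s : Γ) (c : ℤ), ∀ i, s • L i = L (c + -1 * i)
  · left
    obtain ⟨s, c, hs⟩ := hflip
    have h1 := hF.flip_mem_involutions hT.toIsTreeDist hL hs
    refine ⟨hf, s, s * h, ⟨h1, hF.flip_mem_involutions hT.toIsTreeDist hL (c := c - ℓ) fun i => ?_,
      fun e => ?_⟩, ?_⟩
    · rw [mul_smul, hh, hs]; congr 1; ring
    · exact hf (by rw [left_eq_mul.1 e]; exact IsOfFinOrder.one)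
    · rw [← mul_assoc, (mem_involutions_iff.1 h1).1, one_mul]
  · right
    obtain ⟨r, m, hm, hr, hgen⟩ := hF.exists_generator hℓ hh
    have hE : ∀ x, x ∈ Subgroup.zpowers r ↔ x ∈ lineStabilizer Γ L := by
      intro x
      constructor
      · rintro ⟨n, rfl⟩
        exact ⟨1, n * m, Or.inl rfl, fun i => by
          simp only [IsTreeAction.zpow_smul_line hr]; congr 1; ring⟩
      · rintro ⟨ε, c, rfl | rfl, hx⟩
        · obtain ⟨n, rfl⟩ := hgen x c fun i => by rw [hx]; congr 1; ring
          exact ⟨n, rfl⟩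
        · exact absurd ⟨x, c, hx⟩ hflip
    refine ⟨hf, r, ?_, isMalnormal_iff.2 fun g hg x hx hgx => ?_⟩
    · obtain ⟨n, rfl⟩ := hgen h ℓ hh
      exact ⟨n, rfl⟩
    · by_contra hx1
      rw [hE] at hg hgx
      have hfx : ¬ IsOfFinOrder x := by
        obtain ⟨n, rfl⟩ := hx
        refine fun h => not_isOfFinOrder_of_shift hT.toIsTreeDist hL hm hr
          (isOfFinOrder_of_zpow ?_ h)
        rintro rfl
        exact hx1 (zpow_zero r)
      rw [hE] at hx
      exact hg (hF.mem_of_conj_mem hT hL hx hfx hgx)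

/-- If the product of two involutions translates a free line, then the stabilizer of the line is a
quasi-malnormal infinite dihedral subgroup. -/
theorem IsFreeLine.isTypeInt (hT : IsTreeAction Γ d) (hL : IsTreeLine d L)
    (hF : IsFreeLine Γ L) {u v : Γ} (huv : IsInvolutionPair u v) {ℓ : ℤ} (hℓ : ℓ ≠ 0)
    (hh : ∀ i, (u * v) • L i = L (i + ℓ)) : IsTypeInt u v := by
  have hinv : ∀ i, (u * v)⁻¹ • L i = L (i + -ℓ) := fun i => by
    rw [inv_smul_eq_iff, hh]; congr 1; ring
  have hflip : ∀ w ∈ involutions Γ, w * (u * v) * w⁻¹ = (u * v)⁻¹ →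
      ∃ c, ∀ i, w • L i = L (c + -1 * i) := by
    intro w hw hwuv
    obtain ⟨ε, c, rfl | rfl, hc⟩ := hT.exists_sign_shift hL
      (hT.smul_axis_mem_range hL hℓ (neg_ne_zero.2 hℓ) hh hinv hwuv)
    · exfalso
      have h2 := congrArg (· • L 0) (mem_involutions_iff.1 hw).1
      simp only [mul_smul, hc, one_smul] at h2
      have h3 := hL.injective hT.toIsTreeDist h2
      refine (mem_involutions_iff.1 hw).2 (hF w fun i => ?_)
      rw [hc]; congr 1; omega
    · exact ⟨c, hc⟩
  obtain ⟨c, hu⟩ := hflip u huv.1 (inverted_by_left huv.1 huv.2.1)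
  obtain ⟨c', hv⟩ := hflip v huv.2.1 (inverted_by_right huv.1 huv.2.1)
  obtain ⟨r, m, hm, hr, hgen⟩ := hF.exists_generator hℓ hh
  have hrinv : ∀ i, r⁻¹ • L i = L (i - m) := fun i => by
    rw [inv_smul_eq_iff, hr]; congr 1; ring
  have huu := (mem_involutions_iff.1 huv.1).1
  have hur : u * r * u = r⁻¹ := hF.ext fun i => by
    rw [mul_smul, mul_smul, hu, hr, hu, hrinv]; congr 1; ring
  have hrf := not_isOfFinOrder_of_shift hT.toIsTreeDist hL hm hr
  have hE : lineStabilizer Γ L = (dihedralLift u r huu hur).range := by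
    apply le_antisymm
    · rintro x ⟨ε, e, rfl | rfl, hx⟩
      · obtain ⟨n, rfl⟩ := hgen x e fun i => by rw [hx]; congr 1; ring
        exact zpow_mem_range_dihedralLift huu hur n
      · obtain ⟨n, hn⟩ := hgen (u * x) (c - e) fun i => by
          rw [mul_smul, hx, hu]; congr 1; ring
        have : x = u * r ^ n := by rw [← hn, ← mul_assoc, huu, one_mul]
        rw [this]
        exact mul_zpow_mem_range_dihedralLift huu hur n
    · exact range_dihedralLift_le huu hur ⟨-1, c, Or.inr rfl, hu⟩
        ⟨1, m, Or.inl rfl, fun i => by rw [hr]; congr 1; ring⟩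
  let e : lineStabilizer Γ L ≃* DInt := (MulEquiv.subgroupCongr hE).trans
    (MonoidHom.ofInjective (dihedralLift_injective huv.1 hur hrf)).symm
  refine ⟨huv, lineStabilizer Γ L, ?_, ⟨e⟩, ?_⟩
  · rw [Subgroup.closure_le]
    rintro _ (rfl | rfl)
    · exact ⟨-1, c, Or.inr rfl, hu⟩
    · exact ⟨-1, c', Or.inr rfl, hv⟩
  · rw [(isDihedralLike_DInt.of_equiv e).isQuasiMalnormal_iff]
    intro g hg x hx hgx
    by_contra hf
    exact hg (hF.mem_of_conj_mem hT hL hx hf hgx)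

end FreeLine

/-- `Γ` acts on a tree, transitively on the vertices, with vertex stabilizers conjugate to the
group `G` embedded by `f`, in such a way that the pointwise stabilizer of each line is trivial or
contains exactly one involution. -/
structure IsTreeExtension {G Γ V : Type*} [Group G] [Group Γ] [MulAction Γ V] (f : G →* Γ)
    (d : V → V → ℕ) (o : V) : Prop extends IsTreeAction Γ d where
  injective : Function.Injective f
  exists_smul_eq (x : V) : ∃ γ : Γ, γ • o = x
  smul_eq_iff (γ : Γ) : γ • o = o ↔ ∃ g, γ = f g
  line (L : ℤ → V) : IsTreeLine d L → IsFreeLine Γ L ∨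
    ∃ w ∈ involutions Γ, (∀ i, w • L i = L i) ∧
      ∀ w' ∈ involutions Γ, (∀ i, w' • L i = L i) → w' = w

namespace IsTreeExtension

variable {G Γ V : Type*} [Group G] [Group Γ] [MulAction Γ V] {f : G →* Γ}
    {d : V → V → ℕ} {o : V}

/-- The stabilizer of any vertex is a copy of `G`. -/
theorem exists_conj (h : IsTreeExtension f d o) (x : V) :
    ∃ k : Γ, ∀ γ : Γ, γ • x = x → ∃ g, γ = k * f g * k⁻¹ := by
  obtain ⟨k, rfl⟩ := h.exists_smul_eq x
  refine ⟨k, fun γ hγ => ?_⟩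
  obtain ⟨g, hg⟩ := (h.smul_eq_iff (k⁻¹ * γ * k)).1 (by
    rw [mul_smul, mul_smul, hγ, inv_smul_smul])
  exact ⟨g, by rw [← hg]; group⟩

theorem conj_injective (h : IsTreeExtension f d o) (k : Γ) :
    Function.Injective ((MulAut.conj k).toMonoidHom.comp f) :=
  (SharpTwo.conj_injective k).comp h.injective

theorem nonempty (_ : IsTreeExtension f d o) : Nonempty V := ⟨o⟩

/-- In the stabilizer of a vertex a nontrivial element centralizes at most one involution. -/
theorem involution_eq_of_fixed (h : IsTreeExtension f d o) (hG : ClassC G) {x : V} {p w w' : Γ}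
    (hp : p ≠ 1) (hw : w ∈ involutions Γ) (hw' : w' ∈ involutions Γ) (hpx : p • x = x)
    (hwx : w • x = x) (hwx' : w' • x = x) (h1 : p * w = w * p) (h2 : p * w' = w' * p) :
    w = w' := by
  obtain ⟨k, hk⟩ := h.exists_conj x
  obtain ⟨g, rfl⟩ := hk p hpx
  obtain ⟨a, rfl⟩ := hk w hwx
  obtain ⟨b, rfl⟩ := hk w' hwx'
  have hi := h.conj_injective k
  have e : a = b := by
    refine hG.involution_eq (g := g) ?_ ((map_mem_involutions hi).1 hw)
      ((map_mem_involutions hi).1 hw') (hi ?_) (hi ?_)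
    · rintro rfl; exact hp (by simp)
    · simp only [map_mul]; exact h1
    · simp only [map_mul]; exact h2
  rw [e]

theorem exists_fixed_of_involution (h : IsTreeExtension f d o) {u : Γ} (hu : u ∈ involutions Γ) :
    ∃ x : V, u • x = x :=
  have := h.nonempty
  h.exists_fixed_of_isOfFinOrder (isOfFinOrder_of_involution hu)

theorem involution_eq_of_commute (h : IsTreeExtension f d o) (hG : ClassC G) {u w : Γ}
    (hu : u ∈ involutions Γ) (hw : w ∈ involutions Γ) (huw : u * w = w * u) : u = w := by
  obtain ⟨x, hx⟩ := h.exists_fixed_of_involution hw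
  obtain ⟨m, hm1, hm2⟩ := h.exists_common_fixed_of_commute (mem_involutions_iff.1 hu).1 huw.symm hx
  exact h.involution_eq_of_fixed hG (mem_involutions_iff.1 hu).2 hu hw hm1 hm1 hm2 rfl huw

/-- A line preserved by two distinct involutions is free: an involution fixing the line pointwise
and unique as such would commute with both of them, hence be equal to both. -/
theorem isFreeLine_of_involutions (h : IsTreeExtension f d o) (hG : ClassC G) {L : ℤ → V}
    (hL : IsTreeLine d L) {u v : Γ} (hu : u ∈ involutions Γ) (hv : v ∈ involutions Γ)
    (huv : u ≠ v) (huL : ∀ i, u • L i ∈ Set.range L) (hvL : ∀ i, v • L i ∈ Set.range L) :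
    IsFreeLine Γ L := by
  refine (h.line L hL).resolve_right ?_
  rintro ⟨w, hw, hwL, huniq⟩
  have key : ∀ u ∈ involutions Γ, (∀ i, u • L i ∈ Set.range L) → u = w := by
    intro u hu huL
    refine h.involution_eq_of_commute hG hu hw ?_
    have : u * w * u⁻¹ = w := by
      refine huniq _ ((conj_mem_involutions u).2 hw) fun i => ?_
      obtain ⟨j, hj⟩ := huL i
      have hj' : u⁻¹ • L i = L j := by rw [involution_inv hu, hj]
      rw [mul_smul, hj', mul_smul, hwL, ← hj', smul_inv_smul]
    rwa [mul_inv_eq_iff_eq_mul] at this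
  exact huv ((key u hu huL).trans (key v hv hvL).symm)

/-- If the product of two involutions has an axis, the axis is a free line. -/
theorem isFreeLine_axis (h : IsTreeExtension f d o) (hG : ClassC G) {L : ℤ → V}
    (hL : IsTreeLine d L) {u v : Γ} (huv : IsInvolutionPair u v) {ℓ : ℤ} (hℓ : ℓ ≠ 0)
    (hh : ∀ i, (u * v) • L i = L (i + ℓ)) : IsFreeLine Γ L := by
  have hinv : ∀ i, (u * v)⁻¹ • L i = L (i + -ℓ) := fun i => by
    rw [inv_smul_eq_iff, hh]; congr 1; ring
  exact h.isFreeLine_of_involutions hG hL huv.1 huv.2.1 huv.2.2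
    (h.smul_axis_mem_range hL hℓ (neg_ne_zero.2 hℓ) hh hinv (inverted_by_left huv.1 huv.2.1))
    (h.smul_axis_mem_range hL hℓ (neg_ne_zero.2 hℓ) hh hinv (inverted_by_right huv.1 huv.2.1))

/-- A nontrivial element `g` of `Γ` centralizes at most one involution. If `g` fixes a vertex and
`uv` has an axis, then `g` fixes the axis pointwise; if all fixed point sets meet pairwise, they
have a common vertex; if `g` has an axis, then `u` and `v` fix it pointwise. -/
theorem involution_eq (h : IsTreeExtension f d o) (hG : ClassC G) {g u v : Γ} (hg : g ≠ 1)
    (hu : u ∈ involutions Γ) (hv : v ∈ involutions Γ) (h1 : g * u = u * g)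
    (h2 : g * v = v * g) : u = v := by
  by_contra huv
  have := h.nonempty
  have hu2 := (mem_involutions_iff.1 hu).1
  have hv2 := (mem_involutions_iff.1 hv).1
  by_cases hell : ∃ x : V, g • x = x
  · obtain ⟨x, hx⟩ := hell
    obtain ⟨p, hp1, hp2⟩ := h.exists_common_fixed_of_commute hu2 h1 hx
    obtain ⟨q, hq1, hq2⟩ := h.exists_common_fixed_of_commute hv2 h2 hx
    by_cases huvell : ∃ x : V, (u * v) • x = x
    · obtain ⟨y, hy⟩ := huvell
      obtain ⟨r, hr1, hr2⟩ := h.exists_common_fixed_of_mul hu2 hv2 hy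
      obtain ⟨m, m1, m2, m3⟩ := h.toIsTreeDist.exists_median p q r
      exact huv (h.involution_eq_of_fixed hG hg hu hv (h.fixes_between hp2 hq2 m1)
        (h.fixes_between hp1 hr1 m3) (h.fixes_between hq1 hr2 m2) h1 h2)
    · push Not at huvell
      obtain ⟨L, ℓ, hℓ, hL, hLuv⟩ := h.exists_axis huvell
      have hF := h.isFreeLine_axis hG hL ⟨hu, hv, huv⟩ hℓ.ne' hLuv
      refine hg (hF g (h.fixes_axis_of_commute hL hℓ.ne' hLuv ?_ hx))
      rw [← mul_assoc, h1, mul_assoc, h2, mul_assoc]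
  · push Not at hell
    obtain ⟨L, ℓ, hℓ, hL, hLg⟩ := h.exists_axis hell
    obtain ⟨x, hx⟩ := h.exists_fixed_of_involution hu
    obtain ⟨y, hy⟩ := h.exists_fixed_of_involution hv
    have huL := h.fixes_axis_of_commute hL hℓ.ne' hLg h1.symm hx
    have hvL := h.fixes_axis_of_commute hL hℓ.ne' hLg h2.symm hy
    rcases h.line L hL with hF | ⟨w, -, -, hw⟩
    · exact (mem_involutions_iff.1 hu).2 (hF u huL)
    · exact huv ((hw u hu huL).trans (hw v hv hvL).symm)

/-- Two involutions of `Γ` are simultaneously conjugate into `G`, or their product has a free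
axis, whose stabilizer shows that they form a pair of type `D_ℤ`. -/
theorem conj_or_isTypeInt (h : IsTreeExtension f d o) (hG : ClassC G) {u v : Γ}
    (huv : IsInvolutionPair u v) :
    (∃ (k : Γ) (a b : G), IsInvolutionPair a b ∧ u = k * f a * k⁻¹ ∧ v = k * f b * k⁻¹) ∨
      IsTypeInt u v := by
  have := h.nonempty
  by_cases hell : ∃ x : V, (u * v) • x = x
  · left
    obtain ⟨x, hx⟩ := hell
    obtain ⟨m, hm1, hm2⟩ := h.exists_common_fixed_of_mul (mem_involutions_iff.1 huv.1).1
      (mem_involutions_iff.1 huv.2.1).1 hx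
    obtain ⟨k, hk⟩ := h.exists_conj m
    obtain ⟨a, rfl⟩ := hk u hm1
    obtain ⟨b, rfl⟩ := hk v hm2
    exact ⟨k, a, b, (IsInvolutionPair.map_iff (h.conj_injective k)).1 huv, rfl, rfl⟩
  · right
    push Not at hell
    obtain ⟨L, ℓ, hℓ, hL, hLuv⟩ := h.exists_axis hell
    exact (h.isFreeLine_axis hG hL huv hℓ.ne' hLuv).isTypeInt h.toIsTreeAction hL huv hℓ.ne' hLuv

theorem isTypeRat_conj (h : IsTreeExtension f d o) {a b : G} (hab : IsTypeRat a b) (k : Γ) :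
    IsTypeRat (k * f a * k⁻¹) (k * f b * k⁻¹) :=
  hab.map (h.conj_injective k)

/-- The class `𝒞'` is inherited by `Γ`, provided the pairs of type `D_ℤ` of `G` keep their type or
become conjugate to pairs of type `D_ℚ`, and each isolated element of `G` stays isolated or becomes
a translation or a homothety. Elements and pairs fixing a vertex are conjugate into `G`; the others
are governed by the stabilizers of their axes. -/
theorem classC' (h : IsTreeExtension f d o) (hG : ClassC' G)
    (hint : ∀ a b : G, IsTypeInt a b → IsTypeInt (f a) (f b) ∨
      ∃ (a' b' : G) (γ : Γ), IsTypeRat a' b' ∧ γ * f a * γ⁻¹ = f a' ∧ γ * f b * γ⁻¹ = f b')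
    (hiso : ∀ g ∈ isolatedElements G,
      f g ∈ translations Γ ∨ f g ∈ homotheties Γ ∨ f g ∈ isolatedElements Γ) :
    ClassC' Γ := by
  have := h.nonempty
  have hC := hG.1
  -- every pair of type `D_ℚ` of `Γ` is conjugate to a pair of type `D_ℚ` of `G`
  have hrat : ∀ u v : Γ, IsTypeRat u v →
      ∃ (a b : G) (γ : Γ), IsTypeRat a b ∧ γ * u * γ⁻¹ = f a ∧ γ * v * γ⁻¹ = f b := by
    intro u v huv
    rcases h.conj_or_isTypeInt hC huv.1 with ⟨k, a, b, hab, rfl, rfl⟩ | hZ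
    · have h1 : k⁻¹ * (k * f a * k⁻¹) * k⁻¹⁻¹ = f a := by group
      have h2 : k⁻¹ * (k * f b * k⁻¹) * k⁻¹⁻¹ = f b := by group
      rcases hC.type_or a b hab with hZ | hQ
      · rcases hint a b hZ with hZ | ⟨a', b', γ, hQ, e1, e2⟩
        · exact absurd ((isTypeRat_conj_iff k).1 huv) hZ.not_isTypeRat
        · refine ⟨a', b', γ * k⁻¹, hQ, ?_, ?_⟩
          · rw [← e1]; group
          · rw [← e2]; group
      · exact ⟨a, b, k⁻¹, hQ, h1, h2⟩
    · exact absurd huv hZ.not_isTypeRat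
  refine ⟨⟨?_, ?_, ?_, ?_, ?_⟩, ?_, ?_⟩
  · have key : ∀ u ∈ involutions Γ, ∃ (k : Γ) (a : G), a ∈ involutions G ∧ u = k * f a * k⁻¹ := by
      intro u hu
      obtain ⟨x, hx⟩ := h.exists_fixed_of_involution hu
      obtain ⟨k, hk⟩ := h.exists_conj x
      obtain ⟨a, rfl⟩ := hk u hx
      exact ⟨k, a, (map_mem_involutions (h.conj_injective k)).1 hu, rfl⟩
    intro u hu v hv
    obtain ⟨k, a, ha, rfl⟩ := key u hu
    obtain ⟨l, b, hb, rfl⟩ := key v hv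
    obtain ⟨g, rfl⟩ := hC.transitive a ha b hb
    refine ⟨l * f g * k⁻¹, ?_⟩
    simp only [map_mul, map_inv]
    group
  · intro u v huv g h1 h2
    by_contra hg
    rw [mul_inv_eq_iff_eq_mul] at h1 h2
    exact huv.2.2 (h.involution_eq hC hg huv.1 huv.2.1 h1 h2)
  · intro u v huv
    rcases h.conj_or_isTypeInt hC huv with ⟨k, a, b, hab, rfl, rfl⟩ | hZ
    · rcases hC.type_or a b hab with hZ | hQ
      · rcases hint a b hZ with hZ | ⟨a', b', γ, hQ, e1, e2⟩
        · exact Or.inl (hZ.conj k)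
        · right
          have hQ' := (h.isTypeRat_conj hQ 1)
          rw [← e1, ← e2] at hQ'
          simp only [one_mul, inv_one, mul_one] at hQ'
          exact ((isTypeRat_conj_iff γ).1 hQ').conj k
      · exact Or.inr (h.isTypeRat_conj hQ k)
    · exact Or.inl hZ
  · obtain ⟨u, v, huv⟩ := hC.exists_typeRat
    exact ⟨f u, f v, huv.map h.injective⟩
  · intro u v u' v' huv huv'
    obtain ⟨a, b, γ, hab, h1, h2⟩ := hrat u v huv
    obtain ⟨a', b', γ', hab', h1', h2'⟩ := hrat u' v' huv'
    obtain ⟨g, rfl, rfl⟩ := hC.transitive_typeRat a b a' b' hab hab'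
    rw [map_mul, map_mul, map_inv, ← h1] at h1'
    rw [map_mul, map_mul, map_inv, ← h2] at h2'
    refine ⟨γ'⁻¹ * f g * γ, ?_, ?_⟩
    · rw [mul_inv_eq_iff_eq_mul, ← eq_inv_mul_iff_mul_eq] at h1'
      rw [h1']; group
    · rw [mul_inv_eq_iff_eq_mul, ← eq_inv_mul_iff_mul_eq] at h2'
      rw [h2']; group
  · intro γ hγ
    obtain ⟨x, hx⟩ := h.exists_fixed_of_isOfFinOrder hγ
    obtain ⟨k, hk⟩ := h.exists_conj x
    obtain ⟨g, rfl⟩ := hk γ hx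
    have e : orderOf (k * f g * k⁻¹) = orderOf g := orderOf_injective _ (h.conj_injective k) g
    rw [e]
    exact hG.2.1 g ((isOfFinOrder_map_iff (h.conj_injective k)).1 hγ)
  · intro γ hγ
    by_cases hell : ∃ x : V, γ • x = x
    · obtain ⟨x, hx⟩ := hell
      obtain ⟨k, hk⟩ := h.exists_conj x
      obtain ⟨g, rfl⟩ := hk γ hx
      have hi := h.conj_injective k
      rcases hG.2.2 g (fun h' => hγ ((isOfFinOrder_map_iff hi).2 h')) with h1 | h1 | h1
      · exact Or.inl (map_mem_translations hi h1)
      · exact Or.inr (Or.inl (map_mem_homotheties hi h1))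
      · rcases hiso g h1 with h2 | h2 | h2
        · exact Or.inl (map_mem_translations (SharpTwo.conj_injective k) h2)
        · exact Or.inr (Or.inl (map_mem_homotheties (SharpTwo.conj_injective k) h2))
        · exact Or.inr (Or.inr (conj_mem_isolatedElements h2 k))
    · push Not at hell
      obtain ⟨L, ℓ, hℓ, hL, hLγ⟩ := h.exists_axis hell
      rcases h.line L hL with hF | ⟨w, hw, hwL, huniq⟩
      · rcases hF.translation_or_isolated h.toIsTreeAction hL hℓ.ne' hLγ with h1 | h1
        · exact Or.inl h1
        · exact Or.inr (Or.inr h1)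
      · -- the unique involution fixing the axis pointwise is centralized by `γ`
        refine Or.inr (Or.inl ⟨hγ, w, hw, ?_⟩)
        have : γ * w * γ⁻¹ = w := by
          refine huniq _ ((conj_mem_involutions γ).2 hw) fun i => ?_
          have e : γ⁻¹ • L i = L (i - ℓ) := by
            rw [inv_smul_eq_iff, hLγ]; congr 1; ring
          rw [mul_smul, e, mul_smul, hwL, ← e, smul_inv_smul]
        rwa [mul_inv_eq_iff_eq_mul] at this

end IsTreeExtension

end SharpTwo

/-! ### Three HNN extensions preserving the class `𝒞'` -/

namespace SharpTwo

/-- `ClassC.involution_eq` for elements of the image of an embedding. -/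
theorem ClassC.map_involution_eq {G Γ : Type*} [Group G] [Group Γ] (hG : ClassC G) {F : G →* Γ}
    (hF : Function.Injective F) {g a b : G} (hg : F g ≠ 1) (ha : F a ∈ involutions Γ)
    (hb : F b ∈ involutions Γ) (h1 : F g * F a = F a * F g) (h2 : F g * F b = F b * F g) :
    F a = F b := by
  rw [← map_mul, ← map_mul] at h1 h2
  rw [hG.involution_eq (fun h => hg (by rw [h, map_one])) ((map_mem_involutions hF).1 ha)
    ((map_mem_involutions hF).1 hb) (hF h1) (hF h2)]

end SharpTwo

namespace HNNExtension

open SharpTwo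

variable {G : Type*} [Group G] {A B : Subgroup G} {φ : A ≃* B}

/-- The copy of the base group that stabilizes the vertex `γG`. -/
def vertexHom (γ : HNNExtension G A B φ) : G →* HNNExtension G A B φ :=
  (MulAut.conj γ).toMonoidHom.comp of

theorem vertexHom_apply (γ : HNNExtension G A B φ) (g : G) : vertexHom γ g = γ * of g * γ⁻¹ := rfl

theorem vertexHom_injective (γ : HNNExtension G A B φ) : Function.Injective (vertexHom γ) :=
  (SharpTwo.conj_injective γ).comp (of_injective φ)

theorem isTreeExtension (hline : ∀ L : ℤ → TreeVertex A B φ, IsTreeLine treeDist L →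
      IsFreeLine (HNNExtension G A B φ) L ∨
      ∃ w ∈ involutions (HNNExtension G A B φ), (∀ i, w • L i = L i) ∧
        ∀ w' ∈ involutions (HNNExtension G A B φ), (∀ i, w' • L i = L i) → w' = w) :
    IsTreeExtension (of : G →* HNNExtension G A B φ) treeDist
      (vertex 1 : TreeVertex A B φ) where
  toIsTreeAction := isTreeAction_treeDist
  injective := of_injective φ
  exists_smul_eq p := by
    obtain ⟨x, rfl⟩ := exists_vertex_eq p
    exact ⟨x, by rw [smul_vertex, mul_one]⟩
  smul_eq_iff γ := smul_vertex_one_eq_iff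
  line := hline

/-- If `A` meets its other conjugates and the conjugates of `B` in torsion elements only, then the
pointwise stabilizer of a line consists of torsion elements, and has at most one involution. -/
theorem isTreeExtension_of_torsion (hG : ClassC' G)
    (hAA : ∀ c ∉ A, ∀ x ∈ A, c⁻¹ * x * c ∈ A → IsOfFinOrder x)
    (hAB : ∀ c, ∀ x ∈ A, c⁻¹ * x * c ∈ B → IsOfFinOrder x) :
    IsTreeExtension (of : G →* HNNExtension G A B φ) treeDist
      (vertex 1 : TreeVertex A B φ) := by
  refine isTreeExtension fun L hL => ?_
  obtain ⟨γ, c, u, huc, hstab⟩ := exists_line_stabilizer_le hL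
  have key : ∀ p : HNNExtension G A B φ, (∀ i, p • L i = L i) →
      (p = 1 ∨ p ∈ involutions _) ∧ ∃ g, p = vertexHom γ g := by
    intro p hp
    obtain ⟨g, hgA, hgc, rfl⟩ := hstab p hp
    have hf : IsOfFinOrder g := by
      rcases Int.units_eq_one_or u with rfl | rfl
      · exact hAB c g hgA (by simpa using hgc)
      · exact hAA c (huc rfl) g hgA (by simpa using hgc)
    refine ⟨?_, g, rfl⟩
    rcases hG.2.1 g hf with h | h
    · left; rw [orderOf_eq_one_iff.1 h]; simp
    · right; exact (map_mem_involutions (vertexHom_injective γ)).2 h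
  by_cases hF : IsFreeLine (HNNExtension G A B φ) L
  · exact Or.inl hF
  · right
    simp only [IsFreeLine, not_forall] at hF
    obtain ⟨w, hw, hw1⟩ := hF
    obtain ⟨h1, g, rfl⟩ := key w hw
    have hwi := h1.resolve_left hw1
    refine ⟨_, hwi, hw, fun w' hwi' hw' => ?_⟩
    obtain ⟨-, g', rfl⟩ := key w' hw'
    -- the product of the two involutions has order at most two, so that they commute
    have hp := (key (vertexHom γ g' * vertexHom γ g) fun i => by rw [mul_smul, hw, hw']).1
    have hcomm : vertexHom γ g' * vertexHom γ g = vertexHom γ g * vertexHom γ g' := by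
      have e : (vertexHom γ g' * vertexHom γ g)⁻¹ = vertexHom γ g' * vertexHom γ g := by
        rcases hp with hp | hp
        · rw [hp, inv_one]
        · exact involution_inv hp
      rw [← e, mul_inv_rev, involution_inv hwi, involution_inv hwi']
    exact hG.1.map_involution_eq (vertexHom_injective γ) (mem_involutions_iff.1 hwi').2 hwi' hwi
      rfl hcomm

/-- If `A` and `B` contain a common involution which they centralize, then a nontrivial element
fixing a line centralizes one and the same involution along the whole line. -/
theorem isTreeExtension_of_centralizer (hG : ClassC G) {w : G} (hw : w ∈ involutions G)
    (hwA : w ∈ A) (hwB : w ∈ B) (hA : ∀ x ∈ A, x * w = w * x) (hB : ∀ x ∈ B, x * w = w * x) :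
    IsTreeExtension (of : G →* HNNExtension G A B φ) treeDist
      (vertex 1 : TreeVertex A B φ) := by
  refine isTreeExtension fun L hL => ?_
  by_cases hF : IsFreeLine (HNNExtension G A B φ) L
  · exact Or.inl hF
  right
  choose γ u hγ hγu using exists_edge_of_line hL
  have hws : ∀ u, w ∈ toSubgroup A B u := fun u => by
    rcases Int.units_eq_one_or u with rfl | rfl
    · exact hwA
    · exact hwB
  have hsw : ∀ u, ∀ x ∈ toSubgroup A B u, x * w = w * x := fun u => by
    rcases Int.units_eq_one_or u with rfl | rfl
    · exact hA
    · exact hB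
  have hinv : ∀ i, vertexHom (γ i) w ∈ involutions (HNNExtension G A B φ) := fun i =>
    (map_mem_involutions (vertexHom_injective _)).2 hw
  -- the involution attached to an edge fixes the edge and commutes with its stabilizer
  have hfix1 : ∀ i, vertexHom (γ i) w • L i = L i := fun i => by
    rw [hγ, smul_vertex_eq_iff]; exact ⟨w, rfl⟩
  have hfix2 : ∀ i, vertexHom (γ i) w • L (i + 1) = L (i + 1) := fun i => by
    have h1 := (of_smul_neighbour_eq_iff (A := A) (B := B) (φ := φ) (g := w) (c := 1)
      (u := u i)).2 (by simpa using hws _)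
    rw [map_one, one_mul] at h1
    rw [hγu, ← smul_vertex, vertexHom_apply, smul_smul, inv_mul_cancel_right, mul_smul, h1]
  have hcomm : ∀ p : HNNExtension G A B φ, (∀ i, p • L i = L i) → ∀ i,
      p * vertexHom (γ i) w = vertexHom (γ i) w * p := by
    intro p hp i
    obtain ⟨g, rfl, hg⟩ := mem_of_fixes_edge (p := p) (γ := γ i) (c := 1) (u := u i)
      (by rw [← hγ]; exact hp i) (by rw [map_one, mul_one, ← hγu]; exact hp (i + 1))
    rw [← vertexHom_apply, ← map_mul, hsw _ g (by simpa using hg), map_mul]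
  have hvertex : ∀ i (p : HNNExtension G A B φ), p • L i = L i → ∃ g, p = vertexHom (γ i) g :=
    fun i p hp => by
      rw [hγ, smul_vertex_eq_iff] at hp
      exact hp
  simp only [IsFreeLine, not_forall] at hF
  obtain ⟨p, hp, hp1⟩ := hF
  have hstep : ∀ i, vertexHom (γ i) w = vertexHom (γ (i + 1)) w := by
    intro i
    have c1 := hcomm p hp i
    have c2 := hcomm p hp (i + 1)
    have hi := hinv i
    obtain ⟨g, rfl⟩ := hvertex (i + 1) p (hp (i + 1))
    obtain ⟨a, ha⟩ := hvertex (i + 1) _ (hfix2 i)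
    rw [ha] at c1 hi ⊢
    exact hG.map_involution_eq (vertexHom_injective _) hp1 hi (hinv _) c1 c2
  have hconst : ∀ i : ℤ, vertexHom (γ i) w = vertexHom (γ 0) w := by
    intro i
    induction i with
    | zero => rfl
    | succ n ih => rw [← hstep, ih]
    | pred n ih => rw [hstep, sub_add_cancel, ih]
  refine ⟨vertexHom (γ 0) w, hinv 0, fun i => ?_, fun w' hwi' hw' => ?_⟩
  · rw [← hconst i]; exact hfix1 i
  · have c := hcomm w' hw' 0
    obtain ⟨g, rfl⟩ := hvertex 0 w' (hw' 0)
    exact hG.map_involution_eq (vertexHom_injective _) (mem_involutions_iff.1 hwi').2 hwi'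
      (hinv 0) rfl c

/-- A pair of type `D_ℤ` keeps its type if its dihedral group has only torsion elements in common
with the conjugates of the associated subgroups. -/
theorem isTypeInt_of {a b : G} (hab : IsInvolutionPair a b) {D : Subgroup G}
    (hD : Subgroup.closure {a, b} ≤ D) (e : D ≃* DInt) (hq : IsQuasiMalnormal D)
    (h : ∀ x ∈ D, ∀ c : G, c⁻¹ * x * c ∈ A ∨ c⁻¹ * x * c ∈ B → IsOfFinOrder x) :
    IsTypeInt (of a : HNNExtension G A B φ) (of b) := by
  have hi := of_injective (A := A) (B := B) φ
  let e' : D.map (of : G →* HNNExtension G A B φ) ≃* DInt :=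
    (D.equivMapOfInjective _ hi).symm.trans e
  refine ⟨(IsInvolutionPair.map_iff hi).2 hab, D.map of, ?_, ⟨e'⟩, ?_⟩
  · rw [Subgroup.closure_le] at hD ⊢
    rintro _ (rfl | rfl)
    · exact ⟨a, hD (by simp), rfl⟩
    · exact ⟨b, hD (by simp), rfl⟩
  · rw [(isDihedralLike_DInt.of_equiv e').isQuasiMalnormal_iff]
    rw [(isDihedralLike_DInt.of_equiv e).isQuasiMalnormal_iff] at hq
    rintro γ hγ _ ⟨x, hx, rfl⟩ ⟨y, hy, hxy⟩
    rw [isOfFinOrder_map_iff hi]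
    by_cases hγG : γ ∈ (of : G →* HNNExtension G A B φ).range
    · obtain ⟨g, rfl⟩ := hγG
      refine hq g (fun hg => hγ ⟨g, hg, rfl⟩) x hx ?_
      rw [← map_inv, ← map_mul, ← map_mul] at hxy
      rw [← hi hxy]; exact hy
    · obtain ⟨c, hc⟩ := exists_conj_mem_of_conj_mem_range hγG hxy.symm
      exact h x hx c hc

/-- An isolated element remains isolated if its malnormal cyclic group has only torsion elements in
common with the conjugates of the associated subgroups. -/
theorem mem_isolatedElements_of {g k : G} (hg : ¬ IsOfFinOrder g) (hgk : g ∈ Subgroup.zpowers k)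
    (hk : IsMalnormal (Subgroup.zpowers k))
    (h : ∀ x ∈ Subgroup.zpowers k, ∀ c : G,
      c⁻¹ * x * c ∈ A ∨ c⁻¹ * x * c ∈ B → IsOfFinOrder x) :
    (of g : HNNExtension G A B φ) ∈ isolatedElements (HNNExtension G A B φ) := by
  have hi := of_injective (A := A) (B := B) φ
  have hz : Subgroup.zpowers (of k : HNNExtension G A B φ) = (Subgroup.zpowers k).map of :=
    (MonoidHom.map_zpowers of k).symm
  have htors : ∀ x ∈ Subgroup.zpowers k, IsOfFinOrder x → x = 1 := by
    rintro _ ⟨n, rfl⟩ hf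
    by_cases hn : n = 0
    · subst hn; exact zpow_zero k
    · obtain ⟨m, rfl⟩ := hgk
      exact absurd (isOfFinOrder_of_zpow hn hf).zpow hg
  refine ⟨fun h' => hg ((isOfFinOrder_map_iff hi).1 h'), of k, ?_, ?_⟩
  · rw [hz]; exact ⟨g, hgk, rfl⟩
  · rw [hz]
    rw [isMalnormal_iff] at hk ⊢
    rintro γ hγ _ ⟨x, hx, rfl⟩ ⟨y, hy, hxy⟩
    by_cases hγG : γ ∈ (of : G →* HNNExtension G A B φ).range
    · obtain ⟨a, rfl⟩ := hγG
      rw [hk a (fun ha => hγ ⟨a, ha, rfl⟩) x hx, map_one]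
      rw [← map_inv, ← map_mul, ← map_mul] at hxy
      rw [← hi hxy]; exact hy
    · obtain ⟨c, hc⟩ := exists_conj_mem_of_conj_mem_range hγG hxy.symm
      rw [htors x hx (h x hx c hc), map_one]

end HNNExtension

namespace SharpTwo

variable {G : Type u} [Group G]

theorem isOfFinOrder_conj_iff {x : G} (c : G) : IsOfFinOrder (c⁻¹ * x * c) ↔ IsOfFinOrder x := by
  have := isOfFinOrder_map_iff (conj_injective c⁻¹) (x := x)
  simpa using this

theorem conj_conj_eq_or {x a c : G}
    (h : a * (c⁻¹ * x * c) * a⁻¹ = c⁻¹ * x * c ∨ a * (c⁻¹ * x * c) * a⁻¹ = (c⁻¹ * x * c)⁻¹) :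
    (c * a * c⁻¹) * x * (c * a * c⁻¹)⁻¹ = x ∨ (c * a * c⁻¹) * x * (c * a * c⁻¹)⁻¹ = x⁻¹ := by
  have e : (c * a * c⁻¹) * x * (c * a * c⁻¹)⁻¹ = c * (a * (c⁻¹ * x * c) * a⁻¹) * c⁻¹ := by group
  rw [e]
  rcases h with h | h <;> rw [h]
  · left; group
  · right; group

/-- An element of a malnormal cyclic subgroup of which a conjugate lies in a dihedral-like subgroup
is torsion. -/
theorem isOfFinOrder_of_malnormal_of_dihedral {k x c : G} (hk : IsMalnormal (Subgroup.zpowers k))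
    (hx : x ∈ Subgroup.zpowers k) {E : Subgroup G} (hE : IsDihedralLike E)
    (hxE : c⁻¹ * x * c ∈ E) : IsOfFinOrder x := by
  by_contra hf
  obtain ⟨a, b, hab, h1, -⟩ := hE.coe_inverted hxE (fun h => hf ((isOfFinOrder_conj_iff c).1 h))
  exact hf (isOfFinOrder_of_mem_malnormal hk hx ((conj_mem_involutions c).2 hab.1)
    (conj_conj_eq_or (Or.inr h1)))

/-- An element of a malnormal cyclic subgroup of which a conjugate centralizes an involution is
torsion. -/
theorem isOfFinOrder_of_malnormal_of_commute {k x c w : G}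
    (hk : IsMalnormal (Subgroup.zpowers k)) (hx : x ∈ Subgroup.zpowers k) (hw : w ∈ involutions G)
    (hxw : (c⁻¹ * x * c) * w = w * (c⁻¹ * x * c)) : IsOfFinOrder x :=
  isOfFinOrder_of_mem_malnormal hk hx ((conj_mem_involutions c).2 hw)
    (conj_conj_eq_or (Or.inl (by rw [← hxw]; group)))

/-- An element of a dihedral-like subgroup of which a conjugate centralizes an involution is
torsion. -/
theorem ClassC.isOfFinOrder_of_dihedral_of_commute (hG : ClassC G) {D : Subgroup G}
    (hD : IsDihedralLike D) {x c w : G} (hx : x ∈ D) (hw : w ∈ involutions G)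
    (hxw : (c⁻¹ * x * c) * w = w * (c⁻¹ * x * c)) : IsOfFinOrder x := by
  by_contra hf
  obtain ⟨a, b, hab, h1, h2⟩ := hD.coe_inverted hx hf
  apply hf
  rw [hG.eq_one_of_inverted hab h1 h2 ((conj_mem_involutions c).2 hw) ?_]
  · exact IsOfFinOrder.one
  · have e := congrArg (fun y => c * y * c⁻¹) hxw
    calc x * (c * w * c⁻¹) = c * (c⁻¹ * x * c * w) * c⁻¹ := by group
      _ = c * (w * (c⁻¹ * x * c)) * c⁻¹ := e
      _ = _ := by group

/-- For a pair `(u, v)` of type `D_ℚ` the pair `(u, vuv⁻¹)` has the same type, and an element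
conjugating one to the other is a homothety, since it squares the translation `uv`. -/
theorem ClassC.exists_homothety (hG : ClassC G) : ∃ h, h ∈ homotheties G := by
  obtain ⟨u, v, huv⟩ := hG.exists_typeRat
  have hinf := huv.infinite
  obtain ⟨hp, E, hE, ⟨e⟩⟩ := huv
  have huE : u ∈ E := hE (Subgroup.subset_closure (by simp))
  have hvE : v ∈ E := hE (Subgroup.subset_closure (by simp))
  have hu := mem_involutions_iff.1 hp.1
  have hv := mem_involutions_iff.1 hp.2.1
  have hne : u ≠ v * u * v⁻¹ := by
    intro h
    rw [eq_mul_inv_iff_mul_eq] at h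
    exact hp.2.2 (hG.involution_eq_of_commute hp.1 hp.2.1 h)
  have huv : IsTypeRat u v := ⟨hp, E, hE, ⟨e⟩⟩
  have huv' : IsTypeRat u (v * u * v⁻¹) := by
    refine ⟨⟨hp.1, (conj_mem_involutions v).2 hp.1, hne⟩, E, ?_, ⟨e⟩⟩
    rw [Subgroup.closure_le]
    rintro _ (rfl | rfl)
    · exact huE
    · exact E.mul_mem (E.mul_mem hvE huE) (E.inv_mem hvE)
  -- an element fixing `u` and squaring the translation `u * v`
  obtain ⟨g, hg1, hg2⟩ := hG.transitive_typeRat u v u (v * u * v⁻¹) huv huv'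
  have hgu : g * u = u * g := by rwa [mul_inv_eq_iff_eq_mul] at hg1
  have hsq : g * (u * v) * g⁻¹ = (u * v) * (u * v) := by
    calc g * (u * v) * g⁻¹ = (g * u * g⁻¹) * (g * v * g⁻¹) := by group
      _ = u * (v * u * v⁻¹) := by rw [hg1, hg2]
      _ = _ := by rw [involution_inv hp.2.1]; group
  refine ⟨g, fun hf => hinf ?_, u, hp.1, hgu⟩
  -- a torsion element `g` satisfies `gⁿ = 1`, so that `u * v` is equal to its `2ⁿ`-th power
  obtain ⟨n, hn, hgn⟩ := isOfFinOrder_iff_pow_eq_one.1 hf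
  have hpow : ∀ n : ℕ, g ^ n * (u * v) * (g ^ n)⁻¹ = (u * v) ^ (2 ^ n) := by
    intro n
    induction n with
    | zero => simp
    | succ n ih =>
      have e1 : g ^ (n + 1) * (u * v) * (g ^ (n + 1))⁻¹ =
          g ^ n * (g * (u * v) * g⁻¹) * (g ^ n)⁻¹ := by rw [pow_succ]; group
      have e2 : g ^ n * ((u * v) * (u * v)) * (g ^ n)⁻¹ =
          (g ^ n * (u * v) * (g ^ n)⁻¹) * (g ^ n * (u * v) * (g ^ n)⁻¹) := by group
      rw [e1, hsq, e2, ih, ← pow_add, pow_succ, mul_two]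
  have h1 := hpow n
  rw [hgn, one_mul, inv_one, mul_one] at h1
  refine isOfFinOrder_iff_pow_eq_one.2 ⟨2 ^ n - 1, ?_, ?_⟩
  · have := Nat.one_lt_two_pow hn.ne'
    omega
  · have h2 : (u * v) ^ (2 ^ n - 1) * (u * v) = 1 * (u * v) := by
      rw [← pow_succ, Nat.sub_add_cancel Nat.one_le_two_pow, ← h1, one_mul]
    exact mul_right_cancel h2

open HNNExtension in
/-- A pair of type `D_ℤ` acquires type `D_ℚ` when a stable letter conjugates its dihedral group to
the one generated by a pair of type `D_ℚ`. -/
theorem exists_extension_isTypeRat [Countable G] (hG : ClassC' G) {a b : G}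
    (hab : IsTypeInt a b) : ∃ (Γ : Type u) (_ : Group Γ) (f : G →* Γ), Countable Γ ∧
      Function.Injective f ∧ ClassC' Γ ∧ IsTypeRat (f a) (f b) := by
  obtain ⟨hp, A, hA, ⟨eA⟩, hqA⟩ := hab
  obtain ⟨u, v, huv⟩ := hG.1.exists_typeRat
  have hinf := huv.infinite
  obtain ⟨hpuv, E, hE, ⟨eE⟩⟩ := huv
  have huE : u ∈ E := hE (Subgroup.subset_closure (by simp))
  have hvE : v ∈ E := hE (Subgroup.subset_closure (by simp))
  have hu := (mem_involutions_iff.1 hpuv.1).1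
  have hinv : u * (u * v) * u = (u * v)⁻¹ := by
    have := inverted_by_left hpuv.1 hpuv.2.1
    rwa [involution_inv hpuv.1] at this
  let B := (dihedralLift u (u * v) hu hinv).range
  have hBE : B ≤ E := range_dihedralLift_le hu hinv huE (E.mul_mem huE hvE)
  let φ : A ≃* B := eA.trans (MonoidHom.ofInjective (dihedralLift_injective hpuv.1 hinv hinf))
  have dA := isDihedralLike_DInt.of_equiv eA
  have dE := isDihedralLike_DRat.of_equiv eE
  -- pairs in `B` are of type `D_ℚ`
  have hBrat : ∀ x y : G, x ∈ B → y ∈ B → IsInvolutionPair x y → IsTypeRat x y := by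
    intro x y hx hy hxy
    refine ⟨hxy, E, ?_, ⟨eE⟩⟩
    rw [Subgroup.closure_le]
    rintro _ (rfl | rfl)
    · exact hBE hx
    · exact hBE hy
  have hrat : ∀ (x y c : G), IsInvolutionPair x y → c⁻¹ * x * c ∈ A → c⁻¹ * y * c ∈ A →
      ∃ (a' b' : G) (γ : HNNExtension G A B φ), IsTypeRat a' b' ∧ γ * of x * γ⁻¹ = of a' ∧
        γ * of y * γ⁻¹ = of b' := by
    intro x y c hxy hx hy
    have e : ∀ (x : G) (hx : c⁻¹ * x * c ∈ A), (t * of c⁻¹) * of x * (t * of c⁻¹)⁻¹ =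
        (of (φ ⟨c⁻¹ * x * c, hx⟩ : G) : HNNExtension G A B φ) := by
      intro x hx
      rw [equiv_eq_conj]
      simp [mul_assoc]
    refine ⟨φ ⟨_, hx⟩, φ ⟨_, hy⟩, t * of c⁻¹, hBrat _ _ (φ _).2 (φ _).2 ?_, e x hx, e y hy⟩
    rw [← IsInvolutionPair.map_iff (of_injective φ), ← e, ← e]
    exact (IsInvolutionPair.map_iff (conj_injective _)).2
      ((IsInvolutionPair.map_iff (of_injective φ)).2 hxy)
  -- a quasi-malnormal infinite dihedral group meets the conjugates of `B` in torsion elements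
  have hDB : ∀ (D : Subgroup G) (_ : D ≃* DInt), IsQuasiMalnormal D → ∀ c, ∀ x ∈ D,
      c⁻¹ * x * c ∈ B → IsOfFinOrder x := by
    intro D eD hqD c x hx hxB
    exact isOfFinOrder_of_mem_int_of_mem_rat eD hqD (E := conjSubgroup c E)
      ((E.equivMapOfInjective (MulAut.conj c).toMonoidHom (conj_injective c)).symm.trans eE) hx
      (mem_conjSubgroup_iff.2 (hBE hxB))
  have hT : IsTreeExtension (of : G →* HNNExtension G A B φ) treeDist
      (vertex 1 : TreeVertex A B φ) :=
    isTreeExtension_of_torsion hG (dA.isQuasiMalnormal_iff.1 hqA) (hDB A eA hqA)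
  refine ⟨HNNExtension G A B φ, inferInstance, of, inferInstance, of_injective φ,
    hT.classC' hG ?_ ?_, ?_⟩
  · intro x y hxy
    obtain ⟨hpxy, D, hD, ⟨eD⟩, hqD⟩ := hxy
    have dD := isDihedralLike_DInt.of_equiv eD
    -- a `D` sharing an element of infinite order with a conjugate of `A` lies in that conjugate
    by_cases hex : ∃ z ∈ D, ∃ c : G, c⁻¹ * z * c ∈ A ∧ ¬ IsOfFinOrder z
    · right
      obtain ⟨z, hz, c, hzA, hzf⟩ := hex
      have hle : ∀ y ∈ D, c⁻¹ * y * c ∈ A := by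
        intro y hy
        refine dA.mem_of_conj_eq hqA hzA (fun h => hzf ((isOfFinOrder_conj_iff c).1 h)) ?_
        have e : (c⁻¹ * y * c) * (c⁻¹ * z * c) * (c⁻¹ * y * c)⁻¹ =
            c⁻¹ * (y * z * y⁻¹) * c := by group
        rw [e]
        rcases dD.coe_conj_eq hz hy hzf with h | h <;> rw [h]
        · exact Or.inl rfl
        · right; group
      exact hrat x y c hpxy (hle x (hD (Subgroup.subset_closure (by simp))))
        (hle y (hD (Subgroup.subset_closure (by simp))))
    · left
      refine isTypeInt_of hpxy hD eD hqD fun z hz c hc => ?_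
      rcases hc with hc | hc
      · by_contra hf
        exact hex ⟨z, hz, c, hc, hf⟩
      · exact hDB D eD hqD c z hz hc
  · rintro g ⟨hg, k, hgk, hk⟩
    refine Or.inr (Or.inr (mem_isolatedElements_of hg hgk hk fun x hx c hc => ?_))
    rcases hc with hc | hc
    · exact isOfFinOrder_of_malnormal_of_dihedral hk hx dA hc
    · exact isOfFinOrder_of_malnormal_of_dihedral hk hx dE (hBE hc)
  · obtain ⟨a', b', γ, hr, h1, h2⟩ := hrat a b 1 hp
      (by simpa using hA (Subgroup.subset_closure (by simp)))
      (by simpa using hA (Subgroup.subset_closure (by simp)))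
    have := hr.map (of_injective φ)
    rw [← h1, ← h2] at this
    exact (isTypeRat_conj_iff γ).1 this

open HNNExtension in
/-- An isolated element becomes a homothety when a stable letter conjugates the generator of its
malnormal cyclic group to a homothety. -/
theorem exists_extension_mem_homotheties [Countable G] (hG : ClassC' G) {h : G}
    (hh : h ∈ isolatedElements G) : ∃ (Γ : Type u) (_ : Group Γ) (f : G →* Γ), Countable Γ ∧
      Function.Injective f ∧ ClassC' Γ ∧ f h ∈ homotheties Γ := by
  obtain ⟨hf, k, hhk, hk⟩ := hh
  obtain ⟨h₀, hf₀, w, hw, hw₀⟩ := hG.1.exists_homothety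
  have hkf : ¬ IsOfFinOrder k := by
    obtain ⟨n, rfl⟩ := hhk
    exact fun hk => hf hk.zpow
  have inj : ∀ {k : G}, ¬ IsOfFinOrder k → Function.Injective (zpowersHom G k) := fun hk =>
    (injective_zpow_iff_not_isOfFinOrder.2 hk).comp Multiplicative.toAdd.injective
  let A := (zpowersHom G k).range
  let B := (zpowersHom G h₀).range
  have hA : A = Subgroup.zpowers k := by
    ext x; exact ⟨fun ⟨n, hn⟩ => ⟨n.toAdd, hn⟩, fun ⟨n, hn⟩ => ⟨Multiplicative.ofAdd n, hn⟩⟩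
  have hBw : ∀ x ∈ B, x * w = w * x := by
    rintro _ ⟨n, rfl⟩
    exact (show Commute h₀ w from hw₀).zpow_left n.toAdd
  let φ : A ≃* B :=
    (MonoidHom.ofInjective (inj hkf)).symm.trans (MonoidHom.ofInjective (inj hf₀))
  have hkB : ∀ k, IsMalnormal (Subgroup.zpowers k) → ∀ x ∈ Subgroup.zpowers k, ∀ c,
      c⁻¹ * x * c ∈ B → IsOfFinOrder x := fun k hk x hx c hc =>
    isOfFinOrder_of_malnormal_of_commute hk hx hw (hBw _ hc)
  have hT : IsTreeExtension (of : G →* HNNExtension G A B φ) treeDist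
      (vertex 1 : TreeVertex A B φ) := by
    refine isTreeExtension_of_torsion hG ?_ ?_
    · intro c hc x hx hxc
      rw [hA] at hc hx hxc
      rw [isMalnormal_iff.1 hk c hc x hx hxc]
      exact IsOfFinOrder.one
    · intro c x hx hxc
      rw [hA] at hx
      exact hkB k hk x hx c hxc
  have hhom : ∀ (g c : G), ¬ IsOfFinOrder g → c⁻¹ * g * c ∈ A →
      (of g : HNNExtension G A B φ) ∈ homotheties (HNNExtension G A B φ) := by
    intro g c hg hgc
    have e : (of g : HNNExtension G A B φ) =
        (of c * t⁻¹) * of (φ ⟨c⁻¹ * g * c, hgc⟩ : G) * (of c * t⁻¹)⁻¹ := by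
      rw [equiv_eq_conj]
      simp [mul_assoc]
    rw [e]
    refine map_mem_homotheties (conj_injective _) ⟨fun hfin => hg ?_, of w,
      (map_mem_involutions (of_injective φ)).2 hw, ?_⟩
    · rw [← isOfFinOrder_map_iff (of_injective φ), e]
      exact (isOfFinOrder_map_iff (conj_injective _)).2 hfin
    · rw [← map_mul, hBw _ (φ _).2, map_mul]
  refine ⟨HNNExtension G A B φ, inferInstance, of, inferInstance, of_injective φ,
    hT.classC' hG ?_ ?_, ?_⟩
  · intro x y hxy
    left
    obtain ⟨hpxy, D, hD, ⟨eD⟩, hqD⟩ := hxy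
    have dD := isDihedralLike_DInt.of_equiv eD
    refine isTypeInt_of hpxy hD eD hqD fun z hz c hc => ?_
    rcases hc with hc | hc
    · rw [← isOfFinOrder_conj_iff c]
      rw [hA] at hc
      exact isOfFinOrder_of_malnormal_of_dihedral (c := c⁻¹) hk hc dD
        (by simpa [mul_assoc] using hz)
    · exact hG.1.isOfFinOrder_of_dihedral_of_commute dD hz hw (hBw _ hc)
  · rintro g ⟨hg, l, hgl, hl⟩
    right
    by_cases hex : ∃ z ∈ Subgroup.zpowers l, ∃ c : G, c⁻¹ * z * c ∈ A ∧ ¬ IsOfFinOrder z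
    · left
      obtain ⟨z, hz, c, hzA, hzf⟩ := hex
      refine hhom g c hg ?_
      -- `c⁻¹gc` commutes with the nontrivial element `c⁻¹zc` of the malnormal group `A`
      rw [hA] at hzA ⊢
      by_contra hgc
      have hcomm : g * z = z * g := by
        obtain ⟨n, rfl⟩ := hgl
        obtain ⟨m, rfl⟩ := hz
        exact zpow_mul_comm l n m
      have h1 := isMalnormal_iff.1 hk _ hgc _ hzA (by
        have e : (c⁻¹ * g * c)⁻¹ * (c⁻¹ * z * c) * (c⁻¹ * g * c) =
            c⁻¹ * (g⁻¹ * (z * g)) * c := by group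
        rw [e, ← hcomm, inv_mul_cancel_left]
        exact hzA)
      apply hzf
      rw [← isOfFinOrder_conj_iff c, h1]
      exact IsOfFinOrder.one
    · right
      refine mem_isolatedElements_of hg hgl hl fun z hz c hc => ?_
      rcases hc with hc | hc
      · by_contra hfz
        exact hex ⟨z, hz, c, hc, hfz⟩
      · exact hkB l hl z hz c hc
  · exact hhom h 1 hf (by rw [hA]; simpa using hhk)

/-- The homomorphism `ℤ/2ℤ → G` given by an involution. -/
def unitsHom (u : G) (hu : u * u = 1) : ℤˣ →* G where
  toFun e := if e = 1 then 1 else u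
  map_one' := if_pos rfl
  map_mul' e e' := by
    rcases Int.units_eq_one_or e with rfl | rfl <;> rcases Int.units_eq_one_or e' with rfl | rfl <;>
      simp [hu]

theorem unitsHom_neg_one (u : G) (hu : u * u = 1) : unitsHom u hu (-1) = u := by
  change (if (-1 : ℤˣ) = 1 then 1 else u) = u
  simp

theorem commute_unitsHom {h u : G} (hu : u * u = 1) (hhu : h * u = u * h) (e : ℤˣ) :
    Commute h (unitsHom u hu e) := by
  rcases Int.units_eq_one_or e with rfl | rfl
  · rw [map_one]; exact Commute.one_right h
  · rw [unitsHom_neg_one]; exact hhu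

/-- The homomorphism `ℤ × ℤ/2ℤ → G` given by an involution and an element centralizing it. -/
def homothetyHom (h u : G) (hu : u * u = 1) (hhu : h * u = u * h) : Multiplicative ℤ × ℤˣ →* G :=
  (zpowersHom G h).noncommCoprod (unitsHom u hu) fun n e =>
    (commute_unitsHom hu hhu e).zpow_left n.toAdd

theorem homothetyHom_apply (h u : G) (hu : u * u = 1) (hhu : h * u = u * h)
    (x : Multiplicative ℤ × ℤˣ) :
    homothetyHom h u hu hhu x = h ^ x.1.toAdd * unitsHom u hu x.2 := rfl

theorem homothetyHom_injective {h u : G} (hu : u ∈ involutions G) (hhu : h * u = u * h)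
    (hh : ¬ IsOfFinOrder h) :
    Function.Injective (homothetyHom h u (mem_involutions_iff.1 hu).1 hhu) := by
  rw [injective_iff_map_eq_one]
  rintro ⟨n, e⟩ hne
  rw [homothetyHom_apply] at hne
  have hn : n.toAdd = 0 := by
    by_contra h0
    apply hh
    apply isOfFinOrder_of_zpow h0
    rw [eq_inv_of_mul_eq_one_left hne, isOfFinOrder_inv_iff]
    rcases Int.units_eq_one_or e with rfl | rfl
    · rw [map_one]; exact IsOfFinOrder.one
    · rw [unitsHom_neg_one]; exact isOfFinOrder_of_involution hu
  have hn1 : n = 1 := hn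
  rcases Int.units_eq_one_or e with rfl | rfl
  · rw [hn1]; rfl
  · rw [unitsHom_neg_one, hn, zpow_zero, one_mul] at hne
    exact absurd hne (mem_involutions_iff.1 hu).2

open HNNExtension in
/-- Two homotheties become conjugate when a stable letter conjugates the groups they generate
together with the involution they centralize. -/
theorem exists_extension_conj_homotheties [Countable G] (hG : ClassC' G) {h h' : G}
    (hh : h ∈ homotheties G) (hh' : h' ∈ homotheties G) :
    ∃ (Γ : Type u) (_ : Group Γ) (f : G →* Γ), Countable Γ ∧
      Function.Injective f ∧ ClassC' Γ ∧ ∃ γ : Γ, γ * f h * γ⁻¹ = f h' := by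
  obtain ⟨hf, w, hw, hhw⟩ := hh
  obtain ⟨hf', w', hw', hhw'⟩ := hh'
  obtain ⟨c, rfl⟩ := hG.1.transitive w hw w' hw'
  have hw2 := (mem_involutions_iff.1 hw).1
  have hf'' : ¬ IsOfFinOrder (c⁻¹ * h' * c) := fun h => hf' ((isOfFinOrder_conj_iff c).1 h)
  have hhw'' : (c⁻¹ * h' * c) * w = w * (c⁻¹ * h' * c) := by
    have e := congrArg (fun y => c⁻¹ * y * c) hhw'
    calc (c⁻¹ * h' * c) * w = c⁻¹ * (h' * (c * w * c⁻¹)) * c := by group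
      _ = c⁻¹ * (c * w * c⁻¹ * h') * c := e
      _ = _ := by group
  let A := (homothetyHom h w hw2 hhw).range
  let B := (homothetyHom (c⁻¹ * h' * c) w hw2 hhw'').range
  let φ : A ≃* B := (MonoidHom.ofInjective (homothetyHom_injective hw hhw hf)).symm.trans
    (MonoidHom.ofInjective (homothetyHom_injective hw hhw'' hf''))
  have hmem : ∀ (h : G) (hhw : h * w = w * h), w ∈ (homothetyHom h w hw2 hhw).range :=
    fun h hhw => ⟨(1, -1), by rw [homothetyHom_apply, unitsHom_neg_one]; simp⟩
  have hcomm : ∀ (h : G) (hhw : h * w = w * h), ∀ x ∈ (homothetyHom h w hw2 hhw).range,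
      x * w = w * x := by
    rintro h hhw _ ⟨x, rfl⟩
    rw [homothetyHom_apply]
    exact (Commute.zpow_left (show Commute h w from hhw) _).mul_left
      (commute_unitsHom hw2 rfl x.2).symm
  have hT : IsTreeExtension (of : G →* HNNExtension G A B φ) treeDist
      (vertex 1 : TreeVertex A B φ) :=
    isTreeExtension_of_centralizer hG.1 hw (hmem _ _) (hmem _ _) (hcomm _ _) (hcomm _ _)
  refine ⟨HNNExtension G A B φ, inferInstance, of, inferInstance, of_injective φ,
    hT.classC' hG ?_ ?_, of c * t, ?_⟩
  · intro x y hxy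
    left
    obtain ⟨hpxy, D, hD, ⟨eD⟩, hqD⟩ := hxy
    refine isTypeInt_of hpxy hD eD hqD fun z hz d hd => ?_
    refine hG.1.isOfFinOrder_of_dihedral_of_commute (isDihedralLike_DInt.of_equiv eD) hz hw
      (c := d) ?_
    rcases hd with hd | hd
    · exact hcomm _ _ _ hd
    · exact hcomm _ _ _ hd
  · rintro g ⟨hg, l, hgl, hl⟩
    refine Or.inr (Or.inr (mem_isolatedElements_of hg hgl hl fun z hz d hd => ?_))
    refine isOfFinOrder_of_malnormal_of_commute hl hz hw (c := d) ?_
    rcases hd with hd | hd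
    · exact hcomm _ _ _ hd
    · exact hcomm _ _ _ hd
  · have e : ∀ (h : G) (hhw : h * w = w * h),
        homothetyHom h w hw2 hhw (Multiplicative.ofAdd 1, 1) = h := by
      intro h hhw
      simp [homothetyHom_apply]
    have hφ : ∀ x, φ (MonoidHom.ofInjective (homothetyHom_injective hw hhw hf) x) =
        MonoidHom.ofInjective (homothetyHom_injective hw hhw'' hf'') x := fun x => by
      simp [φ]
    have h1 := equiv_eq_conj (φ := φ)
      (MonoidHom.ofInjective (homothetyHom_injective hw hhw hf) (Multiplicative.ofAdd 1, 1))
    rw [hφ, MonoidHom.ofInjective_apply, MonoidHom.ofInjective_apply, e, e] at h1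
    calc of c * t * of h * (of c * t)⁻¹ = of c * (t * of h * t⁻¹) * (of c)⁻¹ := by group
      _ = of c * of (c⁻¹ * h' * c) * (of c)⁻¹ := by rw [h1]
      _ = of h' := by rw [← map_inv, ← map_mul, ← map_mul]; congr 1; group

end SharpTwo

/-! ### Chains of extensions and their unions -/

namespace SharpTwo

/-- What one step of the construction achieves for the elements `a`, `b` of `G` in the extension
`f : G →* Γ`. -/
structure Settles {G Γ : Type*} [Group G] [Group Γ] (f : G →* Γ) (a b : G) : Prop where
  pair : IsInvolutionPair a b → IsTypeRat (f a) (f b)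
  conj : a ∈ homotheties G → b ∈ homotheties G → ∃ γ : Γ, γ * f a * γ⁻¹ = f b
  infinite : ¬ IsOfFinOrder a → f a ∈ translations Γ ∨ f a ∈ homotheties Γ

/-- The three extensions, each replaced by the identity if there is nothing to do. -/
theorem exists_extension_settles {G : Type u} [Group G] [Countable G] (hG : ClassC' G) (a b : G) :
    ∃ (Γ : Type u) (_ : Group Γ) (f : G →* Γ), Countable Γ ∧
      Function.Injective f ∧ ClassC' Γ ∧ Settles f a b := by
  obtain ⟨Γ₁, _, f₁, _, hf₁, h₁, s₁⟩ : ∃ (Γ : Type u) (_ : Group Γ) (f : G →* Γ), Countable Γ ∧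
      Function.Injective f ∧ ClassC' Γ ∧ (IsInvolutionPair a b → IsTypeRat (f a) (f b)) := by
    by_cases hab : IsTypeInt a b
    · obtain ⟨Γ, i, f, h1, h2, h3, h4⟩ := exists_extension_isTypeRat hG hab
      exact ⟨Γ, i, f, h1, h2, h3, fun _ => h4⟩
    · exact ⟨G, inferInstance, MonoidHom.id G, inferInstance, Function.injective_id, hG,
        fun hp => (hG.1.type_or a b hp).resolve_left hab⟩
  obtain ⟨Γ₂, _, f₂, _, hf₂, h₂, s₂⟩ : ∃ (Γ : Type u) (_ : Group Γ) (f : Γ₁ →* Γ), Countable Γ ∧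
      Function.Injective f ∧ ClassC' Γ ∧ (f₁ a ∈ homotheties Γ₁ → f₁ b ∈ homotheties Γ₁ →
        ∃ γ : Γ, γ * f (f₁ a) * γ⁻¹ = f (f₁ b)) := by
    by_cases hab : f₁ a ∈ homotheties Γ₁ ∧ f₁ b ∈ homotheties Γ₁
    · obtain ⟨Γ, i, f, h1, h2, h3, h4⟩ := exists_extension_conj_homotheties h₁ hab.1 hab.2
      exact ⟨Γ, i, f, h1, h2, h3, fun _ _ => h4⟩
    · exact ⟨Γ₁, inferInstance, MonoidHom.id Γ₁, inferInstance, Function.injective_id, h₁,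
        fun ha hb => absurd ⟨ha, hb⟩ hab⟩
  obtain ⟨Γ₃, _, f₃, _, hf₃, h₃, s₃⟩ : ∃ (Γ : Type u) (_ : Group Γ) (f : Γ₂ →* Γ), Countable Γ ∧
      Function.Injective f ∧ ClassC' Γ ∧ (¬ IsOfFinOrder (f₂ (f₁ a)) →
        f (f₂ (f₁ a)) ∈ translations Γ ∨ f (f₂ (f₁ a)) ∈ homotheties Γ) := by
    by_cases ha : f₂ (f₁ a) ∈ isolatedElements Γ₂
    · obtain ⟨Γ, i, f, h1, h2, h3, h4⟩ := exists_extension_mem_homotheties h₂ ha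
      exact ⟨Γ, i, f, h1, h2, h3, fun _ => Or.inr h4⟩
    · refine ⟨Γ₂, inferInstance, MonoidHom.id Γ₂, inferInstance, Function.injective_id, h₂,
        fun hf => ?_⟩
      rcases h₂.2.2 _ hf with h | h | h
      · exact Or.inl h
      · exact Or.inr h
      · exact absurd h ha
  refine ⟨Γ₃, inferInstance, f₃.comp (f₂.comp f₁), inferInstance, hf₃.comp (hf₂.comp hf₁), h₃,
    ⟨fun hp => ((s₁ hp).map hf₂).map hf₃, fun ha hb => ?_, fun ha => s₃ fun hf => ha ?_⟩⟩
  · obtain ⟨γ, hγ⟩ := s₂ (map_mem_homotheties hf₁ ha) (map_mem_homotheties hf₁ hb)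
    refine ⟨f₃ γ, ?_⟩
    have := congrArg f₃ hγ
    simpa using this
  · rwa [isOfFinOrder_map_iff hf₂, isOfFinOrder_map_iff hf₁] at hf

section Chain

variable {H : ℕ → Type u} [∀ n, Group (H n)] (f : ∀ n, H n →* H (n + 1))

/-- The composite homomorphisms of a chain of groups. -/
def chainMap (n m : ℕ) (h : n ≤ m) : H n →* H m :=
  Nat.leRec (motive := fun m _ => H n →* H m) (MonoidHom.id (H n)) (fun m _ g => (f m).comp g) h

theorem chainMap_self (n : ℕ) : chainMap f n n le_rfl = MonoidHom.id (H n) :=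
  Nat.leRec_self _ _

theorem chainMap_succ (n m : ℕ) (h : n ≤ m) :
    chainMap f n (m + 1) (Nat.le_succ_of_le h) = (f m).comp (chainMap f n m h) :=
  Nat.leRec_succ _ _ h

theorem chainMap_trans (n m k : ℕ) (h : n ≤ m) (h' : m ≤ k) (x : H n) :
    chainMap f m k h' (chainMap f n m h x) = chainMap f n k (h.trans h') x := by
  induction k, h' using Nat.le_induction with
  | base => rw [chainMap_self]; rfl
  | succ k hk ih =>
    rw [chainMap_succ f m k hk, chainMap_succ f n k (h.trans hk), MonoidHom.comp_apply, ih,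
      MonoidHom.comp_apply]

theorem chainMap_injective (hf : ∀ n, Function.Injective (f n)) (n m : ℕ) (h : n ≤ m) :
    Function.Injective (chainMap f n m h) := by
  induction m, h using Nat.le_induction with
  | base => rw [chainMap_self]; exact Function.injective_id
  | succ m hm ih =>
    rw [chainMap_succ f n m hm]
    exact (hf m).comp ih

/-- A chain of injective homomorphisms has a union. -/
theorem exists_union (hf : ∀ n, Function.Injective (f n)) :
    ∃ (L : Type u) (_ : Group L) (ι : ∀ n, H n →* L), (∀ n, Function.Injective (ι n)) ∧
      (∀ n m (h : n ≤ m) x, ι m (chainMap f n m h x) = ι n x) ∧ ∀ x, ∃ n y, x = ι n y := by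
  have : DirectedSystem H (fun i j h => chainMap f i j h) :=
    ⟨fun i x => by rw [chainMap_self]; rfl, fun i j k hij hjk x => chainMap_trans f k j i _ _ x⟩
  refine ⟨DirectLimit H (chainMap f), inferInstance, fun n =>
    { toFun := fun x => ⟦⟨n, x⟩⟧
      map_one' := (DirectLimit.one_def n).symm
      map_mul' := fun x y => (DirectLimit.mul_def n x y).symm }, ?_, ?_, ?_⟩
  · intro n
    exact DirectLimit.mk_injective _ (chainMap_injective f hf) n
  · intro n m h x
    exact DirectLimit.mk_apply n m x h
  · intro x
    exact DirectLimit.exists_eq_mk _ x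

end Chain

/-- A stage of the construction: a countable group of the class `𝒞'`, with a doubly indexed list of
pairs of elements to be settled. -/
structure Stage where
  carrier : Type u
  [group : Group carrier]
  [countable : Countable carrier]
  classC' : ClassC' carrier
  todo : ℕ → ℕ → carrier × carrier

attribute [instance] Stage.group Stage.countable

/-- An enumeration of the pairs of elements of a countable group. -/
noncomputable def pairEnum (G : Type*) [Group G] [Countable G] : ℕ → G × G :=
  (exists_surjective_nat (G × G)).choose

theorem pairEnum_surjective (G : Type*) [Group G] [Countable G] :
    Function.Surjective (pairEnum G) :=
  (exists_surjective_nat (G × G)).choose_spec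

/-- The stage number `n` settles the pair with the indices coded by `n`. The list for the next
stage consists of the images of the rows up to `n` of the old list, followed by rows enumerating all
pairs of the new group. -/
theorem Stage.exists_next (S : Stage.{u}) (n : ℕ) :
    ∃ (S' : Stage.{u}) (f : S.carrier →* S'.carrier), Function.Injective f ∧
      Settles f (S.todo n.unpair.1 n.unpair.2).1 (S.todo n.unpair.1 n.unpair.2).2 ∧
      (∀ i ≤ n, ∀ j, S'.todo i j = (f (S.todo i j).1, f (S.todo i j).2)) ∧
      ∀ i, n < i → S'.todo i = pairEnum S'.carrier := by
  obtain ⟨Γ, _, f, _, hf, hΓ, hs⟩ := exists_extension_settles S.classC'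
    (S.todo n.unpair.1 n.unpair.2).1 (S.todo n.unpair.1 n.unpair.2).2
  refine ⟨{ carrier := Γ, classC' := hΓ, todo := fun i j =>
    if i ≤ n then (f (S.todo i j).1, f (S.todo i j).2) else pairEnum Γ j }, f, hf, hs, ?_, ?_⟩
  · intro i hi j
    exact if_pos hi
  · intro i hi
    funext j
    exact if_neg (not_le.2 hi)

/-- A chain of extensions in which each pair of elements of each group is settled at some stage. -/
theorem exists_chain {G : Type u} [Group G] [Countable G] (hG : ClassC' G) :
    ∃ (H : ℕ → Type u) (_ : ∀ n, Group (H n)) (f : ∀ n, H n →* H (n + 1)),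
      (∀ n, Countable (H n)) ∧ (∀ n, Function.Injective (f n)) ∧ (∀ n, ClassC' (H n)) ∧
      (∃ ι : G →* H 0, Function.Injective ι) ∧
      ∀ (n : ℕ) (a b : H n), ∃ (m : ℕ) (h : n ≤ m),
        Settles (f m) (chainMap f n m h a) (chainMap f n m h b) := by
  choose next φ hφ hsettle hold hnew using Stage.exists_next.{u}
  let S₀ : Stage.{u} := { carrier := G, classC' := hG, todo := fun _ => pairEnum G }
  let S : ℕ → Stage.{u} := Nat.rec (motive := fun _ => Stage.{u}) S₀ (fun n T => next T n)
  let f (n : ℕ) : (S n).carrier →* (S (n + 1)).carrier := φ (S n) n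
  refine ⟨fun n => (S n).carrier, fun n => inferInstance, f, fun n => inferInstance,
    fun n => hφ (S n) n, fun n => (S n).classC', ⟨MonoidHom.id G, Function.injective_id⟩, ?_⟩
  intro n a b
  obtain ⟨j, hj⟩ : ∃ j, (S n).todo n j = (a, b) := by
    have e : (S n).todo n = pairEnum (S n).carrier := by
      cases n with
      | zero => rfl
      | succ n => exact hnew (S n) n (n + 1) (Nat.lt_succ_self n)
    rw [e]
    exact pairEnum_surjective _ _
  have key : ∀ m (h : n ≤ m), (S m).todo n j = (chainMap f n m h a, chainMap f n m h b) := by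
    intro m h
    induction m, h using Nat.le_induction with
    | base => rw [chainMap_self]; exact hj
    | succ m hm ih =>
      rw [chainMap_succ f n m hm]
      refine (hold (S m) m n hm j).trans ?_
      rw [ih]; rfl
  refine ⟨Nat.pair n j, Nat.left_le_pair n j, ?_⟩
  have := hsettle (S (Nat.pair n j)) (Nat.pair n j)
  rw [Nat.unpair_pair] at this
  dsimp only at this
  rwa [key _ (Nat.left_le_pair n j)] at this

/-! ### Sharp 2-transitivity and the conjugacy classes -/

section Conclusion

variable {G : Type u} [Group G]

/-- The action by conjugation on the involutions is sharply 2-transitive. -/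
theorem isSharplyTwoTransitive_of_isTypeRat (hG : ClassC G)
    (hrat : ∀ u v : G, IsInvolutionPair u v → IsTypeRat u v) : IsSharplyTwoTransitive G := by
  let act : MulAction G (involutions G) :=
    { smul := fun g x => ⟨g * x * g⁻¹, (conj_mem_involutions g).2 x.2⟩
      one_smul := fun x => Subtype.ext (by change 1 * (x : G) * 1⁻¹ = x; simp)
      mul_smul := fun g h x => Subtype.ext (by
        change g * h * (x : G) * (g * h)⁻¹ = g * (h * x * h⁻¹) * g⁻¹
        group) }
  have hsmul : ∀ (g : G) (x y : involutions G), g • x = y ↔ g * (x : G) * g⁻¹ = y :=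
    fun g x y => Subtype.ext_iff
  refine ⟨involutions G, act, ?_, fun x₁ x₂ y₁ y₂ hx hy => ?_⟩
  · obtain ⟨u, v, huv⟩ := hG.exists_typeRat
    exact ⟨⟨u, huv.1.1⟩, ⟨v, huv.1.2.1⟩, fun h => huv.1.2.2 (congrArg Subtype.val h)⟩
  · have px : IsInvolutionPair (x₁ : G) x₂ := ⟨x₁.2, x₂.2, fun h => hx (Subtype.ext h)⟩
    have py : IsInvolutionPair (y₁ : G) y₂ := ⟨y₁.2, y₂.2, fun h => hy (Subtype.ext h)⟩
    obtain ⟨g, h1, h2⟩ := hG.transitive_typeRat _ _ _ _ (hrat _ _ px) (hrat _ _ py)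
    refine ⟨g, ⟨(hsmul _ _ _).2 h1, (hsmul _ _ _).2 h2⟩, ?_⟩
    rintro k ⟨h3, h4⟩
    rw [hsmul] at h3 h4
    have : g⁻¹ * k = 1 := by
      refine hG.free _ _ px _ ?_ ?_
      · calc g⁻¹ * k * x₁ * (g⁻¹ * k)⁻¹ = g⁻¹ * (k * x₁ * k⁻¹) * g := by group
          _ = g⁻¹ * (g * x₁ * g⁻¹) * g := by rw [h3, h1]
          _ = x₁ := by group
      · calc g⁻¹ * k * x₂ * (g⁻¹ * k)⁻¹ = g⁻¹ * (k * x₂ * k⁻¹) * g := by group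
          _ = g⁻¹ * (g * x₂ * g⁻¹) * g := by rw [h4, h2]
          _ = x₂ := by group
    exact (inv_mul_eq_one.1 this).symm

theorem carrier_mk_eq {S : Set G} (hconj : ∀ x ∈ S, ∀ y ∈ S, ∃ g, g * x * g⁻¹ = y)
    (hmem : ∀ x ∈ S, ∀ g, g * x * g⁻¹ ∈ S) {x : G} (hx : x ∈ S) :
    (ConjClasses.mk x).carrier = S := by
  ext y
  rw [ConjClasses.mem_carrier_iff_mk_eq, ConjClasses.mk_eq_mk_iff_isConj, isConj_comm, isConj_iff]
  constructor
  · rintro ⟨g, rfl⟩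
    exact hmem x hx g
  · intro hy
    exact hconj x hx y hy

/-- The four conjugacy classes of a group in which all pairs of involutions are of type `D_ℚ`, all
elements of infinite order are translations or homotheties, and all homotheties are conjugate. -/
theorem conjClasses_eq (hG : ClassC' G)
    (hrat : ∀ u v : G, IsInvolutionPair u v → IsTypeRat u v)
    (hinf : ∀ h : G, ¬ IsOfFinOrder h → h ∈ translations G ∨ h ∈ homotheties G)
    (hhom : ∀ h ∈ homotheties G, ∀ h' ∈ homotheties G, ∃ g, g * h * g⁻¹ = h') :
    Nat.card (ConjClasses G) = 4 ∧
      Set.range (ConjClasses.carrier : ConjClasses G → Set G) =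
        {{1}, involutions G, translations G, homotheties G} := by
  have c1 : ∀ x ∈ ({1} : Set G), (ConjClasses.mk x).carrier = {1} := fun x hx =>
    carrier_mk_eq (by rintro _ rfl _ rfl; exact ⟨1, by simp⟩) (by rintro _ rfl g; simp) hx
  have c2 : ∀ x ∈ involutions G, (ConjClasses.mk x).carrier = involutions G := fun x hx =>
    carrier_mk_eq hG.1.transitive (fun x hx g => (conj_mem_involutions g).2 hx) hx
  have c3 : ∀ x ∈ translations G, (ConjClasses.mk x).carrier = translations G := fun x hx => by
    refine carrier_mk_eq ?_ (fun x hx g => map_mem_translations (conj_injective g) hx) hx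
    rintro _ ⟨-, u, v, huv, rfl⟩ _ ⟨-, u', v', huv', rfl⟩
    obtain ⟨g, rfl, rfl⟩ := hG.1.transitive_typeRat _ _ _ _ (hrat _ _ huv) (hrat _ _ huv')
    exact ⟨g, by group⟩
  have c4 : ∀ x ∈ homotheties G, (ConjClasses.mk x).carrier = homotheties G := fun x hx =>
    carrier_mk_eq hhom (fun x hx g => map_mem_homotheties (conj_injective g) hx) hx
  obtain ⟨u, v, huv⟩ := hG.1.exists_typeRat
  have hτ : u * v ∈ translations G := ⟨huv.infinite, u, v, huv.1, rfl⟩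
  obtain ⟨h, hh⟩ := hG.1.exists_homothety
  have hrange : Set.range (ConjClasses.carrier : ConjClasses G → Set G) =
      {{1}, involutions G, translations G, homotheties G} := by
    ext S
    constructor
    · rintro ⟨c, rfl⟩
      obtain ⟨x, rfl⟩ := ConjClasses.exists_rep c
      by_cases hx : IsOfFinOrder x
      · rcases hG.2.1 x hx with h1 | h1
        · exact Or.inl (c1 x (orderOf_eq_one_iff.1 h1))
        · exact Or.inr (Or.inl (c2 x h1))
      · rcases hinf x hx with h1 | h1
        · exact Or.inr (Or.inr (Or.inl (c3 x h1)))
        · exact Or.inr (Or.inr (Or.inr (c4 x h1)))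
    · rintro (rfl | rfl | rfl | rfl)
      · exact ⟨_, c1 1 rfl⟩
      · exact ⟨_, c2 u huv.1.1⟩
      · exact ⟨_, c3 _ hτ⟩
      · exact ⟨_, c4 h hh⟩
  refine ⟨?_, hrange⟩
  have hinj : Function.Injective (ConjClasses.carrier : ConjClasses G → Set G) := by
    intro c c' e
    obtain ⟨x, rfl⟩ := ConjClasses.exists_rep c
    have : x ∈ (ConjClasses.mk x).carrier := ConjClasses.mem_carrier_mk
    rw [e, ConjClasses.mem_carrier_iff_mk_eq] at this
    exact this
  have hu1 : u ≠ 1 := (mem_involutions_iff.1 huv.1.1).2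
  have huf := isOfFinOrder_of_involution huv.1.1
  have n1 : ({1} : Set G) ∉ ({involutions G, translations G, homotheties G} : Set (Set G)) := by
    have h1 : (1 : G) ∈ ({1} : Set G) := rfl
    rintro (e | e | e) <;> rw [e] at h1
    · exact (mem_involutions_iff.1 h1).2 rfl
    · exact h1.1 IsOfFinOrder.one
    · exact h1.1 IsOfFinOrder.one
  have n2 : involutions G ∉ ({translations G, homotheties G} : Set (Set G)) := by
    have h1 := huv.1.1
    rintro (e | e) <;> rw [e] at h1
    · exact h1.1 huf
    · exact h1.1 huf
  have n3 : translations G ≠ homotheties G := by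
    intro e
    obtain ⟨-, w, hw, hc⟩ := e ▸ hτ
    exact hG.1.not_translation_of_commute hτ hw hc
  rw [← Set.ncard_univ, ← Set.ncard_image_of_injective _ hinj, Set.image_univ, hrange,
    Set.ncard_insert_of_notMem n1, Set.ncard_insert_of_notMem n2, Set.ncard_pair n3]

end Conclusion

end SharpTwo

theorem mainTheorem7 (G₀ : Type u) [Group G₀] [Countable G₀] (hG₀ : SharpTwo.ClassC' G₀) :
    ∃ (G : Type u) (_ : Group G), Countable G ∧
      (∃ ι : G₀ →* G, Function.Injective ι) ∧
      SharpTwo.IsSharplyTwoTransitive G ∧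
      SharpTwo.ClassC' G ∧
      Nat.card (ConjClasses G) = 4 ∧
      Set.range (ConjClasses.carrier : ConjClasses G → Set G) =
        {{1}, SharpTwo.involutions G, SharpTwo.translations G, SharpTwo.homotheties G} := by
  open SharpTwo in
  obtain ⟨H, _, f, hcount, hf, hC, ⟨ι₀, hι₀⟩, hsettle⟩ := exists_chain hG₀
  obtain ⟨G, _, ι, hι, hcomp, hsurj⟩ := exists_union f hf
  have hcomp' : ∀ n x, ι (n + 1) (f n x) = ι n x := fun n x => by
    rw [← hcomp n (n + 1) (Nat.le_succ n) x, chainMap_succ f n n le_rfl, chainMap_self]; rfl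
  -- finitely many elements lie in a common group of the chain
  have hlift₂ : ∀ x y : G, ∃ (n : ℕ) (a b : H n), x = ι n a ∧ y = ι n b := by
    intro x y
    obtain ⟨n, a, rfl⟩ := hsurj x
    obtain ⟨m, b, rfl⟩ := hsurj y
    exact ⟨max n m, chainMap f n _ (le_max_left n m) a, chainMap f m _ (le_max_right n m) b,
      (hcomp _ _ _ _).symm, (hcomp _ _ _ _).symm⟩
  have hlift : ∀ x y z w : G, ∃ (n : ℕ) (a b c e : H n),
      x = ι n a ∧ y = ι n b ∧ z = ι n c ∧ w = ι n e := by
    intro x y z w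
    obtain ⟨n, a, b, rfl, rfl⟩ := hlift₂ x y
    obtain ⟨m, c, e, rfl, rfl⟩ := hlift₂ z w
    exact ⟨max n m, chainMap f n _ (le_max_left n m) a, chainMap f n _ (le_max_left n m) b,
      chainMap f m _ (le_max_right n m) c, chainMap f m _ (le_max_right n m) e,
      (hcomp _ _ _ _).symm, (hcomp _ _ _ _).symm, (hcomp _ _ _ _).symm, (hcomp _ _ _ _).symm⟩
  have hpair : ∀ u v : G, IsInvolutionPair u v →
      ∃ (n : ℕ) (a b : H n), u = ι n a ∧ v = ι n b ∧ IsTypeRat a b := by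
    intro u v huv
    obtain ⟨n, a, b, rfl, rfl⟩ := hlift₂ u v
    rw [IsInvolutionPair.map_iff (hι n)] at huv
    obtain ⟨m, h, hs⟩ := hsettle n a b
    exact ⟨m + 1, _, _, by rw [hcomp', hcomp], by rw [hcomp', hcomp],
      hs.pair ((IsInvolutionPair.map_iff (chainMap_injective f hf n m h)).2 huv)⟩
  have hrat : ∀ u v : G, IsInvolutionPair u v → IsTypeRat u v := by
    intro u v huv
    obtain ⟨n, a, b, rfl, rfl, hab⟩ := hpair u v huv
    exact hab.map (hι n)
  have hinf : ∀ h : G, ¬ IsOfFinOrder h → h ∈ translations G ∨ h ∈ homotheties G := by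
    intro h hh
    obtain ⟨n, a, rfl⟩ := hsurj h
    rw [isOfFinOrder_map_iff (hι n)] at hh
    obtain ⟨m, hm, hs⟩ := hsettle n a a
    have := hs.infinite (fun hf' => hh
      ((isOfFinOrder_map_iff (chainMap_injective f hf n m hm)).1 hf'))
    rw [← hcomp n m hm, ← hcomp']
    rcases this with h1 | h1
    · exact Or.inl (map_mem_translations (hι _) h1)
    · exact Or.inr (map_mem_homotheties (hι _) h1)
  have hhom : ∀ h ∈ homotheties G, ∀ h' ∈ homotheties G, ∃ g, g * h * g⁻¹ = h' := by
    rintro h ⟨h1, u, hu, hhu⟩ h' ⟨h1', u', hu', hhu'⟩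
    obtain ⟨n, a, b, c, e, rfl, rfl, rfl, rfl⟩ := hlift h u h' u'
    have ha : a ∈ homotheties (H n) := ⟨fun hf' => h1 ((isOfFinOrder_map_iff (hι n)).2 hf'), b,
      (map_mem_involutions (hι n)).1 hu, hι n (by rw [map_mul, map_mul, hhu])⟩
    have hc : c ∈ homotheties (H n) := ⟨fun hf' => h1' ((isOfFinOrder_map_iff (hι n)).2 hf'), e,
      (map_mem_involutions (hι n)).1 hu', hι n (by rw [map_mul, map_mul, hhu'])⟩
    obtain ⟨m, hm, hs⟩ := hsettle n a c
    have hi := chainMap_injective f hf n m hm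
    obtain ⟨γ, hγ⟩ := hs.conj (map_mem_homotheties hi ha) (map_mem_homotheties hi hc)
    refine ⟨ι _ γ, ?_⟩
    have := congrArg (ι (m + 1)) hγ
    rwa [map_mul, map_mul, map_inv, hcomp', hcomp', hcomp, hcomp] at this
  have hG : ClassC' G := by
    refine ⟨⟨?_, ?_, ?_, ?_, ?_⟩, ?_, ?_⟩
    · intro u hu v hv
      obtain ⟨n, a, b, rfl, rfl⟩ := hlift₂ u v
      obtain ⟨g, rfl⟩ := (hC n).1.transitive a ((map_mem_involutions (hι n)).1 hu) b
        ((map_mem_involutions (hι n)).1 hv)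
      exact ⟨ι n g, by simp⟩
    · intro u v huv g h1 h2
      obtain ⟨n, a, b, c, -, rfl, rfl, rfl, -⟩ := hlift u v g g
      rw [IsInvolutionPair.map_iff (hι n)] at huv
      rw [(hC n).1.free a b huv c (hι n (by simpa using h1)) (hι n (by simpa using h2)), map_one]
    · exact fun u v huv => Or.inr (hrat u v huv)
    · obtain ⟨u, v, huv⟩ := (hC 0).1.exists_typeRat
      exact ⟨_, _, huv.map (hι 0)⟩
    · intro u v u' v' huv huv'
      obtain ⟨n, a, b, rfl, rfl, hab⟩ := hpair u v huv.1
      obtain ⟨m, a', b', rfl, rfl, hab'⟩ := hpair u' v' huv'.1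
      obtain ⟨g, h1, h2⟩ := (hC (max n m)).1.transitive_typeRat _ _ _ _
        (hab.map (chainMap_injective f hf n _ (le_max_left n m)))
        (hab'.map (chainMap_injective f hf m _ (le_max_right n m)))
      refine ⟨ι _ g, ?_, ?_⟩
      · have := congrArg (ι _) h1
        rwa [map_mul, map_mul, map_inv, hcomp, hcomp] at this
      · have := congrArg (ι _) h2
        rwa [map_mul, map_mul, map_inv, hcomp, hcomp] at this
    · intro h hh
      obtain ⟨n, a, rfl⟩ := hsurj h
      rw [orderOf_injective _ (hι n)]
      exact (hC n).2.1 a ((isOfFinOrder_map_iff (hι n)).1 hh)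
    · intro h hh
      rcases hinf h hh with h1 | h1
      · exact Or.inl h1
      · exact Or.inr (Or.inl h1)
  refine ⟨G, inferInstance, ?_, ⟨(ι 0).comp ι₀, (hι 0).comp hι₀⟩,
    isSharplyTwoTransitive_of_isTypeRat hG.1 hrat, hG, conjClasses_eq hG hrat hinf hhom⟩
  rw [← Set.countable_univ_iff]
  exact (Set.countable_iUnion fun n => Set.countable_range (ι n)).mono fun x _ => by
    obtain ⟨n, y, rfl⟩ := hsurj x
    exact Set.mem_iUnion.2 ⟨n, y, rfl⟩
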